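/- Let $p$ be an odd prime, $q$ a power of $p$, $\ell\ne p$ a prime, and $E$ an ordinary elliptic curve over $\mathbb F_q$ with $q$-Frobenius endomorphism $\pi$. Let $\mathcal O=\operatorname{End}(E)$ be its endomorphism ring, $K=\mathcal O\otimes\mathbb Q$, $\mathcal O_K$ the maximal order of the number field $K$ and $d_K$ its discriminant. Assume that $\mathcal O$ is $\ell$-maximal, i.e. $\ell\nmid[\mathcal O_K:\mathcal O]$, and that the Kronecker symbol $(d_K/\ell)$ equals $+1$. Let $\lambda\ne\mu$ in $\mathbb Z_\ell$ be the two eigenvalues of $\pi$ on the Tate module $T_\ell(E)$. If $\ell$ is odd put $\alpha=v_\ell(\lambda^{\ell-1}-1)$ and $\beta=v_\ell(\mu^{\ell-1}-1)$; if $\ell=2$ put $\alpha=v_2(\lambda^2-1)-1$ and $\beta=v_2(\mu^2-1)-1$. Order the eigenvalues so that $\alpha\ge\beta$. For $k\ge1$ let $d_k$ be the degree of the smallest extension $F/\mathbb F_q$ (inside an algebraic closure of $\mathbb F_q$) such that $E[\ell^k]\subset E(F)$. Then: 1. The order of $q$ in $(\mathbb Z/\ell\mathbb Z)^\times$ divides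 $d_1$, and $d_1$ divides $\ell-1$. 2. If $\ell$ is odd, then $d_k=d_1\,\ell^{\max(v_\ell(d_1),\,k-\beta)}$ for all $k\ge1$ (here $v_\ell(d_1)=0$ by 1). 3. If $\ell=2$, then $d_2\in\{1,2\}$, and $d_k=2^{\max(v_2(d_2),\,k-\beta)}$ for all $k\ge2$. 4. Let $n\ge0$; if $\ell=2$, assume in addition that $n\ge1$ or $d_2=1$. If $[F:\mathbb F_q]=d_1\ell^n$, then the group $E[\ell^\infty](F)$ of points of $E(F)$ of $\ell$-power order is isomorphic to $(\mathbb Z/\ell^{n+\alpha}\mathbb Z)\times(\mathbb Z/\ell^{n+\beta}\mathbb Z)$. 5. For all $k\ge1$, the group $E[\ell^k]$ contains at most $k\cdot\ell^{k+\beta}$ Galois conjugacy classes over $F_1=\mathbb F_{q^{d_1}}$. -/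

import Mathlib

open scoped WeierstrassCurve.Affine Polynomial TensorProduct Classical

noncomputable section

/-! ### The Tate module of an abelian group -/

section TateModule

variable (ℓ : ℕ) [Fact ℓ.Prime] (A : Type*) [AddCommGroup A]

/-- `T_ℓ(A) = lim A[ℓ^n]`, the inverse limit along multiplication by `ℓ`: sequences `(x_n)` with
`x_0 = 0` and `ℓ x_{n+1} = x_n` (so that `x_n` lies in `A[ℓ^n]`). -/
def tateModule : AddSubgroup (ℕ → A) where
  carrier := {x | x 0 = 0 ∧ ∀ n, ℓ • x (n + 1) = x n}
  zero_mem' := ⟨rfl, fun n => by simp⟩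
  add_mem' := by
    rintro x y ⟨hx, hx'⟩ ⟨hy, hy'⟩
    exact ⟨by simp [hx, hy], fun n => by simp [smul_add, hx', hy']⟩
  neg_mem' := by
    rintro x ⟨hx, hx'⟩
    exact ⟨by simp [hx], fun n => by simp [hx']⟩

variable {ℓ A}

lemma tateModule_pow_smul (x : tateModule ℓ A) (n : ℕ) : ℓ ^ n • x.1 n = 0 := by
  induction n with
  | zero => simpa using x.2.1
  | succ n ih => rw [pow_succ, mul_smul, x.2.2 n, ih]

/-- Multiples of `x_n` depend only on the multiplier modulo `ℓ^n`. -/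
lemma tateModule_nsmul_congr (x : tateModule ℓ A) (n : ℕ) {a b : ℕ}
    (h : (a : ZMod (ℓ ^ n)) = b) : a • x.1 n = b • x.1 n := by
  rw [ZMod.natCast_eq_natCast_iff] at h
  have hd : addOrderOf (x.1 n) ∣ ℓ ^ n :=
    addOrderOf_dvd_of_nsmul_eq_zero (tateModule_pow_smul x n)
  exact (nsmul_eq_nsmul_iff_modEq).2 (h.of_dvd hd)

/-- `ℤ_ℓ` acts on `T_ℓ(A)` through the residues modulo `ℓ^n` on the `n`-th coordinate. -/
instance : SMul ℤ_[ℓ] (tateModule ℓ A) where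
  smul a x := ⟨fun n => (PadicInt.toZModPow n a).val • x.1 n, by
    refine ⟨by simp [x.2.1], fun n => ?_⟩
    have : NeZero (ℓ ^ n) := ⟨pow_ne_zero _ (Fact.out : ℓ.Prime).ne_zero⟩
    have : NeZero (ℓ ^ (n + 1)) := ⟨pow_ne_zero _ (Fact.out : ℓ.Prime).ne_zero⟩
    rw [smul_comm, x.2.2 n]
    apply tateModule_nsmul_congr
    have h := PadicInt.cast_toZModPow n (n + 1) n.le_succ a
    rw [ZMod.natCast_zmod_val, ← h, ZMod.cast_eq_val]⟩

lemma tateModule_smul_apply (a : ℤ_[ℓ]) (x : tateModule ℓ A) (n : ℕ) :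
    (a • x).1 n = (PadicInt.toZModPow n a).val • x.1 n := rfl

instance : Module ℤ_[ℓ] (tateModule ℓ A) where
  one_smul x := by
    ext n
    have : NeZero (ℓ ^ n) := ⟨pow_ne_zero _ (Fact.out : ℓ.Prime).ne_zero⟩
    rw [tateModule_smul_apply, tateModule_nsmul_congr x n (b := 1) (by simp), one_smul]
  mul_smul a b x := by
    ext n
    have : NeZero (ℓ ^ n) := ⟨pow_ne_zero _ (Fact.out : ℓ.Prime).ne_zero⟩
    rw [tateModule_smul_apply, tateModule_smul_apply, tateModule_smul_apply, ← mul_smul]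
    exact tateModule_nsmul_congr x n (by simp)
  smul_zero a := by
    ext n
    rw [tateModule_smul_apply]
    exact smul_zero _
  zero_smul x := by
    ext n
    rw [tateModule_smul_apply, tateModule_nsmul_congr x n (b := 0) (by simp), zero_smul]
    rfl
  smul_add a x y := by
    ext n
    exact smul_add _ (x.1 n) (y.1 n)
  add_smul a b x := by
    ext n
    have : NeZero (ℓ ^ n) := ⟨pow_ne_zero _ (Fact.out : ℓ.Prime).ne_zero⟩
    change _ = (PadicInt.toZModPow n a).val • x.1 n + (PadicInt.toZModPow n b).val • x.1 n
    rw [tateModule_smul_apply, ← add_smul]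
    exact tateModule_nsmul_congr x n (by simp)

variable (ℓ) in
/-- The `ℤ_ℓ`-linear endomorphism of `T_ℓ(A)` induced by an endomorphism of `A`. -/
def tateMap (φ : A →+ A) : Module.End ℤ_[ℓ] (tateModule ℓ A) where
  toFun x := ⟨fun n => φ (x.1 n), by simp [x.2.1], fun n => by rw [← map_nsmul, x.2.2 n]⟩
  map_add' x y := by
    ext n
    exact map_add φ (x.1 n) (y.1 n)
  map_smul' a x := by
    ext n
    exact map_nsmul φ _ (x.1 n)

end TateModule

/-! ### Elliptic curves over a finite field -/

section Curve

variable {k : Type*} [Field k] (E : WeierstrassCurve k)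

/-- The group `E(k̄)` of geometric points. -/
abbrev GeomPoint : Type _ := (E⁄(AlgebraicClosure k)).Point

/-- In characteristic `p`, a curve `E` is ordinary if it has a geometric point of order `p`. -/
def IsOrdinary (p : ℕ) : Prop := ∃ P : GeomPoint E, P ≠ 0 ∧ p • P = 0

/-- The `q`-Frobenius endomorphism `(x, y) ↦ (x^q, y^q)` of `E`, on geometric points. -/
def curveFrobenius [Fintype k] : GeomPoint E →+ GeomPoint E :=
  WeierstrassCurve.Affine.Point.map (FiniteField.frobeniusAlgHom k (AlgebraicClosure k))

/-- A homomorphism `φ : E(k̄) → E(k̄)` is algebraic if it is zero or is given, at all but finitely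
many points, by rational functions: `φ(x, y) = (f₁(x, y) / g₁(x, y), f₂(x, y) / g₂(x, y))`. -/
def IsAlgebraicHom (φ : GeomPoint E →+ GeomPoint E) : Prop :=
  φ = 0 ∨ ∃ f₁ g₁ f₂ g₂ : (AlgebraicClosure k)[X][X], ∃ S : Set (GeomPoint E), S.Finite ∧
    ∀ (x y : AlgebraicClosure k) (h : (E⁄(AlgebraicClosure k)).Nonsingular x y),
      WeierstrassCurve.Affine.Point.some x y h ∉ S →
        g₁.evalEval x y ≠ 0 ∧ g₂.evalEval x y ≠ 0 ∧
        ∃ h', φ (.some x y h) = .some (f₁.evalEval x y / g₁.evalEval x y)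
          (f₂.evalEval x y / g₂.evalEval x y) h'

/-- The ring `End(E)` of (geometric) endomorphisms of `E`, acting on `E(k̄)`. The algebraic
homomorphisms are already closed under sums and composition, so taking the subring which they
generate adds no further element. -/
def endRing : Subring (AddMonoid.End (GeomPoint E)) :=
  Subring.closure {φ | IsAlgebraicHom E φ}

/-- The field of definition of `E[m]` in `k̄`: the extension of `k` generated by the coordinates of
the `m`-torsion points, i.e. the smallest `F` with `E[m] ⊆ E(F)`. -/
def torsionField (m : ℕ) : IntermediateField k (AlgebraicClosure k) :=
  IntermediateField.adjoin k {z | ∃ x y h,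
    m • (WeierstrassCurve.Affine.Point.some x y h : GeomPoint E) = 0 ∧ (z = x ∨ z = y)}

/-- The degree over `k` of the field of definition of `E[m]`. -/
def torsionDegree (m : ℕ) : ℕ := Module.finrank k (torsionField E m)

/-- The subgroup `E[ℓ^∞](F)` of points of `E(F)` killed by a power of `ℓ`. -/
def ellPowerTorsion (ℓ : ℕ) (F : IntermediateField k (AlgebraicClosure k)) :
    AddSubgroup (E⁄F).Point where
  carrier := {P | ∃ m : ℕ, ℓ ^ m • P = 0}
  zero_mem' := ⟨0, by simp⟩
  add_mem' := by
    rintro P Q ⟨m, hm⟩ ⟨n, hn⟩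
    refine ⟨m + n, ?_⟩
    rw [smul_add, pow_add, mul_smul _ _ Q, hn, mul_comm, mul_smul, hm, smul_zero, smul_zero,
      add_zero]
  neg_mem' := by
    rintro P ⟨m, hm⟩
    exact ⟨m, by rw [smul_neg, hm, neg_zero]⟩

/-- Points of `E[m]` which are conjugate under `Gal(k̄ / F)`. -/
def galoisSetoid (F : IntermediateField k (AlgebraicClosure k)) (m : ℕ) :
    Setoid {P : GeomPoint E // m • P = 0} where
  r P Q := ∃ σ : AlgebraicClosure k ≃ₐ[F] AlgebraicClosure k,
    WeierstrassCurve.Affine.Point.map (W' := E) σ.toAlgHom P.1 = Q.1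
  iseqv := by
    refine ⟨fun P => ⟨.refl, ?_⟩, ?_, ?_⟩
    · rcases P with ⟨_ | ⟨x, y, h⟩, hP⟩ <;> rfl
    · rintro P Q ⟨σ, h⟩
      refine ⟨σ.symm, ?_⟩
      rw [← h, WeierstrassCurve.Affine.Point.map_map]
      have : σ.symm.toAlgHom.comp σ.toAlgHom = AlgHom.id F _ := by
        ext x
        simp
      rw [this]
      rcases P with ⟨_ | ⟨x, y, h⟩, hP⟩ <;> rfl
    · rintro P Q R ⟨σ, h⟩ ⟨τ, h'⟩
      refine ⟨σ.trans τ, ?_⟩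
      rw [← h', ← h, WeierstrassCurve.Affine.Point.map_map]
      rfl

/-- The Galois conjugacy classes of `E[m]` over `F`. -/
abbrev GaloisClass (F : IntermediateField k (AlgebraicClosure k)) (m : ℕ) : Type _ :=
  Quotient (galoisSetoid E F m)

/-- The image of `𝒪 = End(E)` in a ring `K` that is identified with `𝒪 ⊗ ℚ`. -/
def endImage {K : Type*} [Ring K] (e : (ℚ ⊗[ℤ] endRing E) ≃+* K) : Subring K :=
  (e.toRingHom.comp
    (Algebra.TensorProduct.includeRight : endRing E →ₐ[ℤ] ℚ ⊗[ℤ] endRing E).toRingHom).range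

/-- `𝒪 = End(E)` is `ℓ`-maximal: `ℓ` does not divide the index of `𝒪` in the maximal order of the
number field `K = 𝒪 ⊗ ℚ`. -/
def IsEllMaximal (ℓ : ℕ) {K : Type*} [Field K] (e : (ℚ ⊗[ℤ] endRing E) ≃+* K) : Prop :=
  ¬ ℓ ∣ (endImage E e).toAddSubgroup.relIndex (integralClosure ℤ K).toSubring.toAddSubgroup

end Curve

/-- The Kronecker symbol `(d / ℓ)` for a prime `ℓ`: the Legendre symbol if `ℓ` is odd, and for
`ℓ = 2` it is `0` for even `d`, `1` for `d ≡ ±1` and `-1` for `d ≡ ±3` modulo `8`. -/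
def kroneckerAtPrime (d : ℤ) (ℓ : ℕ) [Fact ℓ.Prime] : ℤ :=
  if ℓ = 2 then ZMod.χ₈ (d : ZMod 8) else legendreSym ℓ d

/-- `v_ℓ(x^(ℓ-1) - 1)` if `ℓ` is odd and `v_2(x² - 1) - 1` if `ℓ = 2`, for an `ℓ`-adic unit `x`
that is not a root of unity. -/
def unitLevel {ℓ : ℕ} [Fact ℓ.Prime] (x : ℤ_[ℓ]) : ℕ :=
  if ℓ = 2 then (x ^ 2 - 1).valuation - 1 else (x ^ (ℓ - 1) - 1).valuation

end

/-! Everything follows once T_ℓ(E) has a basis of eigenvectors v, w of Frobenius. Then π^N acts on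
E[ℓ^k] as the diagonal matrix (λ^N, μ^N) modulo ℓ^k, and d_k is the order of π on E[ℓ^k]. So d_k
divides N iff ℓ^k divides both λ^N - 1 and μ^N - 1. Lifting the exponent
(`PadicInt.valuation_pow_sub_one`) shows that along multiples of d_1 (of d_2 if ℓ = 2) these numbers
have valuations α + v_ℓ(N) and β + v_ℓ(N). The degrees and the fixed subgroups are read off from
this. For the conjugacy classes, a point whose w-coordinate has exact order ℓ^t with t > β has at
least ℓ^(t-β) conjugates, which leaves at most ℓ^(k+β) classes for each t.

Primitive eigenvectors need not form a basis, since λ and μ may agree modulo ℓ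
(`isTateBasis_of_eigenvectors` settles this). End(E) acts on the two eigenlines through characters,
which extend to two distinct embeddings of K in ℚ_ℓ. If these agreed modulo ℓ on the maximal order,
the matrix whose squared determinant is d_K would have two congruent columns, and ℓ would divide d_K
(`exists_not_dvd_sub`). So some integer of K, and by ℓ-maximality some endomorphism, has eigenvalues
that differ modulo ℓ, and its eigenlines are independent modulo ℓ.

Two facts about E are needed: E[ℓ] has ℓ² points, and λμ ≡ q modulo ℓ. Both come from counting
kernels through x-coordinates. If φ, ψ and φ - ψ act on x by rational functions, so does φ + ψ, and
the degrees obey the parallelogram law (`IsXRational.add`). Hence m has degree m² and m - π has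
degree m² - tm + q. A homomorphism with nonzero Wronskian has as many kernel points as its degree
(`IsXRational.card_ker`). Divisibility by ℓ of the second count identifies λ and μ modulo ℓ as the
roots of X² - tX + q. -/

/-! ### Sums and differences of points on `x`-coordinates -/

namespace WeierstrassCurve

section AddSub

variable {R : Type*} [CommRing R] (W : WeierstrassCurve R)

/-- The first of the forms which give `(x(P+Q)x(P-Q) : x(P+Q)+x(P-Q) : 1)` in terms of
`(s : t : u) = (x(P)x(Q) : x(P)+x(Q) : 1)`. -/
def addSubProd (s t u : R) : R := s ^ 2 - W.b₄ * s * u - W.b₆ * t * u - W.b₈ * u ^ 2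

/-- The second of these forms. -/
def addSubSum (s t u : R) : R := 2 * t * s + W.b₂ * s * u + W.b₄ * t * u + W.b₆ * u ^ 2

/-- The third of these forms. -/
def addSubDen (s t u : R) : R := t ^ 2 - 4 * s * u

variable {W} in
-- The three forms are the coordinates of `addSubMap`, which has no nontrivial zero on an elliptic
-- curve. This is what keeps fractions reduced under addition.
lemma addSub_eq_zero [IsReduced R] [W.IsElliptic] {s t u : R} (h₀ : W.addSubProd s t u = 0)
    (h₁ : W.addSubSum s t u = 0) (h₂ : addSubDen s t u = 0) : s = 0 ∧ t = 0 ∧ u = 0 := by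
  by_contra h
  have hx : ![s, t, u] ≠ 0 := fun H => h ⟨congrFun H 0, congrFun H 1, congrFun H 2⟩
  refine addSubMap_ne_zero W hx (funext fun i => ?_)
  fin_cases i
  · simpa [addSubMap, addSubProd] using h₀
  · simpa [addSubMap, addSubSum] using h₁
  · simpa [addSubMap, addSubDen] using h₂

end AddSub

namespace Affine.Point

set_option linter.unusedSectionVars false

variable {F : Type*} [Field F] [DecidableEq F] {W : WeierstrassCurve F} [W.IsElliptic]

lemma sub_of_X_ne {x₁ x₂ y₁ y₂ : F} {h₁ : W.toAffine.Nonsingular x₁ y₁}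
    {h₂ : W.toAffine.Nonsingular x₂ y₂} (hx : x₁ ≠ x₂) :
    ∃ h, some x₁ y₁ h₁ - some x₂ y₂ h₂ =
      some (W.toAffine.addX x₁ x₂ (W.toAffine.slope x₁ x₂ y₁ (W.toAffine.negY x₂ y₂)))
        (W.toAffine.addY x₁ x₂ y₁ (W.toAffine.slope x₁ x₂ y₁ (W.toAffine.negY x₂ y₂))) h := by
  rw [sub_eq_add_neg, neg_some, add_of_X_ne hx]
  exact ⟨_, rfl⟩

lemma neg_some_eq_iff {x y : F} (h : W.toAffine.Nonsingular x y) :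
    -some x y h = some x y h ↔ y - W.toAffine.negY x y = 0 := by
  rw [neg_some, some.injEq, sub_eq_zero]
  exact ⟨fun h => h.2.symm, fun h => ⟨rfl, h.symm⟩⟩

/-- Completing the square: y - negY is 2y + a₁x + a₃, so its square depends on x alone. -/
lemma sq_sub_negY {x y : F} (h : W.toAffine.Equation x y) :
    (y - W.toAffine.negY x y) ^ 2 = 4 * x ^ 3 + W.b₂ * x ^ 2 + 2 * W.b₄ * x + W.b₆ := by
  rw [equation_iff] at h
  simp only [negY, b₂, b₄, b₆]
  linear_combination 4 * h

/-- The affine form of the addition-and-subtraction formula, when `Q = P`. -/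
lemma exists_addSub_self {x y : F} (h : W.toAffine.Nonsingular x y) :
    ∃ c : F, c ≠ 0 ∧ (some x y h + some x y h).xRep 0 = c * W.addSubProd (x * x) (x + x) 1 ∧
      (some x y h + some x y h).xRep 1 = c * W.addSubSum (x * x) (x + x) 1 ∧
      (some x y h + some x y h).xRep 1 = c * (y - W.toAffine.negY x y) ^ 2 := by
  have hsum : W.addSubSum (x * x) (x + x) 1 = (y - W.toAffine.negY x y) ^ 2 := by
    rw [sq_sub_negY h.1, addSubSum]; ring
  by_cases hy : y = W.toAffine.negY x y
  · have h2 : some x y h + some x y h = 0 := add_self_of_Y_eq hy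
    have hz : W.addSubSum (x * x) (x + x) 1 = 0 := by rw [hsum, sub_eq_zero.2 hy]; ring
    -- On the diagonal the third form vanishes, and here the second does too, so the first cannot.
    have h0 : W.addSubProd (x * x) (x + x) 1 ≠ 0 := fun h0 =>
      one_ne_zero (addSub_eq_zero h0 hz (by rw [addSubDen]; ring)).2.2
    refine ⟨(W.addSubProd (x * x) (x + x) 1)⁻¹, inv_ne_zero h0, ?_, ?_, ?_⟩
    · rw [h2, inv_mul_cancel₀ h0]; rfl
    · rw [h2, hz, mul_zero]; rfl
    · rw [h2, ← hsum, hz, mul_zero]; rfl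
  · have hη : y - W.toAffine.negY x y ≠ 0 := sub_ne_zero.2 hy
    refine ⟨((y - W.toAffine.negY x y) ^ 2)⁻¹, inv_ne_zero (pow_ne_zero 2 hη), ?_, ?_, ?_⟩
    · rw [add_self_of_Y_ne hy, xRep_some, slope_of_Y_ne rfl hy, eq_inv_mul_iff_mul_eq₀ (pow_ne_zero 2 hη)]
      have he := (equation_iff ..).1 h.1
      simp only [Matrix.cons_val_zero, addX, addSubProd]
      field_simp
      simp only [negY, b₄, b₆, b₈]
      linear_combination (-(W.a₁ ^ 2 + 4 * W.a₂ + 8 * x)) * he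
    · rw [add_self_of_Y_ne hy, xRep_some, hsum, inv_mul_cancel₀ (pow_ne_zero 2 hη)]; rfl
    · rw [add_self_of_Y_ne hy, xRep_some, inv_mul_cancel₀ (pow_ne_zero 2 hη)]; rfl

/-- The addition-and-subtraction formula for affine points, together with the formula for the
difference of the two `x`-coordinates. -/
lemma exists_addSub_some {x₁ x₂ y₁ y₂ : F} (h₁ : W.toAffine.Nonsingular x₁ y₁)
    (h₂ : W.toAffine.Nonsingular x₂ y₂) :
    ∃ c : F, c ≠ 0 ∧
      (some _ _ h₁ + some _ _ h₂).xRep 0 * (some _ _ h₁ - some _ _ h₂).xRep 0 =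
        c * W.addSubProd (x₁ * x₂) (x₁ + x₂) 1 ∧
      (some _ _ h₁ + some _ _ h₂).xRep 0 * (some _ _ h₁ - some _ _ h₂).xRep 1 +
        (some _ _ h₁ + some _ _ h₂).xRep 1 * (some _ _ h₁ - some _ _ h₂).xRep 0 =
        c * W.addSubSum (x₁ * x₂) (x₁ + x₂) 1 ∧
      (some _ _ h₁ + some _ _ h₂).xRep 1 * (some _ _ h₁ - some _ _ h₂).xRep 1 =
        c * addSubDen (x₁ * x₂) (x₁ + x₂) 1 ∧
      (some _ _ h₁ + some _ _ h₂).xRep 1 * (some _ _ h₁ - some _ _ h₂).xRep 0 -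
        (some _ _ h₁ + some _ _ h₂).xRep 0 * (some _ _ h₁ - some _ _ h₂).xRep 1 =
        c * ((y₁ - W.toAffine.negY x₁ y₁) * (y₂ - W.toAffine.negY x₂ y₂)) := by
  by_cases hx : x₁ = x₂
  · subst hx
    obtain ⟨c, hc, e₀, e₁, e₂⟩ := exists_addSub_self h₁
    have hden : addSubDen (x₁ * x₁) (x₁ + x₁) 1 = 0 := by rw [addSubDen]; ring
    -- Equal x-coordinates force Q = P or Q = -P. Both cases are the duplication formula, with sum
    -- and difference exchanged.
    rcases Y_eq_of_X_eq h₁.1 h₂.1 rfl with hy | hy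
    · subst hy
      refine ⟨c, hc, ?_, ?_, ?_, ?_⟩ <;> rw [sub_self] <;> simp only [xRep_zero,
        Matrix.cons_val_zero, Matrix.cons_val_one, mul_one, mul_zero, zero_add, sub_zero, hden]
      · exact e₀
      · exact e₁
      · rw [e₂]; ring
    · have hQ : some x₁ y₂ h₂ = -some x₁ y₁ h₁ := by
        rw [neg_some, some.injEq, hy, negY_negY]; exact ⟨rfl, rfl⟩
      have hy' : y₂ - W.toAffine.negY x₁ y₂ = -(y₁ - W.toAffine.negY x₁ y₁) := by
        rw [hy, negY_negY]; ring
      refine ⟨c, hc, ?_, ?_, ?_, ?_⟩ <;> rw [hQ, add_neg_cancel, sub_neg_eq_add] <;>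
        simp only [xRep_zero,
        Matrix.cons_val_zero, Matrix.cons_val_one, one_mul, zero_mul, add_zero, zero_sub, hden,
        mul_zero]
      · exact e₀
      · exact e₁
      · rw [e₂, hy']; ring
  · obtain ⟨h, hs⟩ := sub_of_X_ne (h₁ := h₁) (h₂ := h₂) hx
    have hd : x₁ - x₂ ≠ 0 := sub_ne_zero.2 hx
    have e₁ := (equation_iff ..).1 h₁.1
    have e₂ := (equation_iff ..).1 h₂.1
    refine ⟨((x₁ - x₂) ^ 2)⁻¹, inv_ne_zero (pow_ne_zero 2 hd), ?_, ?_, ?_, ?_⟩ <;>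
      rw [add_of_X_ne hx, hs] <;>
      simp only [xRep_some, Matrix.cons_val_zero, Matrix.cons_val_one, slope_of_X_ne hx, addX,
        addSubProd, addSubSum, addSubDen, negY, b₂, b₄, b₆, b₈, one_pow, mul_one, one_mul]
    · field_simp
      linear_combination (
        y₁ ^ 2 + y₁ * W.a₃ + x₁ * y₁ * W.a₁ - 2 * y₂ ^ 2 - 2 * x₂ * y₂ * W.a₁ - 2 * y₂ * W.a₃ - 
          x₂ * W.a₁ * W.a₃ + x₁ * x₂ * W.a₁ ^ 2 + x₁ * W.a₁ * W.a₃ - x₁ ^ 2 * W.a₂ + 4 * x₁ * x₂ 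
          * W.a₂ - 2 * x₂ ^ 2 * W.a₂ - x₁ ^ 3 + 2 * x₁ ^ 2 * x₂ + 2 * x₁ * x₂ ^ 2 - 2 * x₂ ^ 3 - 
          x₂ ^ 2 * W.a₁ ^ 2 + x₁ * W.a₄ + W.a₆) * e₁ + (
        y₂ ^ 2 + x₂ * y₂ * W.a₁ + y₂ * W.a₃ + x₂ * W.a₁ * W.a₃ + x₁ * x₂ * W.a₁ ^ 2 - x₁ * W.a₁ 
          * W.a₃ - 4 * x₁ ^ 2 * W.a₂ + 4 * x₁ * x₂ * W.a₂ - x₂ ^ 2 * W.a₂ - 4 * x₁ ^ 3 + 2 * x₁ 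
          ^ 2 * x₂ + 2 * x₁ * x₂ ^ 2 - x₂ ^ 3 - x₁ ^ 2 * W.a₁ ^ 2 - 2 * x₁ * W.a₄ - W.a₆ + x₂ * 
          W.a₄) * e₂
    · field_simp
      linear_combination 2*e₁ + 2*e₂
    · field_simp
      ring
    · field_simp
      ring

/-- The addition-and-subtraction formula on `x`-coordinates in `ℙ¹`. -/
lemma exists_addSub (P Q : W.toAffine.Point) :
    ∃ c : F, c ≠ 0 ∧
      (P + Q).xRep 0 * (P - Q).xRep 0 = c * W.addSubProd (P.xRep 0 * Q.xRep 0)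
        (P.xRep 0 * Q.xRep 1 + P.xRep 1 * Q.xRep 0) (P.xRep 1 * Q.xRep 1) ∧
      (P + Q).xRep 0 * (P - Q).xRep 1 + (P + Q).xRep 1 * (P - Q).xRep 0 =
        c * W.addSubSum (P.xRep 0 * Q.xRep 0)
        (P.xRep 0 * Q.xRep 1 + P.xRep 1 * Q.xRep 0) (P.xRep 1 * Q.xRep 1) ∧
      (P + Q).xRep 1 * (P - Q).xRep 1 = c * addSubDen (P.xRep 0 * Q.xRep 0)
        (P.xRep 0 * Q.xRep 1 + P.xRep 1 * Q.xRep 0) (P.xRep 1 * Q.xRep 1) := by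
  rcases P with _ | ⟨x₁, y₁, h₁⟩
  · refine ⟨1, one_ne_zero, ?_⟩
    rw [← zero_def, zero_add, zero_sub, xRep_neg]
    simp only [addSubProd, addSubSum, addSubDen, xRep_zero, Matrix.cons_val_zero,
      Matrix.cons_val_one]
    exact ⟨by ring, by ring, by ring⟩
  rcases Q with _ | ⟨x₂, y₂, h₂⟩
  · refine ⟨1, one_ne_zero, ?_⟩
    rw [← zero_def, add_zero, sub_zero]
    simp only [addSubProd, addSubSum, addSubDen, xRep_zero, Matrix.cons_val_zero,
      Matrix.cons_val_one]
    exact ⟨by ring, by ring, by ring⟩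
  obtain ⟨c, hc, e₀, e₁, e₂, -⟩ := exists_addSub_some h₁ h₂
  refine ⟨c, hc, ?_, ?_, ?_⟩
  · simpa only [xRep_some, Matrix.cons_val_zero, Matrix.cons_val_one, mul_one, one_mul] using e₀
  · simpa only [xRep_some, Matrix.cons_val_zero, Matrix.cons_val_one, mul_one, one_mul] using e₁
  · simpa only [xRep_some, Matrix.cons_val_zero, Matrix.cons_val_one, mul_one, one_mul] using e₂

end Affine.Point

end WeierstrassCurve

/-! ### Homomorphisms which are rational on `x`-coordinates -/

namespace WeierstrassCurve

set_option linter.unusedSectionVars false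

open Polynomial WeierstrassCurve.Affine WeierstrassCurve.Affine.Point

/-! ### Degrees and values of the three forms on polynomials -/

section Degree

variable {F : Type*} [Field F] (W : WeierstrassCurve F)

/-- This bounds every monomial of the forms other than s²: one factor has degree strictly below that
of s, so s² dominates without cancellation. -/
lemma degree_C_mul_mul_lt (b : F) {s q r : F[X]} (hq : q.degree ≤ s.degree)
    (hr : r.degree < s.degree) : (C b * q * r).degree < (s ^ 2).degree := by
  have hs : s ≠ 0 := by rintro rfl; simp at hr
  by_cases hr0 : r = 0
  · rw [hr0, mul_zero, degree_zero, bot_lt_iff_ne_bot, Ne, degree_eq_bot]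
    exact pow_ne_zero 2 hs
  have hrb : r.degree ≠ ⊥ := by rwa [Ne, degree_eq_bot]
  have hsb : s.degree ≠ ⊥ := by rwa [Ne, degree_eq_bot]
  calc (C b * q * r).degree ≤ (C b * q).degree + r.degree := degree_mul_le ..
    _ ≤ s.degree + r.degree := by
        gcongr
        rw [← smul_eq_C_mul]
        exact (degree_smul_le ..).trans hq
    _ < s.degree + s.degree := WithBot.add_lt_add_left hsb hr
    _ = (s ^ 2).degree := by rw [sq, degree_mul]

lemma degree_addSubProd {s t u : F[X]} (ht : t.degree < s.degree) (hu : u.degree < s.degree) :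
    ((W.map C).addSubProd s t u).degree = (s ^ 2).degree := by
  simp only [addSubProd, map_b₄, map_b₆, map_b₈]
  have h₁ : (s ^ 2 - C W.b₄ * s * u).degree = (s ^ 2).degree :=
    degree_sub_eq_left_of_degree_lt (degree_C_mul_mul_lt _ le_rfl hu)
  have h₂ : (s ^ 2 - C W.b₄ * s * u - C W.b₆ * t * u).degree = (s ^ 2).degree := by
    rw [degree_sub_eq_left_of_degree_lt, h₁]
    rw [h₁]; exact degree_C_mul_mul_lt _ ht.le hu
  rw [degree_sub_eq_left_of_degree_lt, h₂]
  rw [h₂, sq u, ← mul_assoc]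
  exact degree_C_mul_mul_lt _ hu.le hu

lemma degree_addSubSum_lt {s t u : F[X]} (ht : t.degree < s.degree) (hu : u.degree < s.degree) :
    ((W.map C).addSubSum s t u).degree < (s ^ 2).degree := by
  simp only [addSubSum, map_b₂, map_b₄, map_b₆]
  refine (degree_add_le ..).trans_lt (max_lt ((degree_add_le ..).trans_lt
    (max_lt ((degree_add_le ..).trans_lt (max_lt ?_ ?_)) ?_)) ?_)
  · rw [mul_right_comm, show (2 : F[X]) = C 2 from (map_ofNat C 2).symm]
    exact degree_C_mul_mul_lt _ le_rfl ht
  · exact degree_C_mul_mul_lt _ le_rfl hu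
  · exact degree_C_mul_mul_lt _ ht.le hu
  · rw [sq u, ← mul_assoc]
    exact degree_C_mul_mul_lt _ hu.le hu

lemma eval_addSubProd (s t u : F[X]) (x : F) : ((W.map C).addSubProd s t u).eval x =
    W.addSubProd (s.eval x) (t.eval x) (u.eval x) := by
  simp [addSubProd]

lemma eval_addSubSum (s t u : F[X]) (x : F) : ((W.map C).addSubSum s t u).eval x =
    W.addSubSum (s.eval x) (t.eval x) (u.eval x) := by
  simp [addSubSum]

lemma eval_addSubDen (s t u : F[X]) (x : F) : (addSubDen s t u).eval x =
    addSubDen (s.eval x) (t.eval x) (u.eval x) := by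
  simp [addSubDen]

end Degree

variable {F : Type*} [Field F] [DecidableEq F] {W : WeierstrassCurve F}

/-- The homomorphism `φ` acts on `x`-coordinates through the reduced fraction `A / B`, whose
numerator has the larger degree. -/
structure IsXRational (φ : W.toAffine.Point →+ W.toAffine.Point) (A B : F[X]) : Prop where
  isCoprime : IsCoprime A B
  degree_lt : B.degree < A.degree
  cross : ∀ (x y : F) (h : W.toAffine.Nonsingular x y),
    (φ (some x y h)).xRep 0 * B.eval x = (φ (some x y h)).xRep 1 * A.eval x

/-- Since every x lifts to a point, polynomial identities in x can be verified at points of the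
curve. -/
lemma exists_nonsingular [IsAlgClosed F] [W.IsElliptic] (x : F) :
    ∃ y, W.toAffine.Nonsingular x y := by
  obtain ⟨y, hy⟩ := IsAlgClosed.exists_root (W.toAffine.polynomial.map (evalRingHom x)) (by
    rw [Polynomial.Monic.degree_map monic_polynomial, degree_polynomial]
    decide)
  refine ⟨y, (equation_iff_nonsingular (W := W.toAffine)).1 ?_⟩
  rw [Equation, ← map_evalRingHom_eval]
  exact hy

lemma Affine.Point.xRep_cases (P : W.toAffine.Point) :
    (P.xRep 0 = 1 ∧ P.xRep 1 = 0) ∨ P.xRep 1 = 1 := by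
  rcases P with _ | _
  · exact .inl ⟨rfl, rfl⟩
  · exact .inr rfl

namespace IsXRational

variable {φ ψ : W.toAffine.Point →+ W.toAffine.Point} {A B C₁ D A' B' : F[X]}

lemma ne_zero (h : IsXRational φ A B) : A ≠ 0 := by
  rintro rfl
  simpa using h.degree_lt

lemma eval_ne_zero (h : IsXRational φ A B) (x : F) : A.eval x ≠ 0 ∨ B.eval x ≠ 0 := by
  obtain ⟨a, b, hab⟩ := h.isCoprime
  by_contra! H
  simpa [H.1, H.2] using congrArg (eval x) hab

/-- Coprimality makes (A(x) : B(x)) a genuine point of ℙ¹, so the cross relation becomes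
proportionality with a nonzero factor. -/
lemma exists_smul (hφ : IsXRational φ A B) {x y : F} (h : W.toAffine.Nonsingular x y) :
    ∃ r : F, r ≠ 0 ∧ A.eval x = r * (φ (some x y h)).xRep 0 ∧
      B.eval x = r * (φ (some x y h)).xRep 1 := by
  have hc := hφ.cross x y h
  have hn := hφ.eval_ne_zero x
  rcases xRep_cases (φ (some x y h)) with ⟨h0, h1⟩ | h1
  · rw [h0, h1, one_mul, zero_mul] at hc
    exact ⟨A.eval x, hn.resolve_right (not_not.2 hc), by rw [h0, mul_one], by rw [hc, h1, mul_zero]⟩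
  · rw [h1, one_mul] at hc
    refine ⟨B.eval x, fun h => ?_, by rw [← hc, mul_comm], by rw [h1, mul_one]⟩
    rw [h, mul_zero] at hc
    exact hn.elim (fun h' => h' hc.symm) fun h' => h' h

lemma neg (hφ : IsXRational φ A B) : IsXRational (-φ) A B :=
  ⟨hφ.isCoprime, hφ.degree_lt, fun x y h => by
    rw [AddMonoidHom.neg_apply, xRep_neg]; exact hφ.cross x y h⟩

lemma zero : IsXRational (0 : W.toAffine.Point →+ W.toAffine.Point) 1 0 :=
  ⟨isCoprime_one_left, by simp, fun x y h => by simp⟩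

lemma id : IsXRational (AddMonoidHom.id W.toAffine.Point) X 1 :=
  ⟨isCoprime_one_right, by simp, fun x y h => by simp⟩

/-- If `φ`, `ψ` and `φ - ψ` are rational on `x`-coordinates, then so is `φ + ψ`. -/
theorem add [IsAlgClosed F] [W.IsElliptic] (hφ : IsXRational φ A B) (hψ : IsXRational ψ C₁ D)
    (hsub : IsXRational (φ - ψ) A' B') :
    ∃ A'' B'', IsXRational (φ + ψ) A'' B'' ∧
      A' * A'' = (W.map C).addSubProd (A * C₁) (A * D + B * C₁) (B * D) ∧
      A' * B'' + B' * A'' = (W.map C).addSubSum (A * C₁) (A * D + B * C₁) (B * D) ∧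
      B' * B'' = addSubDen (A * C₁) (A * D + B * C₁) (B * D) ∧
      A'.natDegree + A''.natDegree = 2 * (A.natDegree + C₁.natDegree) := by
  set N₀ := (W.map C).addSubProd (A * C₁) (A * D + B * C₁) (B * D) with hN₀
  set N₁ := (W.map C).addSubSum (A * C₁) (A * D + B * C₁) (B * D) with hN₁
  set N₂ := addSubDen (A * C₁) (A * D + B * C₁) (B * D) with hN₂
  -- the values of the three forms at a point
  have key (x y : F) (h : W.toAffine.Nonsingular x y) : ∃ r : F, r ≠ 0 ∧
      N₀.eval x = r * (((φ + ψ) (some x y h)).xRep 0 * ((φ - ψ) (some x y h)).xRep 0) ∧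
      N₁.eval x = r * (((φ + ψ) (some x y h)).xRep 0 * ((φ - ψ) (some x y h)).xRep 1 +
        ((φ + ψ) (some x y h)).xRep 1 * ((φ - ψ) (some x y h)).xRep 0) ∧
      N₂.eval x = r * (((φ + ψ) (some x y h)).xRep 1 * ((φ - ψ) (some x y h)).xRep 1) := by
    obtain ⟨a, ha, ha₀, ha₁⟩ := hφ.exists_smul h
    obtain ⟨b, hb, hb₀, hb₁⟩ := hψ.exists_smul h
    obtain ⟨c, hc, e₀, e₁, e₂⟩ := exists_addSub (φ (some x y h)) (ψ (some x y h))
    refine ⟨(a * b) ^ 2 * c⁻¹, mul_ne_zero (pow_ne_zero 2 (mul_ne_zero ha hb)) (inv_ne_zero hc),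
      ?_, ?_, ?_⟩
    · rw [AddMonoidHom.add_apply, AddMonoidHom.sub_apply, e₀, mul_assoc, inv_mul_cancel_left₀ hc,
        hN₀, eval_addSubProd]
      simp only [eval_add, eval_mul, ha₀, ha₁, hb₀, hb₁, addSubProd]
      ring
    · rw [AddMonoidHom.add_apply, AddMonoidHom.sub_apply, e₁, mul_assoc, inv_mul_cancel_left₀ hc,
        hN₁, eval_addSubSum]
      simp only [eval_add, eval_mul, ha₀, ha₁, hb₀, hb₁, addSubSum]
      ring
    · rw [AddMonoidHom.add_apply, AddMonoidHom.sub_apply, e₂, mul_assoc, inv_mul_cancel_left₀ hc,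
        hN₂, eval_addSubDen]
      simp only [eval_add, eval_mul, ha₀, ha₁, hb₀, hb₁, addSubDen]
      ring
  -- the quadratic equation
  have hquad : N₂ * A' ^ 2 - N₁ * A' * B' + N₀ * B' ^ 2 = 0 := by
    refine Polynomial.funext fun x => ?_
    obtain ⟨y, h⟩ := exists_nonsingular (W := W) x
    obtain ⟨r, -, e₀, e₁, e₂⟩ := key x y h
    obtain ⟨a, -, ha₀, ha₁⟩ := hsub.exists_smul h
    simp only [eval_add, eval_sub, eval_mul, eval_pow, e₀, e₁, e₂, ha₀, ha₁, eval_zero]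
    ring
  obtain ⟨A'', B'', h₀, h₁, h₂⟩ : ∃ A'' B'', A' * A'' = N₀ ∧ A' * B'' + B' * A'' = N₁ ∧
      B' * B'' = N₂ := by
    obtain ⟨p, q, hpq⟩ := hsub.isCoprime
    -- The known root is split off the quadratic form. If B' = 0 it cannot be cancelled, but then A'
    -- is a unit with inverse p.
    by_cases hB : B' = 0
    · rw [hB, mul_zero, add_zero] at hpq
      refine ⟨p * N₀, p * N₁, ?_, ?_, ?_⟩
      · linear_combination N₀ * hpq
      · rw [hB]; linear_combination N₁ * hpq
      · have : N₂ * A' ^ 2 = 0 := by rw [← hquad, hB]; ring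
        rw [hB, zero_mul, eq_comm]
        exact (mul_eq_zero.1 this).resolve_right (pow_ne_zero 2 hsub.ne_zero)
    · have d₂ : B' ∣ N₂ := (hsub.isCoprime.symm.pow_right (n := 2)).dvd_of_dvd_mul_right
        ⟨N₁ * A' - N₀ * B', by linear_combination hquad⟩
      have d₀ : A' ∣ N₀ := (hsub.isCoprime.pow_right (n := 2)).dvd_of_dvd_mul_right
        ⟨N₁ * B' - N₂ * A', by linear_combination hquad⟩
      obtain ⟨B'', h₂⟩ := d₂
      obtain ⟨A'', h₀⟩ := d₀
      refine ⟨A'', B'', h₀.symm, mul_left_cancel₀ (mul_ne_zero hsub.ne_zero hB) ?_, h₂.symm⟩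
      rw [h₀, h₂] at hquad
      linear_combination hquad
  have hA := hφ.ne_zero
  have hC := hψ.ne_zero
  have ht : (A * D + B * C₁).degree < (A * C₁).degree := by
    refine (degree_add_le ..).trans_lt (max_lt ?_ ?_)
    · rw [degree_mul, degree_mul]
      exact WithBot.add_lt_add_left (degree_ne_bot.2 hA) hψ.degree_lt
    · rw [degree_mul, degree_mul]
      exact WithBot.add_lt_add_right (degree_ne_bot.2 hC) hφ.degree_lt
  have hu : (B * D).degree < (A * C₁).degree := by
    rw [degree_mul, degree_mul]
    refine lt_of_le_of_lt ?_ (WithBot.add_lt_add_right (degree_ne_bot.2 hC) hφ.degree_lt)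
    gcongr
    exact hψ.degree_lt.le
  have hd₀ := degree_addSubProd W ht hu
  have hd₁ := degree_addSubSum_lt W ht hu
  rw [← hN₀, ← h₀] at hd₀
  rw [← hN₁, ← h₁, ← hd₀] at hd₁
  have hA'' : A'' ≠ 0 := by
    rintro rfl
    rw [mul_zero, degree_zero, eq_comm, degree_eq_bot] at hd₀
    exact pow_ne_zero 2 (mul_ne_zero hA hC) hd₀
  refine ⟨A'', B'', ⟨?_, ?_, fun x y h => ?_⟩, h₀, h₁, h₂, ?_⟩
  -- A common root of A'' and B'' would kill all three forms, hence A C₁, A D + B C₁ and B D,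
  -- against the coprimality of A, B and of C₁, D.
  · rw [Polynomial.isCoprime_iff_aeval_ne_zero_of_isAlgClosed F F]
    intro x
    obtain ⟨y, h⟩ := exists_nonsingular (W := W) x
    simp only [coe_aeval_eq_eval]
    by_contra! H
    have z : W.addSubProd ((A * C₁).eval x) ((A * D + B * C₁).eval x) ((B * D).eval x) = 0 := by
      rw [← eval_addSubProd, ← hN₀, ← h₀, eval_mul, H.1, mul_zero]
    have z₁ : W.addSubSum ((A * C₁).eval x) ((A * D + B * C₁).eval x) ((B * D).eval x) = 0 := by
      rw [← eval_addSubSum, ← hN₁, ← h₁, eval_add, eval_mul, eval_mul, H.1, H.2]; simp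
    have z₂ : addSubDen ((A * C₁).eval x) ((A * D + B * C₁).eval x) ((B * D).eval x) = 0 := by
      rw [← eval_addSubDen, ← hN₂, ← h₂, eval_mul, H.2, mul_zero]
    obtain ⟨s₀, s₁, s₂⟩ := addSub_eq_zero z z₁ z₂
    simp only [eval_mul, eval_add, mul_eq_zero] at s₀ s₁ s₂
    have n₁ := hφ.eval_ne_zero x
    have n₂ := hψ.eval_ne_zero x
    rcases s₀ with s₀ | s₀ <;> rcases s₂ with s₂ | s₂ <;> simp_all
  -- N₁ has smaller degree than N₀ = A' A''. If the degree of B'' reached that of A'', the term A'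
  -- B'' would dominate N₁ and be too large.
  · by_contra! hle
    have hlt : (B' * A'').degree < (A' * B'').degree := by
      rw [degree_mul, degree_mul]
      refine lt_of_lt_of_le (WithBot.add_lt_add_right (degree_ne_bot.2 hA'') hsub.degree_lt) ?_
      gcongr
    rw [degree_add_eq_left_of_degree_lt hlt, degree_mul, degree_mul] at hd₁
    exact absurd hd₁ (not_lt.2 (by gcongr))
  · obtain ⟨r, hr, e₀, e₁, e₂⟩ := key x y h
    obtain ⟨a, ha, ha₀, ha₁⟩ := hsub.exists_smul h
    rw [← h₀, eval_mul, ha₀] at e₀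
    rw [← h₁, eval_add, eval_mul, eval_mul, ha₀, ha₁] at e₁
    rw [← h₂, eval_mul, ha₁] at e₂
    rcases xRep_cases ((φ - ψ) (some x y h)) with ⟨u₀, u₁⟩ | u₁
    · rw [u₀, u₁] at e₁
      rw [u₀] at e₀
      refine mul_left_cancel₀ ha ?_
      linear_combination ((φ + ψ) (some x y h)).xRep 0 * e₁ - ((φ + ψ) (some x y h)).xRep 1 * e₀
    · rw [u₁] at e₁ e₂
      refine mul_left_cancel₀ ha ?_
      linear_combination (((φ + ψ) (some x y h)).xRep 0 + ((φ - ψ) (some x y h)).xRep 0 * ((φ + ψ) (some x y h)).xRep 1) * e₂ - ((φ + ψ) (some x y h)).xRep 1 * e₁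
  · rw [← natDegree_mul hsub.ne_zero hA'', natDegree_eq_of_degree_eq hd₀, natDegree_pow,
      natDegree_mul hA hC]

end IsXRational

end WeierstrassCurve

/-! ### Kernels and degrees -/

namespace WeierstrassCurve

set_option linter.unusedSectionVars false

open Polynomial WeierstrassCurve.Affine WeierstrassCurve.Affine.Point

section Wronskian

variable {F : Type*} [Field F] {A B : F[X]}

/-- By coprimality A divides its own derivative, which has smaller degree. -/
lemma derivative_eq_zero_of_wronskian_eq_zero (hc : IsCoprime A B) (hd : B.degree < A.degree)
    (hw : derivative A * B - A * derivative B = 0) : derivative A = 0 ∧ derivative B = 0 := by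
  have hA : A ≠ 0 := by rintro rfl; simp at hd
  have h : derivative A = 0 := eq_zero_of_dvd_of_degree_lt
    (hc.dvd_of_dvd_mul_right ⟨derivative B, by linear_combination hw⟩) (degree_derivative_lt hA)
  rw [h, zero_mul, zero_sub, neg_eq_zero] at hw
  exact ⟨h, (mul_eq_zero.1 hw).resolve_left hA⟩

lemma natDegree_cast_eq_zero_of_derivative_eq_zero (hA : A ≠ 0) (h : derivative A = 0) :
    (A.natDegree : F) = 0 := by
  rcases Nat.eq_zero_or_eq_succ_pred A.natDegree with h0 | h0
  · rw [h0, Nat.cast_zero]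
  · have := congrArg (fun p => coeff p A.natDegree.pred) h
    simp only [coeff_derivative, coeff_zero] at this
    rw [← Nat.succ_eq_add_one, ← h0, coeff_natDegree] at this
    have h' := (mul_eq_zero.1 this).resolve_left (leadingCoeff_ne_zero.2 hA)
    rw [h0]
    exact_mod_cast h'

end Wronskian

variable {F : Type*} [Field F] [DecidableEq F] {W : WeierstrassCurve F}

namespace IsXRational

variable {φ ψ : W.toAffine.Point →+ W.toAffine.Point} {A B C₁ D A' B' : F[X]}

lemma degree_sub_C_mul (hφ : IsXRational φ A B) (c : F) : (A - C c * B).degree = A.degree := by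
  refine degree_sub_eq_left_of_degree_lt (lt_of_le_of_lt ?_ hφ.degree_lt)
  rw [← smul_eq_C_mul]
  exact degree_smul_le ..

/-- The roots of A - cB are the x-coordinates of the points which φ sends above c; fibres of φ are
studied through this polynomial. -/
lemma eval_sub_C_mul_eq_zero_iff (hφ : IsXRational φ A B) {x y : F}
    (h : W.toAffine.Nonsingular x y) (c : F) :
    (A - C c * B).eval x = 0 ↔ (φ (some x y h)).xRep = ![c, 1] := by
  obtain ⟨r, hr, h₀, h₁⟩ := hφ.exists_smul h
  rw [eval_sub, eval_mul, eval_C, h₀, h₁, mul_left_comm, ← mul_sub, mul_eq_zero, or_iff_right hr,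
    sub_eq_zero]
  constructor
  · intro H
    rcases xRep_cases (φ (some x y h)) with ⟨u₀, u₁⟩ | u₁
    · rw [u₀, u₁, mul_zero] at H
      exact absurd H one_ne_zero
    · ext i
      fin_cases i
      · simpa [u₁] using H
      · exact u₁
  · intro H
    simp [H]

variable [IsAlgClosed F] [W.IsElliptic]

lemma surjective (hφ : IsXRational φ A B) (hA : A.natDegree ≠ 0) : Function.Surjective φ := by
  rintro (_ | ⟨c, y₀, h₀⟩)
  · exact ⟨0, map_zero φ⟩
  obtain ⟨x, hx⟩ := IsAlgClosed.exists_root (A - C c * B) (by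
    rw [hφ.degree_sub_C_mul]
    exact fun h => hA (natDegree_eq_of_degree_eq_some h))
  obtain ⟨y, h⟩ := exists_nonsingular (W := W) x
  have hX : (φ (some x y h)).xRep = (some c y₀ h₀).xRep :=
    (hφ.eval_sub_C_mul_eq_zero_iff h c).1 hx
  rcases eq_or_eq_neg_of_xRep_eq_xRep hX with hP | hP
  · exact ⟨_, hP⟩
  · exact ⟨-some x y h, by rw [map_neg, hP, neg_neg]⟩

/-- A homomorphism which is separable on `x`-coordinates has as many points in its kernel as its
degree says. -/
theorem card_ker (hφ : IsXRational φ A B) (h2 : (2 : F) ≠ 0)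
    (hw : derivative A * B - A * derivative B ≠ 0) : Nat.card φ.ker = A.natDegree := by
  have h4 : (4 : F) ≠ 0 := by
    rw [show (4 : F) = 2 ^ 2 by norm_num]
    exact pow_ne_zero 2 h2
  have hA : A.natDegree ≠ 0 := by
    intro h
    have hB : B = 0 := by
      rw [← degree_eq_bot, ← Nat.WithBot.lt_zero_iff]
      have := hφ.degree_lt
      rwa [degree_eq_natDegree hφ.ne_zero, h] at this
    rw [hB] at hw
    simp at hw
  have : Infinite F := IsAlgClosed.instInfinite
  -- The value c avoids the x-coordinates of the 2-torsion, so that Q ≠ -Q above c, and the values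
  -- of A / B at the zeros of the Wronskian, so that A - cB has simple roots.
  obtain ⟨c, hc⟩ := Infinite.exists_notMem_finset (W.Ψ₂Sq.roots.toFinset ∪
    (derivative A * B - A * derivative B).roots.toFinset.image fun x => A.eval x / B.eval x)
  rw [Finset.notMem_union] at hc
  obtain ⟨hc₁, hc₂⟩ := hc
  set f := A - C c * B with hf
  have hf0 : f ≠ 0 := by
    rw [← degree_ne_bot, hφ.degree_sub_C_mul, degree_ne_bot]
    exact hφ.ne_zero
  have hsep : f.Separable := by
    rw [Separable, Polynomial.isCoprime_iff_aeval_ne_zero_of_isAlgClosed F F]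
    intro x
    simp only [coe_aeval_eq_eval]
    by_contra! H
    obtain ⟨e₀, e₁⟩ := H
    rw [hf] at e₀ e₁
    simp only [derivative_sub, derivative_mul, derivative_C, zero_mul, zero_add, eval_sub, eval_mul,
      eval_C] at e₀ e₁
    have hB : B.eval x ≠ 0 := by
      intro hB
      rw [hB, mul_zero, sub_zero] at e₀
      exact (hφ.eval_ne_zero x).elim (fun h => h e₀) fun h => h hB
    refine hc₂ (Finset.mem_image.2 ⟨x, ?_, ?_⟩)
    · rw [Multiset.mem_toFinset, mem_roots hw, IsRoot.def, eval_sub, eval_mul, eval_mul]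
      linear_combination B.eval x * e₁ - (derivative B).eval x * e₀
    · rw [div_eq_iff hB]
      linear_combination e₀
  obtain ⟨y₀, h₀⟩ := exists_nonsingular (W := W) c
  set Q := some c y₀ h₀ with hQ
  have hQn : -Q ≠ Q := by
    rw [hQ, Ne, neg_some_eq_iff]
    intro h
    refine hc₁ ?_
    rw [Multiset.mem_toFinset, mem_roots (W.Ψ₂Sq_ne_zero h4), IsRoot.def, Ψ₂Sq]
    have := sq_sub_negY h₀.1
    rw [h] at this
    simp only [eval_add, eval_mul, eval_C, eval_pow, eval_X]
    linear_combination -this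
  -- The fibre over Q is the coset P₀ + ker φ. Its points have distinct x-coordinates because Q ≠
  -- -Q, and these exhaust the roots of f because a point over -Q can be negated.
  obtain ⟨P₀, hP₀⟩ := hφ.surjective hA Q
  let g : φ.ker → F := fun R => (P₀ + R.1).xRep 0
  have hφg (R : φ.ker) : φ (P₀ + R.1) = Q := by
    rw [map_add, hP₀, R.2, add_zero]
  have hne (R : φ.ker) : P₀ + R.1 ≠ 0 := fun h => by
    have := hφg R
    rw [h, _root_.map_zero] at this
    exact some_ne_zero h₀ this.symm
  have hx (P : W.toAffine.Point) (hP : P ≠ 0) : P.xRep = ![P.xRep 0, 1] := by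
    rcases P with _ | _
    · exact absurd rfl hP
    · rfl
  have hinj : Function.Injective g := by
    intro R S hRS
    have hX : (P₀ + R.1).xRep = (P₀ + S.1).xRep := by
      rw [hx _ (hne R), hx _ (hne S)]
      exact congrArg (fun z => ![z, 1]) hRS
    rcases eq_or_eq_neg_of_xRep_eq_xRep hX with h | h
    · exact Subtype.ext (add_left_cancel h)
    · have := congrArg φ h
      rw [map_neg, hφg, hφg] at this
      exact absurd this.symm hQn
  have hrange : Set.range g = (f.roots.toFinset : Set F) := by
    ext x
    rw [Finset.mem_coe, Multiset.mem_toFinset, mem_roots hf0, IsRoot.def]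
    constructor
    · rintro ⟨R, rfl⟩
      have h₁ := hφg R
      have h₂ := hne R
      simp only [g]
      rcases hP : P₀ + R.1 with _ | ⟨x, y, h⟩
      · exact absurd hP h₂
      · rw [hP] at h₁
        exact (hφ.eval_sub_C_mul_eq_zero_iff h c).2 (by rw [h₁]; rfl)
    · intro hfx
      obtain ⟨y, h⟩ := exists_nonsingular (W := W) x
      have hX : (φ (some x y h)).xRep = Q.xRep := (hφ.eval_sub_C_mul_eq_zero_iff h c).1 hfx
      rcases eq_or_eq_neg_of_xRep_eq_xRep hX with hP | hP
      · refine ⟨⟨some x y h - P₀, ?_⟩, ?_⟩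
        · rw [AddMonoidHom.mem_ker, map_sub, hP, hP₀, sub_self]
        · simp only [g, add_sub_cancel]
          rfl
      · refine ⟨⟨-some x y h - P₀, ?_⟩, ?_⟩
        · rw [AddMonoidHom.mem_ker, map_sub, map_neg, hP, hP₀, neg_neg, sub_self]
        · simp only [g, add_sub_cancel, xRep_neg]
          rfl
  have hcard : f.roots.toFinset.card = f.natDegree := by
    rw [Multiset.toFinset_card_of_nodup (nodup_roots hsep),
      splits_iff_card_roots.1 (IsAlgClosed.splits f)]
  rw [← Nat.card_range_of_injective hinj, hrange, Nat.card_coe_set_eq, Set.ncard_coe_finset, hcard,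
    natDegree_eq_of_degree_eq (hφ.degree_sub_C_mul c)]

end IsXRational

/-! ### Multiplication by m and its difference with an inseparable homomorphism -/

variable (W) in
/-- Multiplication by `m` as a homomorphism. -/
def mulHom (m : ℕ) : W.toAffine.Point →+ W.toAffine.Point := m • AddMonoidHom.id _

variable [IsAlgClosed F] [W.IsElliptic]

/-- Addition applied to m + 1 and 1, whose difference m is already known; the parallelogram law
gives (m + 2)² = 2((m + 1)² + 1) - m². -/
lemma exists_isXRational_mulHom (m : ℕ) :
    ∃ A B : F[X], IsXRational (mulHom W m) A B ∧ A.natDegree = m ^ 2 := by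
  induction m using Nat.twoStepInduction with
  | zero =>
    refine ⟨1, 0, ?_, by simp⟩
    convert IsXRational.zero (W := W) using 1
    ext; simp [mulHom]
  | one =>
    refine ⟨X, 1, ?_, by simp⟩
    convert IsXRational.id (W := W) using 1
    ext; simp [mulHom]
  | more m h₀ h₁ =>
    obtain ⟨A', B', h₀, d₀⟩ := h₀
    obtain ⟨A, B, h₁, d₁⟩ := h₁
    have e : mulHom W (m + 1) - AddMonoidHom.id _ = mulHom W m := by
      simp only [mulHom, add_smul, one_smul, add_sub_cancel_right]
    rw [← e] at h₀
    obtain ⟨A'', B'', h, -, -, -, hd⟩ := h₁.add IsXRational.id h₀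
    refine ⟨A'', B'', ?_, ?_⟩
    · convert h using 1
      simp only [mulHom, add_smul, one_smul, add_assoc, two_smul]
    · rw [d₀, d₁, natDegree_X] at hd
      nlinarith

/-- A vanishing Wronskian would make the degree m² zero in F. -/
lemma wronskian_mulHom_ne_zero {m : ℕ} (hm : (m : F) ≠ 0) {A B : F[X]}
    (h : IsXRational (mulHom W m) A B) (hd : A.natDegree = m ^ 2) :
    derivative A * B - A * derivative B ≠ 0 := by
  intro hw
  have := natDegree_cast_eq_zero_of_derivative_eq_zero h.ne_zero
    (derivative_eq_zero_of_wronskian_eq_zero h.isCoprime h.degree_lt hw).1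
  rw [hd, Nat.cast_pow] at this
  exact hm (pow_eq_zero_iff two_ne_zero |>.1 this)

/-- For `m` prime to the characteristic there are `m ^ 2` points of order dividing `m`. -/
theorem card_ker_mulHom (h2 : (2 : F) ≠ 0) {m : ℕ} (hm : (m : F) ≠ 0) :
    Nat.card (mulHom W m).ker = m ^ 2 := by
  obtain ⟨A, B, h, hd⟩ := exists_isXRational_mulHom (W := W) m
  rw [h.card_ker h2 (wronskian_mulHom_ne_zero hm h hd), hd]

theorem mulHom_surjective {m : ℕ} (hm : m ≠ 0) : Function.Surjective (mulHom W m) := by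
  obtain ⟨A, B, h, hd⟩ := exists_isXRational_mulHom (W := W) m
  exact h.surjective (by rw [hd]; exact pow_ne_zero 2 hm)

variable {ψ : W.toAffine.Point →+ W.toAffine.Point} {C₁ D A₁ B₁ : F[X]}

/-- By the parallelogram law the degree has constant second difference 2 in m, so it is the
quadratic polynomial fixed by its values at m = 0 and m = 1. -/
lemma exists_isXRational_mulHom_sub (hψ : IsXRational ψ C₁ D)
    (h₁ : IsXRational (AddMonoidHom.id _ - ψ) A₁ B₁) (m : ℕ) :
    ∃ A B : F[X], IsXRational (mulHom W m - ψ) A B ∧ (A.natDegree : ℤ) =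
      m ^ 2 - (1 + C₁.natDegree - A₁.natDegree) * m + C₁.natDegree := by
  induction m using Nat.twoStepInduction with
  | zero =>
    refine ⟨C₁, D, ?_, by simp⟩
    convert hψ.neg using 1
    ext; simp [mulHom]
  | one =>
    refine ⟨A₁, B₁, ?_, by push_cast; ring⟩
    convert h₁ using 1
    ext; simp [mulHom]
  | more m i₀ i₁ =>
    obtain ⟨A', B', h₀, d₀⟩ := i₀
    obtain ⟨A, B, h₁, d₁⟩ := i₁
    have e : mulHom W (m + 1) - ψ - AddMonoidHom.id _ = mulHom W m - ψ := by
      simp only [mulHom, add_smul, one_smul]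
      abel
    rw [← e] at h₀
    obtain ⟨A'', B'', h, -, -, -, hd⟩ := h₁.add IsXRational.id h₀
    refine ⟨A'', B'', ?_, ?_⟩
    · convert h using 1
      simp only [mulHom, add_smul, one_smul, two_smul]
      abel
    · rw [natDegree_X] at hd
      have hd' : (A'.natDegree : ℤ) + A''.natDegree = 2 * (A.natDegree + 1) := by exact_mod_cast hd
      rw [d₀, d₁] at hd'
      push_cast at hd' ⊢
      linear_combination hd'

/-- If m - ψ were inseparable like ψ, then so would be their sum m, against
`wronskian_mulHom_ne_zero`. -/
lemma wronskian_mulHom_sub_ne_zero (h2 : (2 : F) ≠ 0) {m : ℕ} (hm : (m : F) ≠ 0)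
    (hψ : IsXRational ψ C₁ D) (hC : derivative C₁ = 0) (hD : derivative D = 0) {A B : F[X]}
    (h : IsXRational (mulHom W m - ψ) A B) : derivative A * B - A * derivative B ≠ 0 := by
  intro hw
  obtain ⟨hA, hB⟩ := derivative_eq_zero_of_wronskian_eq_zero h.isCoprime h.degree_lt hw
  obtain ⟨A₂, B₂, hm', hd⟩ := exists_isXRational_mulHom (W := W) m
  refine wronskian_mulHom_ne_zero hm hm' hd ?_
  have e : mulHom W m - ψ - -ψ = mulHom W m := by abel
  rw [← e] at hm'
  -- Here m - ψ is combined with -ψ: their difference is m, with fraction A₂ / B₂, and their sum m -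
  -- 2ψ has fraction A₃ / B₃. The forms built from polynomials with zero derivative have zero
  -- derivative themselves.
  obtain ⟨A₃, B₃, h₃, e₀, e₁, e₂, -⟩ := h.add hψ.neg hm'
  have d₀ := congrArg derivative e₀
  have d₁ := congrArg derivative e₁
  have d₂ := congrArg derivative e₂
  simp only [addSubProd, addSubSum, addSubDen, map_b₂, map_b₄, map_b₆, map_b₈, derivative_add,
    derivative_sub, derivative_mul, derivative_pow, derivative_C, derivative_ofNat, hA, hB, hC, hD,
    mul_zero, zero_mul, add_zero, sub_zero] at d₀ d₁ d₂
  have hz : (derivative A₂ * B₂ - A₂ * derivative B₂) * (A₂ * B₃ - B₂ * A₃) = 0 := by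
    linear_combination A₂ * B₂ * d₁ - B₂ ^ 2 * d₀ - A₂ ^ 2 * d₂
  rcases mul_eq_zero.1 hz with hz | hz
  · exact hz
  -- In the remaining case the fractions A₂ / B₂ and A₃ / B₃ coincide; differentiating this equality
  -- gives a further relation.
  have h2' : (2 : F[X]) ≠ 0 := by
    rw [← map_ofNat C 2]
    exact C_ne_zero.2 h2
  have hz' := congrArg derivative hz
  simp only [derivative_sub, derivative_mul, derivative_zero] at hz'
  have w₃ : (derivative A₂ * B₂ - A₂ * derivative B₂) * A₃ = 0 := by
    refine mul_left_cancel₀ h2' ?_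
    linear_combination 2 * B₂ * d₀ - A₂ * d₁ + A₂ * hz'
  exact (mul_eq_zero.1 w₃).resolve_right h₃.ne_zero

/-- The number of points on which `ψ` is multiplication by `m`, for an inseparable `ψ`. -/
theorem card_ker_mulHom_sub (h2 : (2 : F) ≠ 0) {m : ℕ} (hm : (m : F) ≠ 0)
    (hψ : IsXRational ψ C₁ D) (hC : derivative C₁ = 0) (hD : derivative D = 0)
    (h₁ : IsXRational (AddMonoidHom.id _ - ψ) A₁ B₁) :
    (Nat.card (mulHom W m - ψ).ker : ℤ) =
      m ^ 2 - (1 + C₁.natDegree - A₁.natDegree) * m + C₁.natDegree := by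
  obtain ⟨A, B, h, hd⟩ := exists_isXRational_mulHom_sub hψ h₁ m
  rw [h.card_ker h2 (wronskian_mulHom_sub_ne_zero h2 hm hψ hC hD h), hd]

end WeierstrassCurve

/-! ### The Frobenius endomorphism -/

section Frobenius

set_option linter.unusedSectionVars false

open Polynomial WeierstrassCurve WeierstrassCurve.Affine WeierstrassCurve.Affine.Point

variable {k : Type*} [Field k] [Fintype k] (E : WeierstrassCurve k)

lemma curveFrobenius_some {x y : AlgebraicClosure k}
    (h : (E⁄(AlgebraicClosure k)).Nonsingular x y) : ∃ h',
      curveFrobenius E (.some x y h) = .some (x ^ Fintype.card k) (y ^ Fintype.card k) h' :=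
  ⟨_, rfl⟩

lemma isXRational_curveFrobenius :
    IsXRational (W := E.baseChange (AlgebraicClosure k)) (curveFrobenius E)
      (X ^ Fintype.card k) 1 := by
  refine ⟨isCoprime_one_right, ?_, fun x y h => ?_⟩
  · rw [degree_X_pow, degree_one]
    exact_mod_cast Fintype.card_pos
  · obtain ⟨h', e⟩ := curveFrobenius_some E h
    rw [e]
    simp

lemma sub_negY_frobenius (x y : AlgebraicClosure k) :
    y ^ Fintype.card k - (E⁄(AlgebraicClosure k)).negY (x ^ Fintype.card k) (y ^ Fintype.card k) =
      (y - (E⁄(AlgebraicClosure k)).negY x y) ^ Fintype.card k := by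
  have h := baseChange_negY (W' := E)
    (FiniteField.frobeniusAlgHom k (AlgebraicClosure k)) x y
  have h' := map_sub (FiniteField.frobeniusAlgHom k (AlgebraicClosure k)) y
    ((E⁄(AlgebraicClosure k)).negY x y)
  rw [← h] at h'
  exact h'.symm

lemma exists_mul_isCoprime {F : Type*} [Field F] {S T : F[X]} (hS : S ≠ 0) :
    ∃ g A B : F[X], g ≠ 0 ∧ S = g * A ∧ T = g * B ∧ IsCoprime A B := by
  have hg : EuclideanDomain.gcd S T ≠ 0 := fun h => hS (EuclideanDomain.gcd_eq_zero_iff.1 h).1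
  obtain ⟨A, hA⟩ := EuclideanDomain.gcd_dvd_left S T
  obtain ⟨B, hB⟩ := EuclideanDomain.gcd_dvd_right S T
  refine ⟨_, A, B, hg, hA, hB, EuclideanDomain.gcdA S T, EuclideanDomain.gcdB S T,
    mul_left_cancel₀ hg ?_⟩
  have := EuclideanDomain.gcd_eq_gcd_ab S T
  linear_combination -this - EuclideanDomain.gcdA S T * hA - EuclideanDomain.gcdB S T * hB

/-- If `ψ` raises coordinates to an odd power `q > 1`, then `1 - ψ` is rational on
`x`-coordinates. -/
lemma exists_isXRational_id_sub {F : Type*} [Field F] [DecidableEq F] [IsAlgClosed F]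
    {W : WeierstrassCurve F} [W.IsElliptic] (h2 : (2 : F) ≠ 0) {q : ℕ} (hq : Odd q) (hq1 : 1 < q)
    (ψ : W.toAffine.Point →+ W.toAffine.Point)
    (hψ : ∀ x y h, ∃ h', ψ (some x y h) = some (x ^ q) (y ^ q) h')
    (hη : ∀ x y, y ^ q - W.toAffine.negY (x ^ q) (y ^ q) = (y - W.toAffine.negY x y) ^ q) :
    ∃ A B, IsXRational (AddMonoidHom.id _ - ψ) A B := by
  obtain ⟨r, hr⟩ := hq
  set N₀ := (W.map C).addSubProd (X * X ^ q) (X + X ^ q) 1 with hN₀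
  set N₁ := (W.map C).addSubSum (X * X ^ q) (X + X ^ q) 1 with hN₁
  set N₂ : F[X] := addSubDen (X * X ^ q) (X + X ^ q) 1 with hN₂
  -- With η = y - negY, the product η(P) η(ψP) is η^(q+1), a power of η² and so a polynomial in x
  -- because q is odd. It separates x(P - ψP) from x(P + ψP).
  set R := W.Ψ₂Sq ^ (r + 1) with hR
  have key (x y : F) (h : W.toAffine.Nonsingular x y) :
      ∃ c : F, c ≠ 0 ∧
      (some x y h + ψ (some x y h)).xRep 0 *
        (some x y h - ψ (some x y h)).xRep 0 = c * N₀.eval x ∧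
      (some x y h + ψ (some x y h)).xRep 0 *
        (some x y h - ψ (some x y h)).xRep 1 +
      (some x y h + ψ (some x y h)).xRep 1 *
        (some x y h - ψ (some x y h)).xRep 0 = c * N₁.eval x ∧
      (some x y h + ψ (some x y h)).xRep 1 *
        (some x y h - ψ (some x y h)).xRep 1 = c * N₂.eval x ∧
      (some x y h + ψ (some x y h)).xRep 1 *
        (some x y h - ψ (some x y h)).xRep 0 -
      (some x y h + ψ (some x y h)).xRep 0 *
        (some x y h - ψ (some x y h)).xRep 1 = c * R.eval x := by
    obtain ⟨h', e⟩ := hψ x y h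
    obtain ⟨c, hc, e₀, e₁, e₂, e₃⟩ := exists_addSub_some (W := W) h h'
    rw [← e] at e₀ e₁ e₂ e₃
    refine ⟨c, hc, ?_, ?_, ?_, ?_⟩
    · rw [hN₀, eval_addSubProd]
      simpa using e₀
    · rw [hN₁, eval_addSubSum]
      simpa using e₁
    · rw [hN₂, eval_addSubDen]
      simpa using e₂
    · have hsq := sq_sub_negY (W := W) h.1
      have e₄ : R.eval x = (y - W.toAffine.negY x y) * (y ^ q - W.toAffine.negY (x ^ q) (y ^ q)) := by
        rw [hη, ← pow_succ', hr,
          show 2 * r + 1 + 1 = 2 * (r + 1) by ring, pow_mul, hsq, hR, eval_pow, Ψ₂Sq]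
        simp only [eval_add, eval_mul, eval_C, eval_pow, eval_X]
      rw [e₄]
      exact e₃
  -- With u, v the coordinates of P + ψP and P - ψP, the factors are proportional to 2u₁v₀ and
  -- 2u₀v₁. So x(P - ψP) is (N₁ + R) / (2N₂), and also 2N₀ / (N₁ - R).
  have hST : (N₁ + R) * (N₁ - R) = 2 * N₀ * (2 * N₂) := by
    refine Polynomial.funext fun x => ?_
    obtain ⟨y, h⟩ := exists_nonsingular (W := W) x
    obtain ⟨c, hc, e₀, e₁, e₂, e₃⟩ := key x y h
    refine mul_left_cancel₀ (pow_ne_zero 2 hc) ?_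
    simp only [eval_mul, eval_add, eval_sub, eval_ofNat]
    set u := (some x y h + ψ (some x y h)).xRep
    set v := (some x y h - ψ (some x y h)).xRep
    linear_combination -(2 * u 1 * v 0) * (e₁ - e₃) - c * (N₁.eval x - R.eval x) * (e₁ + e₃) +
      4 * u 1 * v 1 * e₀ + 4 * c * N₀.eval x * e₂
  have hdeg : (N₁ + R).natDegree = 2 * q + 1 := by
    have e : N₁ + R = C 2 * X ^ (2 * q + 1) + (C 2 * X ^ (q + 2) + C W.b₂ * X ^ (q + 1) + C W.b₄ * X +
        C W.b₄ * X ^ q + C W.b₆ + R) := by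
      rw [hN₁, addSubSum, map_b₂, map_b₄, map_b₆, map_ofNat]
      ring
    -- The degree is at most 3(r + 1), and 3(r + 1) ≤ 4r + 2 = 2q since q > 1 gives r ≥ 1.
    have hRd : R.natDegree ≤ 2 * q := by
      refine natDegree_pow_le.trans ((Nat.mul_le_mul_left _ W.natDegree_Ψ₂Sq_le).trans ?_)
      omega
    have hlow : (C 2 * X ^ (q + 2) + C W.b₂ * X ^ (q + 1) + C W.b₄ * X +
        C W.b₄ * X ^ q + C W.b₆ + R).natDegree ≤ 2 * q := by
      refine natDegree_add_le_of_degree_le ?_ hRd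
      refine natDegree_add_le_of_degree_le ?_ (by rw [natDegree_C]; omega)
      refine natDegree_add_le_of_degree_le ?_ ((natDegree_C_mul_X_pow_le _ _).trans (by omega))
      refine natDegree_add_le_of_degree_le ?_ ((natDegree_C_mul_le _ _).trans (by rw [natDegree_X]; omega))
      exact natDegree_add_le_of_degree_le ((natDegree_C_mul_X_pow_le _ _).trans (by omega))
        ((natDegree_C_mul_X_pow_le _ _).trans (by omega))
    rw [e, natDegree_add_eq_left_of_natDegree_lt, natDegree_C_mul_X_pow _ _ h2]
    rw [natDegree_C_mul_X_pow _ _ h2]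
    omega
  have hN₂' : N₂ = (X - X ^ q) ^ 2 := by rw [hN₂, addSubDen]; ring
  have hdeg₂ : (2 * N₂).natDegree ≤ 2 * q := by
    rw [hN₂', ← map_ofNat C 2]
    refine (natDegree_C_mul_le _ _).trans (natDegree_pow_le.trans ?_)
    refine Nat.mul_le_mul_left _ ((natDegree_sub_le _ _).trans ?_)
    rw [natDegree_X, natDegree_X_pow]
    omega
  have hS0 : N₁ + R ≠ 0 := by
    intro h
    rw [h, natDegree_zero] at hdeg
    omega
  obtain ⟨g, A, B, hg, hA, hB, hcop⟩ := exists_mul_isCoprime (T := 2 * N₂) hS0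
  refine ⟨A, B, hcop, ?_, fun x y h => ?_⟩
  · have hlt : (2 * N₂).degree < (N₁ + R).degree := by
      rw [degree_eq_natDegree hS0, hdeg]
      exact degree_le_natDegree.trans_lt (by exact_mod_cast Nat.lt_succ_of_le hdeg₂)
    rw [hA, hB, degree_mul, degree_mul] at hlt
    exact lt_of_add_lt_add_left hlt
  · rw [AddMonoidHom.sub_apply, AddMonoidHom.id_apply]
    obtain ⟨c, hc, e₀, e₁, e₂, e₃⟩ := key x y h
    set u := (some x y h + ψ (some x y h)).xRep
    set v := (some x y h - ψ (some x y h)).xRep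
    have hA' := congrArg (eval x) hA
    have hB' := congrArg (eval x) hB
    simp only [eval_add, eval_mul, eval_ofNat] at hA' hB'
    -- Where the cancelled factor g vanishes, the first fraction says nothing, and the second one is
    -- used; its terms cannot vanish as well, by `addSub_eq_zero`.
    by_cases hgx : g.eval x = 0
    · rw [hgx, zero_mul] at hA' hB'
      have hrel : A * (N₁ - R) = 2 * N₀ * B := by
        refine mul_left_cancel₀ hg ?_
        rw [hA, hB] at hST
        linear_combination hST
      have hrel' := congrArg (eval x) hrel
      simp only [eval_sub, eval_mul, eval_ofNat] at hrel'
      have p₀ : (v 0 * B.eval x - v 1 * A.eval x) * (2 * N₀.eval x) = 0 := by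
        refine mul_left_cancel₀ hc ?_
        linear_combination (-c * v 0) * hrel' - A.eval x * v 0 * (e₁ - e₃) + 2 * A.eval x * v 1 * e₀
      have p₁ : (v 0 * B.eval x - v 1 * A.eval x) * (N₁.eval x - R.eval x) = 0 := by
        refine mul_left_cancel₀ hc ?_
        linear_combination (-c * v 1) * hrel' - B.eval x * v 0 * (e₁ - e₃) + 2 * B.eval x * v 1 * e₀
      rw [← sub_eq_zero]
      by_contra hne
      have z₀ := (mul_eq_zero.1 ((mul_eq_zero.1 p₀).resolve_left hne)).resolve_left h2
      have z₁ := (mul_eq_zero.1 p₁).resolve_left hne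
      have z₂ := (mul_eq_zero.1 hB').resolve_left h2
      have z₁' : N₁.eval x = 0 :=
        (mul_eq_zero.1 (show 2 * N₁.eval x = 0 by linear_combination z₁ + hA')).resolve_left h2
      rw [hN₀, eval_addSubProd] at z₀
      rw [hN₁, eval_addSubSum] at z₁'
      rw [hN₂, eval_addSubDen] at z₂
      have := (addSub_eq_zero z₀ z₁' z₂).2.2
      rw [eval_one] at this
      exact one_ne_zero this
    · refine mul_left_cancel₀ (mul_ne_zero hc hgx) ?_
      linear_combination (-c * v 0) * hB' + (c * v 1) * hA' - 2 * v 0 * e₂ + v 1 * (e₁ + e₃)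

/-- The number of geometric points on which Frobenius is multiplication by `m`. -/
theorem exists_card_ker_mulHom_sub_curveFrobenius [E.IsElliptic] {p : ℕ} [CharP k p] [Fact p.Prime] (hp : p ≠ 2) :
    ∃ t : ℤ, ∀ m : ℕ, ¬ p ∣ m →
      (Nat.card (mulHom (E.baseChange (AlgebraicClosure k)) m - curveFrobenius E).ker : ℤ) =
        m ^ 2 - t * m + Fintype.card k := by
  have : (E⁄(AlgebraicClosure k)).IsElliptic :=
    inferInstanceAs (E.map (algebraMap k (AlgebraicClosure k))).IsElliptic
  have : CharP (AlgebraicClosure k) p := charP_of_injective_algebraMap' k p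
  have hcast {m : ℕ} (hm : ¬ p ∣ m) : (m : AlgebraicClosure k) ≠ 0 := by
    rwa [Ne, CharP.cast_eq_zero_iff (AlgebraicClosure k) p]
  have hp2 : ¬ p ∣ 2 := fun h =>
    hp ((Nat.prime_dvd_prime_iff_eq (Fact.out : p.Prime) Nat.prime_two).1 h)
  have h2' : (2 : AlgebraicClosure k) ≠ 0 := by exact_mod_cast hcast hp2
  obtain ⟨n, -, hn⟩ := FiniteField.card k p
  have hq : Odd (Fintype.card k) := by
    rw [hn]
    exact ((Fact.out : p.Prime).odd_of_ne_two hp).pow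
  obtain ⟨A, B, h⟩ := exists_isXRational_id_sub (W := E.baseChange (AlgebraicClosure k)) h2' hq
    Fintype.one_lt_card (curveFrobenius E) (fun x y h => curveFrobenius_some E h)
    (sub_negY_frobenius E)
  -- This is the trace of Frobenius, 1 + q - deg(1 - π).
  refine ⟨1 + Fintype.card k - A.natDegree, fun m hm => ?_⟩
  have hd : derivative (X ^ Fintype.card k : (AlgebraicClosure k)[X]) = 0 := by
    rw [derivative_X_pow, hn, Nat.cast_pow, CharP.cast_eq_zero, zero_pow n.ne_zero, C_0, zero_mul]
  have := card_ker_mulHom_sub h2' (hcast hm) (isXRational_curveFrobenius E) hd derivative_one h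
  rw [natDegree_X_pow] at this
  exact this

end Frobenius

/-! ### Tate modules of rank two -/

section TateModule

set_option linter.unusedSectionVars false

variable {ℓ : ℕ} [Fact ℓ.Prime] {A : Type*} [AddCommGroup A]

lemma tateModule_smul_apply_congr {a b : ℤ_[ℓ]} {n : ℕ} (h : (ℓ : ℤ_[ℓ]) ^ n ∣ a - b)
    (x : tateModule ℓ A) : (a • x).1 n = (b • x).1 n := by
  have : PadicInt.toZModPow n a = PadicInt.toZModPow n b := by
    rw [← sub_eq_zero, ← map_sub, ← RingHom.mem_ker, PadicInt.ker_toZModPow,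
      Ideal.mem_span_singleton]
    exact h
  rw [tateModule_smul_apply, tateModule_smul_apply, this]

lemma tateModule_smul_apply_eq_zero {a : ℤ_[ℓ]} {n : ℕ} (h : (ℓ : ℤ_[ℓ]) ^ n ∣ a)
    (x : tateModule ℓ A) : (a • x).1 n = 0 := by
  rw [tateModule_smul_apply_congr (b := 0) (by rwa [sub_zero]), zero_smul]
  rfl

lemma tateModule_natCast_smul_apply (m : ℕ) (x : tateModule ℓ A) (n : ℕ) :
    ((m : ℤ_[ℓ]) • x).1 n = m • x.1 n := by
  rw [Nat.cast_smul_eq_nsmul]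
  rfl

lemma tateModule_smul_apply_eq_nsmul (a : ℤ_[ℓ]) (n : ℕ) :
    ∃ m : ℕ, (ℓ : ℤ_[ℓ]) ^ n ∣ a - m ∧ ∀ x : tateModule ℓ A, (a • x).1 n = m • x.1 n := by
  refine ⟨a.appr n, Ideal.mem_span_singleton.1 (PadicInt.appr_spec n a), fun x => ?_⟩
  rw [← tateModule_natCast_smul_apply]
  exact tateModule_smul_apply_congr (Ideal.mem_span_singleton.1 (PadicInt.appr_spec n a)) x

lemma tateModule_pow_smul_apply (x : tateModule ℓ A) (n m : ℕ) :
    ℓ ^ m • x.1 (n + m) = x.1 n := by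
  induction m with
  | zero => simp
  | succ m ih => rw [pow_succ, mul_smul, ← add_assoc, x.2.2, ih]

lemma tateModule_add_apply (x y : tateModule ℓ A) (n : ℕ) : (x + y).1 n = x.1 n + y.1 n := rfl

/-- The quotient is the sequence shifted by n. -/
lemma exists_eq_pow_smul_of_apply_eq_zero {x : tateModule ℓ A} {n : ℕ} (h : x.1 n = 0) :
    ∃ y : tateModule ℓ A, x = (ℓ : ℤ_[ℓ]) ^ n • y := by
  refine ⟨⟨fun i => x.1 (i + n), by simpa using h, fun i => ?_⟩, ?_⟩
  · change ℓ • x.1 (i + 1 + n) = x.1 (i + n)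
    rw [add_right_comm]
    exact x.2.2 _
  · ext i
    rw [← Nat.cast_pow, tateModule_natCast_smul_apply]
    exact (tateModule_pow_smul_apply x i n).symm

lemma tateModule_natCast_pow_smul_eq_zero {x : tateModule ℓ A} {n : ℕ}
    (h : (ℓ : ℤ_[ℓ]) ^ n • x = 0) : x = 0 := by
  ext i
  have := congrFun (congrArg Subtype.val h) (i + n)
  rw [← Nat.cast_pow, tateModule_natCast_smul_apply, tateModule_pow_smul_apply] at this
  exact this

/-- A nonzero ℓ-adic integer is a unit times a power of ℓ, so torsion-freeness reduces to powers of
ℓ. -/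
lemma tateModule_smul_eq_zero {a : ℤ_[ℓ]} {x : tateModule ℓ A} (h : a • x = 0) (ha : a ≠ 0) :
    x = 0 := by
  rw [PadicInt.unitCoeff_spec ha, mul_smul, ← Units.smul_def, Units.smul_def] at h
  have h' := congrArg (fun z => (((PadicInt.unitCoeff ha)⁻¹ : ℤ_[ℓ]ˣ) : ℤ_[ℓ]) • z) h
  simp only [smul_zero, smul_smul] at h'
  rw [← mul_assoc, Units.inv_mul, one_mul] at h'
  exact tateModule_natCast_pow_smul_eq_zero h'

lemma tateModule_smul_left_cancel {a b : ℤ_[ℓ]} {x : tateModule ℓ A} (hx : x ≠ 0)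
    (h : a • x = b • x) : a = b := by
  by_contra hne
  exact hx (tateModule_smul_eq_zero (a := a - b) (by rw [sub_smul, h, sub_self])
    (sub_ne_zero.2 hne))

lemma exists_tateModule_apply_one (hs : ∀ P : A, ∃ Q, ℓ • Q = P) {P : A} (hP : ℓ • P = 0) :
    ∃ x : tateModule ℓ A, x.1 1 = P := by
  choose f hf using hs
  let s : ℕ → A := fun n => Nat.casesOn n 0 fun m => f^[m] P
  refine ⟨⟨s, rfl, fun n => ?_⟩, rfl⟩
  rcases n with _ | n
  · exact hP
  · change ℓ • f^[n + 1] P = f^[n] P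
    rw [Function.iterate_succ_apply', hf]

/-- The elements `x` and `y` of the Tate module give a basis of `A[ℓ ^ n]` for all `n`. -/
def IsTateBasis (x y : tateModule ℓ A) : Prop :=
  ∀ n, (∀ a b : ℤ_[ℓ], (a • x + b • y).1 n = 0 → (ℓ : ℤ_[ℓ]) ^ n ∣ a ∧ (ℓ : ℤ_[ℓ]) ^ n ∣ b) ∧
    ∀ P : A, ℓ ^ n • P = 0 → ∃ a b : ℤ_[ℓ], (a • x + b • y).1 n = P

lemma tateModule_independent_pow {x y : tateModule ℓ A}
    (h : ∀ a b : ℤ_[ℓ], (a • x + b • y).1 1 = 0 → (ℓ : ℤ_[ℓ]) ∣ a ∧ (ℓ : ℤ_[ℓ]) ∣ b) (n : ℕ)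
    (a b : ℤ_[ℓ]) (hab : (a • x + b • y).1 n = 0) :
    (ℓ : ℤ_[ℓ]) ^ n ∣ a ∧ (ℓ : ℤ_[ℓ]) ^ n ∣ b := by
  induction n generalizing a b with
  | zero => simp
  | succ n ih =>
    obtain ⟨⟨a, rfl⟩, b, rfl⟩ := h a b (by
      rw [← tateModule_pow_smul_apply _ 1 n, add_comm 1 n, hab, smul_zero])
    obtain ⟨h₁, h₂⟩ := ih a b (by
      rw [mul_smul, mul_smul, ← smul_add, tateModule_natCast_smul_apply,
        (a • x + b • y).2.2] at hab
      exact hab)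
    rw [pow_succ']
    exact ⟨mul_dvd_mul_left _ h₁, mul_dvd_mul_left _ h₂⟩

/-- Successive approximation: once ℓ^n P is matched at level one, the error is killed by ℓ^n. -/
lemma tateModule_span_pow {x y : tateModule ℓ A}
    (h : ∀ P : A, ℓ • P = 0 → ∃ a b : ℤ_[ℓ], (a • x + b • y).1 1 = P) (n : ℕ)
    (P : A) (hP : ℓ ^ n • P = 0) : ∃ a b : ℤ_[ℓ], (a • x + b • y).1 n = P := by
  induction n generalizing P with
  | zero => exact ⟨0, 0, by simpa using hP.symm⟩
  | succ n ih =>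
    obtain ⟨a, b, hab⟩ := h (ℓ ^ n • P) (by rw [smul_smul, ← pow_succ', hP])
    obtain ⟨c, d, hcd⟩ := ih (P - (a • x + b • y).1 (n + 1)) (by
      rw [smul_sub, add_comm n 1, tateModule_pow_smul_apply, hab, sub_self])
    refine ⟨a + ℓ * c, b + ℓ * d, ?_⟩
    have : (a + ℓ * c) • x + (b + ℓ * d) • y = (a • x + b • y) + (ℓ : ℤ_[ℓ]) • (c • x + d • y) := by
      rw [add_smul, add_smul, mul_smul, mul_smul, smul_add]
      abel
    rw [this, tateModule_add_apply, tateModule_natCast_smul_apply, (c • x + d • y).2.2, hcd,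
      add_sub_cancel]

/-- By independence the ℓ² combinations with coefficients below ℓ are distinct in A[ℓ], so they
exhaust it; both properties then lift to all levels. -/
lemma isTateBasis_of_independent (hA : Nat.card {P : A // ℓ • P = 0} = ℓ ^ 2)
    {x y : tateModule ℓ A}
    (h : ∀ a b : ℤ_[ℓ], (a • x + b • y).1 1 = 0 → (ℓ : ℤ_[ℓ]) ∣ a ∧ (ℓ : ℤ_[ℓ]) ∣ b) :
    IsTateBasis x y := by
  have hℓ0 : ℓ ≠ 0 := (Fact.out : ℓ.Prime).ne_zero
  have hfin : Finite {P : A // ℓ • P = 0} :=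
    Nat.finite_of_card_ne_zero (by rw [hA]; exact pow_ne_zero 2 hℓ0)
  refine fun n => ⟨tateModule_independent_pow h n, tateModule_span_pow (fun P hP => ?_) n⟩
  let f : Fin ℓ × Fin ℓ → {P : A // ℓ • P = 0} := fun c =>
    ⟨(((c.1 : ℕ) : ℤ_[ℓ]) • x + ((c.2 : ℕ) : ℤ_[ℓ]) • y).1 1, by
      have := tateModule_pow_smul (((c.1 : ℕ) : ℤ_[ℓ]) • x + ((c.2 : ℕ) : ℤ_[ℓ]) • y) 1
      rwa [pow_one] at this⟩
  have aux (c d : Fin ℓ) (hcd : (ℓ : ℤ_[ℓ]) ∣ ((c : ℕ) : ℤ_[ℓ]) - ((d : ℕ) : ℤ_[ℓ])) : c = d := by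
    have h₁ : (ℓ : ℤ) ^ 1 ∣ ((c : ℕ) : ℤ) - ((d : ℕ) : ℤ) := by
      rw [← PadicInt.pow_p_dvd_int_iff]
      push_cast
      simpa using hcd
    rw [pow_one] at h₁
    exact Fin.ext (Nat.ModEq.eq_of_lt_of_lt ((Nat.modEq_iff_dvd.2 h₁).symm) c.2 d.2)
  have hf : Function.Injective f := by
    intro c d hcd
    have h₁ := congrArg Subtype.val hcd
    obtain ⟨h₂, h₃⟩ := h (((c.1 : ℕ) : ℤ_[ℓ]) - ((d.1 : ℕ) : ℤ_[ℓ]))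
      (((c.2 : ℕ) : ℤ_[ℓ]) - ((d.2 : ℕ) : ℤ_[ℓ])) (by
        have e : ∀ a b a' b' : ℤ_[ℓ], ((a - a') • x + (b - b') • y).1 1 =
            (a • x + b • y).1 1 - (a' • x + b' • y).1 1 := fun a b a' b' => by
          have : (a - a') • x + (b - b') • y = (a • x + b • y) - (a' • x + b' • y) := by
            rw [sub_smul, sub_smul]
            abel
          rw [this]
          rfl
        rw [e, sub_eq_zero]
        exact h₁)
    exact Prod.ext (aux _ _ h₂) (aux _ _ h₃)
  obtain ⟨c, hc⟩ := (hf.bijective_of_nat_card_le (by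
    rw [hA, Nat.card_prod, Nat.card_fin, sq])).2 ⟨P, hP⟩
  exact ⟨_, _, congrArg Subtype.val hc⟩

lemma exists_isTateBasis (hs : ∀ P : A, ∃ Q, ℓ • Q = P)
    (hA : Nat.card {P : A // ℓ • P = 0} = ℓ ^ 2) : ∃ x y : tateModule ℓ A, IsTateBasis x y := by
  have hℓ1 : 1 < ℓ := (Fact.out : ℓ.Prime).one_lt
  have hfin : Finite {P : A // ℓ • P = 0} :=
    Nat.finite_of_card_ne_zero (by rw [hA]; positivity)
  have hnt : Nontrivial {P : A // ℓ • P = 0} := by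
    rw [← Finite.one_lt_card_iff_nontrivial, hA]
    exact Nat.one_lt_pow two_ne_zero hℓ1
  obtain ⟨P, hP⟩ := exists_ne (⟨0, smul_zero ℓ⟩ : {P : A // ℓ • P = 0})
  have hP0 : P.1 ≠ 0 := fun h => hP (Subtype.ext h)
  obtain ⟨Q, hQ, hQn⟩ : ∃ Q : A, ℓ • Q = 0 ∧ ∀ n : ℕ, Q ≠ n • P.1 := by
    by_contra! H
    have hle := Nat.card_le_card_of_surjective (fun n : Fin ℓ => (⟨(n : ℕ) • P.1, by
      rw [smul_comm, P.2, smul_zero]⟩ : {P : A // ℓ • P = 0})) (by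
        rintro ⟨Q, hQ⟩
        obtain ⟨n, rfl⟩ := H Q hQ
        refine ⟨⟨n % ℓ, Nat.mod_lt _ (by omega)⟩, Subtype.ext ?_⟩
        change (n % ℓ) • P.1 = n • P.1
        conv_rhs => rw [← Nat.mod_add_div n ℓ, add_smul, mul_comm, mul_smul, P.2, smul_zero,
          add_zero])
    rw [hA, Nat.card_fin] at hle
    nlinarith
  obtain ⟨x, hx⟩ := exists_tateModule_apply_one hs P.2
  obtain ⟨y, hy⟩ := exists_tateModule_apply_one hs hQ
  refine ⟨x, y, isTateBasis_of_independent hA fun a b hab => ?_⟩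
  have hunit {c : ℤ_[ℓ]} (hc : ¬ (ℓ : ℤ_[ℓ]) ∣ c) : IsUnit c := by
    by_contra hu
    exact hc ((PadicInt.norm_lt_one_iff_dvd c).1 (PadicInt.not_isUnit_iff.1 hu))
  have hb : (ℓ : ℤ_[ℓ]) ∣ b := by
    by_contra hb
    obtain ⟨u, rfl⟩ := hunit hb
    have e : y = (-((u⁻¹ : ℤ_[ℓ]ˣ) : ℤ_[ℓ]) * a) • x +
        ((u⁻¹ : ℤ_[ℓ]ˣ) : ℤ_[ℓ]) • (a • x + (u : ℤ_[ℓ]) • y) := by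
      rw [smul_add, smul_smul, smul_smul, Units.inv_mul, one_smul, neg_mul, neg_smul,
        neg_add_cancel_left]
    obtain ⟨m, -, hm⟩ := tateModule_smul_apply_eq_nsmul (A := A) (-((u⁻¹ : ℤ_[ℓ]ˣ) : ℤ_[ℓ]) * a) 1
    refine hQn m ?_
    rw [← hy, ← hx, ← hm]
    conv_lhs => rw [e]
    rw [tateModule_add_apply, tateModule_smul_apply _ (a • x + (u : ℤ_[ℓ]) • y), hab, smul_zero,
      add_zero]
  refine ⟨?_, hb⟩
  by_contra ha
  obtain ⟨u, rfl⟩ := hunit ha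
  rw [tateModule_add_apply, tateModule_smul_apply_eq_zero (a := b) (by rwa [pow_one]),
    add_zero] at hab
  have e : x = ((u⁻¹ : ℤ_[ℓ]ˣ) : ℤ_[ℓ]) • ((u : ℤ_[ℓ]) • x) := by
    rw [smul_smul, Units.inv_mul, one_smul]
  refine hP0 ?_
  rw [← hx, e, tateModule_smul_apply, hab, smul_zero]

/-- The coordinates found at each level have a convergent subsequence, because ℤ_ℓ × ℤ_ℓ is compact.
-/
lemma IsTateBasis.exists_eq {x y : tateModule ℓ A} (h : IsTateBasis x y) (z : tateModule ℓ A) :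
    ∃ a b : ℤ_[ℓ], z = a • x + b • y := by
  choose c hc using fun n => (h n).2 (z.1 n) (tateModule_pow_smul z n)
  choose d hd using hc
  obtain ⟨⟨a, b⟩, φ, hφ, hlim⟩ := CompactSpace.tendsto_subseq fun n => (c n, d n)
  refine ⟨a, b, ?_⟩
  ext n
  have hclose (f : ℕ → ℤ_[ℓ]) (t : ℤ_[ℓ]) (hf : Filter.Tendsto f Filter.atTop (nhds t)) :
      ∀ᶠ m in Filter.atTop, (ℓ : ℤ_[ℓ]) ^ n ∣ f m - t := by
    have hpos : (0 : ℝ) < (ℓ : ℝ) ^ (-n : ℤ) :=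
      zpow_pos (by exact_mod_cast (Fact.out : ℓ.Prime).pos) _
    filter_upwards [(tendsto_iff_norm_sub_tendsto_zero.1 hf).eventually (gt_mem_nhds hpos)]
      with m hm
    rw [← Ideal.mem_span_singleton, ← PadicInt.norm_le_pow_iff_mem_span_pow]
    exact hm.le
  obtain ⟨m, ⟨h₁, h₂⟩, hm⟩ := ((hclose _ a ((continuous_fst.tendsto _).comp hlim)).and
    (hclose _ b ((continuous_snd.tendsto _).comp hlim))).and
    (Filter.eventually_ge_atTop n) |>.exists
  obtain ⟨r, hr⟩ := Nat.exists_eq_add_of_le (hm.trans (hφ.id_le m))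
  have e := hd (φ m)
  have e' : (c (φ m) • x + d (φ m) • y).1 n = z.1 n := by
    have e₁ := tateModule_pow_smul_apply (c (φ m) • x + d (φ m) • y) n r
    have e₂ := tateModule_pow_smul_apply z n r
    rw [← e₁, ← e₂, ← hr]
    exact congrArg _ e
  rw [← e', tateModule_add_apply, tateModule_add_apply]
  exact congrArg₂ _ (tateModule_smul_apply_congr h₁ x) (tateModule_smul_apply_congr h₂ y)

lemma exists_apply_one_ne_zero {v : tateModule ℓ A} (hv : v ≠ 0) :
    ∃ (n : ℕ) (u : tateModule ℓ A), v = (ℓ : ℤ_[ℓ]) ^ n • u ∧ u.1 1 ≠ 0 := by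
  have hex : ∃ n, v.1 n ≠ 0 := by
    by_contra! H
    exact hv (Subtype.ext (funext H))
  have hpos : Nat.find hex ≠ 0 := fun h => by
    have := Nat.find_spec hex
    rw [h] at this
    exact this v.2.1
  obtain ⟨n, hn⟩ := Nat.exists_eq_succ_of_ne_zero hpos
  have h0 : v.1 n = 0 := not_not.1 (Nat.find_min hex (hn ▸ Nat.lt_succ_self n))
  obtain ⟨u, hu⟩ := exists_eq_pow_smul_of_apply_eq_zero h0
  refine ⟨n, u, hu, fun h1 => Nat.find_spec hex ?_⟩
  obtain ⟨u', rfl⟩ := exists_eq_pow_smul_of_apply_eq_zero h1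
  rw [smul_smul, ← pow_add] at hu
  rw [hn]
  conv_lhs => rw [hu]
  exact tateModule_smul_apply_eq_zero dvd_rfl u'

/-- In a Tate module of rank two, the eigenspace of one of two distinct eigenvalues is spanned by
any of its primitive elements. -/
lemma IsTateBasis.exists_eq_smul_of_eigenvector {x y : tateModule ℓ A} (h : IsTateBasis x y)
    (π : Module.End ℤ_[ℓ] (tateModule ℓ A)) {lam mu : ℤ_[ℓ]} (hne : lam ≠ mu)
    {v w u : tateModule ℓ A} (hv : π v = lam • v) (hv1 : v.1 1 ≠ 0) (hw : π w = mu • w)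
    (hw0 : w ≠ 0) (hu : π u = lam • u) : ∃ c : ℤ_[ℓ], u = c • v := by
  obtain ⟨a, b, rfl⟩ := h.exists_eq v
  obtain ⟨c, d, rfl⟩ := h.exists_eq u
  -- Otherwise u and v would generate a submodule containing nonzero multiples of x and y, and π
  -- would be λ on the whole module, which w contradicts.
  have hdet : a * d - b * c = 0 := by
    by_contra hδ
    have eig {z : tateModule ℓ A} (hz : π ((a * d - b * c) • z) = lam • ((a * d - b * c) • z)) :
        π z = lam • z := by
      rw [← sub_eq_zero]
      refine tateModule_smul_eq_zero (a := a * d - b * c) ?_ hδ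
      rw [smul_sub, ← map_smul, hz, smul_comm, sub_self]
    have hx : π x = lam • x := eig (by
      have e : (a * d - b * c) • x = d • (a • x + b • y) - b • (c • x + d • y) := by module
      rw [e, map_sub, map_smul, map_smul, hv, hu]
      module)
    have hy : π y = lam • y := eig (by
      have e : (a * d - b * c) • y = a • (c • x + d • y) - c • (a • x + b • y) := by module
      rw [e, map_sub, map_smul, map_smul, hv, hu]
      module)
    obtain ⟨r, s, rfl⟩ := h.exists_eq w
    refine hw0 (tateModule_smul_eq_zero (a := lam - mu) ?_ (sub_ne_zero.2 hne))
    rw [sub_smul, ← hw, map_add, map_smul, map_smul, hx, hy]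
    module
  have hunit : IsUnit a ∨ IsUnit b := by
    by_contra! H
    have hd {t : ℤ_[ℓ]} (ht : ¬ IsUnit t) : (ℓ : ℤ_[ℓ]) ^ 1 ∣ t := by
      rw [pow_one]
      exact (PadicInt.norm_lt_one_iff_dvd t).1 (PadicInt.not_isUnit_iff.1 ht)
    exact hv1 (by rw [tateModule_add_apply, tateModule_smul_apply_eq_zero (hd H.1),
      tateModule_smul_apply_eq_zero (hd H.2), add_zero])
  rcases hunit with ⟨t, rfl⟩ | ⟨t, rfl⟩
  · refine ⟨((t⁻¹ : ℤ_[ℓ]ˣ) : ℤ_[ℓ]) * c, ?_⟩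
    have e : d = ((t⁻¹ : ℤ_[ℓ]ˣ) : ℤ_[ℓ]) * c * b := by
      linear_combination ((t⁻¹ : ℤ_[ℓ]ˣ) : ℤ_[ℓ]) * hdet - d * t.inv_mul
    have e' : c = ((t⁻¹ : ℤ_[ℓ]ˣ) : ℤ_[ℓ]) * c * t := by linear_combination -c * t.inv_mul
    rw [smul_add, smul_smul, smul_smul, ← e, ← e']
  · refine ⟨((t⁻¹ : ℤ_[ℓ]ˣ) : ℤ_[ℓ]) * d, ?_⟩
    have e : c = ((t⁻¹ : ℤ_[ℓ]ˣ) : ℤ_[ℓ]) * d * a := by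
      linear_combination (-((t⁻¹ : ℤ_[ℓ]ˣ) : ℤ_[ℓ])) * hdet - c * t.inv_mul
    have e' : d = ((t⁻¹ : ℤ_[ℓ]ˣ) : ℤ_[ℓ]) * d * t := by linear_combination -d * t.inv_mul
    rw [smul_add, smul_smul, smul_smul, ← e, ← e']

end TateModule

/-! ### Homomorphisms from a number field to `ℚ_ℓ` -/

section NumberField

variable {ℓ : ℕ} [Fact ℓ.Prime]

lemma exists_padicInt_eq_of_isIntegral {x : ℚ_[ℓ]} (hx : IsIntegral ℤ_[ℓ] x) :
    ∃ z : ℤ_[ℓ], (z : ℚ_[ℓ]) = x := by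
  obtain ⟨z, hz⟩ := IsIntegrallyClosed.isIntegral_iff.1 hx
  exact ⟨z, hz⟩

variable {K : Type*} [Field K]

open NumberField in
lemma exists_padicInt_eq (g : K →+* ℚ_[ℓ]) (x : 𝓞 K) : ∃ z : ℤ_[ℓ], (z : ℚ_[ℓ]) = g x :=
  exists_padicInt_eq_of_isIntegral
    ((map_isIntegral_int g (RingOfIntegers.isIntegral_coe x)).tower_top)

variable [NumberField K]

open NumberField in
/-- If `ℓ` does not divide the discriminant, then distinct homomorphisms from the maximal order to
`ℤ_ℓ` remain distinct modulo `ℓ`. -/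
theorem exists_not_dvd_sub {g₁ g₂ : K →+* ℚ_[ℓ]} (hg : g₁ ≠ g₂) (hd : ¬ (ℓ : ℤ) ∣ discr K) :
    ∃ (x : 𝓞 K) (z : ℤ_[ℓ]), (z : ℚ_[ℓ]) = g₁ x - g₂ x ∧ ¬ (ℓ : ℤ_[ℓ]) ∣ z := by
  by_contra! H
  have H' (x : 𝓞 K) : ∃ c : ℤ_[ℓ], g₁ x - g₂ x = ℓ * c := by
    obtain ⟨z₁, h₁⟩ := exists_padicInt_eq g₁ x
    obtain ⟨z₂, h₂⟩ := exists_padicInt_eq g₂ x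
    obtain ⟨c, hc⟩ := H x (z₁ - z₂) (by rw [PadicInt.coe_sub, h₁, h₂])
    refine ⟨c, ?_⟩
    rw [← h₁, ← h₂, ← PadicInt.coe_sub, hc, PadicInt.coe_mul, PadicInt.coe_natCast]
  choose c hc using H'
  let Ω := AlgebraicClosure ℚ_[ℓ]
  let f₁ : K →ₐ[ℚ] Ω := ((algebraMap ℚ_[ℓ] Ω).comp g₁).toRatAlgHom
  let f₂ : K →ₐ[ℚ] Ω := ((algebraMap ℚ_[ℓ] Ω).comp g₂).toRatAlgHom
  have hf : f₁ ≠ f₂ := by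
    intro h
    refine hg (RingHom.ext fun x => ?_)
    exact (algebraMap ℚ_[ℓ] Ω).injective (DFunLike.congr_fun h x)
  let b := integralBasis K
  let ι := Module.Free.ChooseBasisIndex ℤ (𝓞 K)
  have hcard : Fintype.card ι = Fintype.card (K →ₐ[ℚ] Ω) := by
    rw [AlgHom.card, Module.finrank_eq_card_basis b]
  let e : ι ≃ (K →ₐ[ℚ] Ω) := Fintype.equivOfCardEq hcard
  let M := Algebra.embeddingsMatrixReindex ℚ Ω b e
  have hdisc : algebraMap ℚ Ω (discr K : ℚ) = M.det ^ 2 := by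
    rw [coe_discr]
    exact Algebra.discr_eq_det_embeddingsMatrixReindex_pow_two ℚ Ω b e
  have hM (i j : ι) : M i j = e j (b i) := rfl
  have hbi (i : ι) : b i = ((RingOfIntegers.basis K i : 𝓞 K) : K) := integralBasis_apply K i
  have hint (i j : ι) : IsIntegral ℤ_[ℓ] (M i j) := by
    rw [hM, hbi]
    exact ((RingOfIntegers.isIntegral_coe _).map ((e j).restrictScalars ℤ)).tower_top
  let j₁ := e.symm f₁
  let j₂ := e.symm f₂
  have hj : j₁ ≠ j₂ := fun h => hf (e.symm.injective h)
  let col : ι → Ω := fun i => algebraMap ℚ_[ℓ] Ω (c (RingOfIntegers.basis K i))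
  -- Subtracting the column of g₂ from that of g₁ leaves ℓ times an integral column.
  have hdet : M.det = (ℓ : Ω) * (M.updateCol j₁ col).det := by
    rw [← Matrix.det_updateCol_smul, ← Matrix.det_updateCol_add_smul_self M hj (-1)]
    congr 2
    ext i
    simp only [Pi.smul_apply, smul_eq_mul, hM, j₁, j₂,
      Equiv.apply_symm_apply, col]
    rw [hbi]
    have := congrArg (algebraMap ℚ_[ℓ] Ω) (hc (RingOfIntegers.basis K i))
    rw [map_sub, map_mul, map_natCast] at this
    rw [← this]
    change algebraMap ℚ_[ℓ] Ω (g₁ _) + -1 * algebraMap ℚ_[ℓ] Ω (g₂ _) = _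
    ring
  have hδ : IsIntegral ℤ_[ℓ] ((M.updateCol j₁ col).det ^ 2) := by
    refine (IsIntegral.det fun i j => ?_).pow 2
    rw [Matrix.updateCol_apply]
    split_ifs
    · exact (isIntegral_algebraMap (R := ℤ_[ℓ]) (x := c (RingOfIntegers.basis K i))).map
        (IsScalarTower.toAlgHom ℤ_[ℓ] ℚ_[ℓ] Ω)
    · exact hint i j
  have hℓ : (ℓ : ℚ_[ℓ]) ≠ 0 := Nat.cast_ne_zero.2 (Fact.out : ℓ.Prime).ne_zero
  -- So d_K / ℓ² is integral over ℤ_ℓ; as it lies in ℚ_ℓ, it lies in ℤ_ℓ.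
  have hval : (M.updateCol j₁ col).det ^ 2 =
      algebraMap ℚ_[ℓ] Ω ((discr K : ℚ_[ℓ]) / (ℓ : ℚ_[ℓ]) ^ 2) := by
    rw [map_div₀, map_pow, map_natCast, map_intCast, eq_div_iff]
    · rw [hdet] at hdisc
      rw [map_intCast] at hdisc
      rw [hdisc]
      ring
    · rw [← map_natCast (algebraMap ℚ_[ℓ] Ω)]
      exact pow_ne_zero 2 ((map_ne_zero _).2 hℓ)
  rw [hval, isIntegral_algebraMap_iff (algebraMap ℚ_[ℓ] Ω).injective] at hδ
  obtain ⟨z, hz⟩ := exists_padicInt_eq_of_isIntegral hδ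
  rw [eq_div_iff (pow_ne_zero 2 hℓ)] at hz
  apply hd
  rw [← pow_one (ℓ : ℤ), ← PadicInt.pow_p_dvd_int_iff, pow_one]
  refine ⟨z * ℓ, ?_⟩
  apply PadicInt.ext
  push_cast
  rw [← hz]
  ring

end NumberField

/-! ### The action of the endomorphism ring on the Tate module -/

section ComplexMultiplication

variable {ℓ : ℕ} [Fact ℓ.Prime] {A : Type*} [AddCommGroup A]

variable (ℓ A) in
/-- The action of the endomorphism ring on the Tate module. -/
def tateEnd : AddMonoid.End A →+* Module.End ℤ_[ℓ] (tateModule ℓ A) where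
  toFun := tateMap ℓ
  map_one' := rfl
  map_mul' _ _ := rfl
  map_zero' := rfl
  map_add' _ _ := rfl

lemma tateModule_sub_apply (x y : tateModule ℓ A) (n : ℕ) : (x - y).1 n = x.1 n - y.1 n := rfl

lemma tateEnd_apply_apply (φ : AddMonoid.End A) (x : tateModule ℓ A) (n : ℕ) :
    (tateEnd ℓ A φ x).1 n = φ (x.1 n) := rfl

/-- The eigenvalue on v is unique because the Tate module is torsion-free, and uniqueness makes it
multiplicative and additive. -/
lemma exists_eigencharacter {R : Type*} [Ring R]
    (ρ : R →+* Module.End ℤ_[ℓ] (tateModule ℓ A)) {v : tateModule ℓ A} (hv : v ≠ 0)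
    (h : ∀ r, ∃ c : ℤ_[ℓ], ρ r v = c • v) : ∃ c : R →+* ℤ_[ℓ], ∀ r, ρ r v = c r • v := by
  choose c hc using h
  have h1 : c 1 = 1 := tateModule_smul_left_cancel hv (by rw [← hc, map_one, one_smul]; rfl)
  have h2 (r s : R) : c (r * s) = c r * c s := tateModule_smul_left_cancel hv (by
    rw [← hc, map_mul, Module.End.mul_apply, hc s, map_smul, hc r, smul_smul, mul_comm])
  have h3 : c 0 = 0 := tateModule_smul_left_cancel hv (by rw [← hc, map_zero, zero_smul]; rfl)
  have h4 (r s : R) : c (r + s) = c r + c s := tateModule_smul_left_cancel hv (by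
    rw [← hc, map_add, LinearMap.add_apply, hc, hc, add_smul])
  exact ⟨⟨⟨⟨c, h1⟩, h2⟩, h3, h4⟩, hc⟩

lemma exists_nsmul_eq_zero_of_tmul_eq_zero {M : Type*} [AddCommGroup M] {x : M}
    (h : (1 : ℚ) ⊗ₜ[ℤ] x = 0) : ∃ n : ℤ, n ≠ 0 ∧ n • x = 0 := by
  obtain ⟨c, hc⟩ := (IsLocalizedModule.eq_zero_iff (nonZeroDivisors ℤ)
    (TensorProduct.mk ℤ ℚ M 1)).1 h
  exact ⟨c, nonZeroDivisors.ne_zero c.2, hc⟩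

variable {K : Type*} [Field K] [NumberField K]

open NumberField in
/-- If a ring `S` of endomorphisms becomes a number field unramified at `ℓ` after tensoring with `ℚ`
and is `ℓ`-maximal there, then an element of `S` with distinct eigenvalues on a Tate module of
rank two is diagonalizable. -/
theorem isTateBasis_of_eigenvectors (hs : ∀ P : A, ∃ Q, ℓ • Q = P)
    (hA : Nat.card {P : A // ℓ • P = 0} = ℓ ^ 2) (S : Subring (AddMonoid.End A))
    (e : (ℚ ⊗[ℤ] S) ≃+* K)
    (hmax : ¬ ℓ ∣ (e.toRingHom.comp (Algebra.TensorProduct.includeRight :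
      S →ₐ[ℤ] ℚ ⊗[ℤ] S).toRingHom).range.toAddSubgroup.relIndex
      (integralClosure ℤ K).toSubring.toAddSubgroup)
    (hd : ¬ (ℓ : ℤ) ∣ discr K) {φ : AddMonoid.End A} (hφ : φ ∈ S) {lam mu : ℤ_[ℓ]}
    (hne : lam ≠ mu) {v w : tateModule ℓ A} (hv : tateEnd ℓ A φ v = lam • v) (hv1 : v.1 1 ≠ 0)
    (hw : tateEnd ℓ A φ w = mu • w) (hw1 : w.1 1 ≠ 0) : IsTateBasis v w := by
  have hv0 : v ≠ 0 := fun h => hv1 (by rw [h]; rfl)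
  have hw0 : w ≠ 0 := fun h => hw1 (by rw [h]; rfl)
  obtain ⟨x, y, hxy⟩ := exists_isTateBasis hs hA
  -- S becomes commutative after tensoring with ℚ, so commutators are torsion in S, and torsion acts
  -- as zero on a torsion-free module.
  have hcomm (a : S) (z : tateModule ℓ A) :
      tateEnd ℓ A φ (tateEnd ℓ A a z) = tateEnd ℓ A a (tateEnd ℓ A φ z) := by
    have h0 : (1 : ℚ) ⊗ₜ[ℤ] ((⟨φ, hφ⟩ : S) * a - a * ⟨φ, hφ⟩) = 0 := by
      rw [TensorProduct.tmul_sub]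
      have e₁ : (1 : ℚ) ⊗ₜ[ℤ] ((⟨φ, hφ⟩ : S) * a) = (1 : ℚ) ⊗ₜ[ℤ] (⟨φ, hφ⟩ : S) * (1 : ℚ) ⊗ₜ[ℤ] a := by
        rw [Algebra.TensorProduct.tmul_mul_tmul, one_mul]
      have e₂ : (1 : ℚ) ⊗ₜ[ℤ] (a * (⟨φ, hφ⟩ : S)) = (1 : ℚ) ⊗ₜ[ℤ] a * (1 : ℚ) ⊗ₜ[ℤ] (⟨φ, hφ⟩ : S) := by
        rw [Algebra.TensorProduct.tmul_mul_tmul, one_mul]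
      rw [e₁, e₂, sub_eq_zero]
      refine e.injective ?_
      rw [map_mul, map_mul, mul_comm]
    obtain ⟨n, hn, hn0⟩ := exists_nsmul_eq_zero_of_tmul_eq_zero h0
    have h1 := congrArg (fun s : S => tateEnd ℓ A (s : AddMonoid.End A) z) hn0
    rw [← sub_eq_zero]
    refine tateModule_smul_eq_zero (a := (n : ℤ_[ℓ])) ?_ (Int.cast_ne_zero.2 hn)
    rw [Int.cast_smul_eq_zsmul]
    have h2 : tateEnd ℓ A ((n • ((⟨φ, hφ⟩ : S) * a - a * ⟨φ, hφ⟩) : S) : AddMonoid.End A) =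
        n • (tateEnd ℓ A φ * tateEnd ℓ A a - tateEnd ℓ A a * tateEnd ℓ A φ) := by
      rw [← map_mul, ← map_mul, ← map_sub, ← map_zsmul]
      rfl
    simp only [h2] at h1
    rw [LinearMap.smul_apply] at h1
    exact h1.trans (by simp)
  obtain ⟨c₁, hc₁⟩ := exists_eigencharacter ((tateEnd ℓ A).comp S.subtype) hv0 fun a =>
    hxy.exists_eq_smul_of_eigenvector _ hne hv hv1 hw hw0 (by
      change tateEnd ℓ A φ (tateEnd ℓ A a v) = lam • tateEnd ℓ A a v
      rw [hcomm, hv, map_smul])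
  obtain ⟨c₂, hc₂⟩ := exists_eigencharacter ((tateEnd ℓ A).comp S.subtype) hw0 fun a =>
    hxy.exists_eq_smul_of_eigenvector _ hne.symm hw hw1 hv hv0 (by
      change tateEnd ℓ A φ (tateEnd ℓ A a w) = mu • tateEnd ℓ A a w
      rw [hcomm, hw, map_smul])
  have hext (c : S →+* ℤ_[ℓ]) : ∃ g : K →+* ℚ_[ℓ], ∀ a : S, g (e (1 ⊗ₜ a)) = c a := by
    let L : ℚ ⊗[ℤ] S →ₐ[ℤ] ℚ_[ℓ] := Algebra.TensorProduct.lift (Rat.castHom ℚ_[ℓ]).toIntAlgHom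
      ((algebraMap ℤ_[ℓ] ℚ_[ℓ]).comp c).toIntAlgHom fun _ _ => Commute.all _ _
    refine ⟨L.toRingHom.comp e.symm.toRingHom, fun a => ?_⟩
    change L (e.symm (e _)) = _
    rw [RingEquiv.symm_apply_apply, Algebra.TensorProduct.lift_tmul, map_one, one_mul]
    rfl
  obtain ⟨g₁, hg₁⟩ := hext c₁
  obtain ⟨g₂, hg₂⟩ := hext c₂
  have hg : g₁ ≠ g₂ := by
    rintro rfl
    have h := (hg₁ ⟨φ, hφ⟩).symm.trans (hg₂ ⟨φ, hφ⟩)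
    have e₁ : lam = c₁ ⟨φ, hφ⟩ := tateModule_smul_left_cancel hv0 (hv.symm.trans (hc₁ ⟨φ, hφ⟩))
    have e₂ : mu = c₂ ⟨φ, hφ⟩ := tateModule_smul_left_cancel hw0 (hw.symm.trans (hc₂ ⟨φ, hφ⟩))
    exact hne (by rw [e₁, e₂]; exact PadicInt.ext h)
  obtain ⟨t, z, hz, hzℓ⟩ := exists_not_dvd_sub hg hd
  set I := (e.toRingHom.comp (Algebra.TensorProduct.includeRight :
      S →ₐ[ℤ] ℚ ⊗[ℤ] S).toRingHom).range.toAddSubgroup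
  set O := (integralClosure ℤ K).toSubring.toAddSubgroup
  -- The index multiplies the maximal order into S. An infinite index would count as 0, which `hmax`
  -- excludes, so this factor is prime to ℓ.
  obtain ⟨a, ha⟩ : ∃ a : S, e (1 ⊗ₜ a) = (I.relIndex O : K) * (t : K) := by
    have := AddSubgroup.nsmul_index_mem (I.addSubgroupOf O) ⟨t, RingOfIntegers.isIntegral_coe t⟩
    rw [AddSubgroup.mem_addSubgroupOf] at this
    obtain ⟨a, ha⟩ := this
    refine ⟨a, ?_⟩
    rw [← nsmul_eq_mul]
    exact ha
  have hca : c₁ a - c₂ a = (I.relIndex O : ℤ_[ℓ]) * z := by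
    apply PadicInt.ext
    rw [PadicInt.coe_sub, ← hg₁, ← hg₂, ha, PadicInt.coe_mul, hz, map_mul, map_mul, map_natCast,
      map_natCast, PadicInt.coe_natCast, mul_sub]
  have hcu : ¬ (ℓ : ℤ_[ℓ]) ∣ c₁ a - c₂ a := by
    rw [hca, PadicInt.prime_p.dvd_mul, not_or]
    refine ⟨fun h => hmax ?_, hzℓ⟩
    have h' : (ℓ : ℤ_[ℓ]) ^ 1 ∣ ((I.relIndex O : ℤ) : ℤ_[ℓ]) := by simpa using h
    rw [PadicInt.pow_p_dvd_int_iff, pow_one] at h'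
    exact_mod_cast h'
  have hprim {r : ℤ_[ℓ]} {u : tateModule ℓ A} (hu : u.1 1 ≠ 0) (h : (r • u).1 1 = 0) :
      (ℓ : ℤ_[ℓ]) ∣ r := by
    by_contra hr
    have hunit : IsUnit r := by
      by_contra hu
      exact hr ((PadicInt.norm_lt_one_iff_dvd r).1 (PadicInt.not_isUnit_iff.1 hu))
    obtain ⟨r, rfl⟩ := hunit
    have e : u = ((r⁻¹ : ℤ_[ℓ]ˣ) : ℤ_[ℓ]) • ((r : ℤ_[ℓ]) • u) := by
      rw [smul_smul, Units.inv_mul, one_smul]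
    exact hu (by rw [e, tateModule_smul_apply, h, smul_zero])
  -- If rv + sw vanishes at level one, so does its image under a. Eliminating one term leaves (c₁(a)
  -- - c₂(a)) times rv or sw, with a factor prime to ℓ.
  refine isTateBasis_of_independent hA fun r s hrs => ?_
  have h₁ : (((r * c₁ a) • v + (s * c₂ a) • w)).1 1 = 0 := by
    have := congrArg (a : AddMonoid.End A) hrs
    rw [map_zero, ← tateEnd_apply_apply, map_add, map_smul, map_smul] at this
    rw [mul_smul, mul_smul, ← hc₁, ← hc₂]
    exact this
  have hsm (b : ℤ_[ℓ]) : (b • (r • v + s • w)).1 1 = 0 := by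
    rw [tateModule_smul_apply, hrs, smul_zero]
  constructor
  · refine (PadicInt.prime_p.dvd_mul.1 (hprim hv1 (r := (c₁ a - c₂ a) * r) ?_)).resolve_left hcu
    have e : ((c₁ a - c₂ a) * r) • v =
      ((r * c₁ a) • v + (s * c₂ a) • w) - c₂ a • (r • v + s • w) := by module
    rw [e, tateModule_sub_apply, h₁, hsm, sub_zero]
  · refine (PadicInt.prime_p.dvd_mul.1 (hprim hw1 (r := (c₁ a - c₂ a) * s) ?_)).resolve_left hcu
    have e : ((c₁ a - c₂ a) * s) • w =
      c₁ a • (r • v + s • w) - ((r * c₁ a) • v + (s * c₂ a) • w) := by module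
    rw [e, tateModule_sub_apply, h₁, hsm, sub_zero]

end ComplexMultiplication

/-! ### Fixed points of the Frobenius endomorphism -/

section FixedPoints

open Polynomial WeierstrassCurve WeierstrassCurve.Affine WeierstrassCurve.Affine.Point

variable {k : Type*} [Field k] [Fintype k]

lemma frobeniusAlgHom_pow_apply {R : Type*} [CommRing R] [Algebra k R] (N : ℕ) (z : R) :
    (FiniteField.frobeniusAlgHom k R ^ N) z = z ^ Fintype.card k ^ N := by
  rw [AlgHom.coe_pow, FiniteField.coe_frobeniusAlgHom, pow_iterate]

section Field

variable {L : Type*} [Field L] [Algebra k L]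

lemma finite_setOf_pow_eq {n : ℕ} (hn : 1 < n) : {z : L | z ^ n = z}.Finite := by
  refine ((X ^ n - X : L[X]).roots.toFinset.finite_toSet).subset fun z hz => ?_
  rw [Finset.mem_coe, Multiset.mem_toFinset,
    mem_roots (FiniteField.X_pow_card_sub_X_ne_zero L hn), IsRoot.def]
  simp only [eval_sub, eval_pow, eval_X]
  exact sub_eq_zero.2 hz

/-- F consists of roots of X^|F| - X, and this polynomial has no room for others. -/
lemma IntermediateField.mem_iff_pow_card_pow_finrank_eq (F : IntermediateField k L)
    (hF : Module.finrank k F ≠ 0) (z : L) :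
    z ∈ F ↔ z ^ Fintype.card k ^ Module.finrank k F = z := by
  have : FiniteDimensional k F := FiniteDimensional.of_finrank_pos (Nat.pos_of_ne_zero hF)
  have : Finite F := Module.finite_of_finite k
  have := Fintype.ofFinite F
  rw [← Module.card_eq_pow_finrank (K := k) (V := F)]
  refine ⟨fun hz => congrArg Subtype.val (FiniteField.pow_card (⟨z, hz⟩ : F)), fun hz => ?_⟩
  have hne : (X ^ Fintype.card F - X : L[X]) ≠ 0 :=
    FiniteField.X_pow_card_sub_X_ne_zero L Fintype.one_lt_card
  have hroot {y : L} (hy : y ^ Fintype.card F = y) :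
      y ∈ (X ^ Fintype.card F - X : L[X]).roots.toFinset := by
    rw [Multiset.mem_toFinset, mem_roots hne, IsRoot.def, eval_sub, eval_pow, eval_X]
    exact sub_eq_zero.2 hy
  have hsub : Finset.univ.map ⟨((↑) : F → L), Subtype.val_injective⟩ ⊆
      (X ^ Fintype.card F - X : L[X]).roots.toFinset := fun y hy => by
    obtain ⟨a, -, rfl⟩ := Finset.mem_map.1 hy
    exact hroot (congrArg Subtype.val (FiniteField.pow_card a))
  have heq := Finset.eq_of_subset_of_card_le hsub (by
    rw [Finset.card_map, Finset.card_univ]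
    refine (Multiset.toFinset_card_le _).trans ((card_roots' _).trans ?_)
    rw [FiniteField.X_pow_card_sub_X_natDegree_eq L Fintype.one_lt_card])
  have := hroot hz
  rw [← heq] at this
  obtain ⟨a, -, rfl⟩ := Finset.mem_map.1 this
  exact a.2

/-- The degree is the order of Frobenius on the generated field, and a power of Frobenius is trivial
there iff it fixes the generators. -/
lemma finrank_adjoin_dvd_iff {s : Set L} (hs : s.Finite) (hint : ∀ z ∈ s, IsIntegral k z) (N : ℕ) :
    Module.finrank k (IntermediateField.adjoin k s) ∣ N ↔
      ∀ z ∈ s, z ^ Fintype.card k ^ N = z := by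
  have := hs.to_subtype
  have : FiniteDimensional k (IntermediateField.adjoin k s) :=
    IntermediateField.finiteDimensional_adjoin hint
  have : Finite (IntermediateField.adjoin k s) := Module.finite_of_finite k
  rw [← FiniteField.orderOf_frobeniusAlgHom k (IntermediateField.adjoin k s), orderOf_dvd_iff_pow_eq_one]
  constructor
  · intro h z hz
    have := DFunLike.congr_fun h ⟨z, IntermediateField.subset_adjoin k s hz⟩
    rw [frobeniusAlgHom_pow_apply] at this
    exact congrArg Subtype.val this
  · intro h
    refine AlgHom.ext fun z => Subtype.ext ?_
    rw [frobeniusAlgHom_pow_apply]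
    change (z : L) ^ _ = z
    obtain ⟨z, hz⟩ := z
    have key (x y : L) : (x + y) ^ Fintype.card k ^ N =
        x ^ Fintype.card k ^ N + y ^ Fintype.card k ^ N := by
      simp only [← frobeniusAlgHom_pow_apply (k := k), map_add]
    induction hz using IntermediateField.adjoin_induction with
    | mem x hx => exact h x hx
    | algebraMap x =>
      change algebraMap k L x ^ _ = algebraMap k L x
      rw [← map_pow, FiniteField.pow_card_pow]
    | add x y _ _ hx hy => exact (key x y).trans (congrArg₂ _ hx hy)
    | inv x _ hx => exact (inv_pow _ _).trans (congrArg _ hx)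
    | mul x y _ _ hx hy => exact (mul_pow _ _ _).trans (congrArg₂ _ hx hy)

end Field

variable (E : WeierstrassCurve k)

lemma curveFrobenius_iterate_some (N : ℕ) {x y : AlgebraicClosure k}
    (h : (E⁄(AlgebraicClosure k)).Nonsingular x y) : ∃ h',
      (curveFrobenius E)^[N] (.some x y h) =
        .some (x ^ Fintype.card k ^ N) (y ^ Fintype.card k ^ N) h' := by
  induction N with
  | zero => exact ⟨by simpa using h, by simp⟩
  | succ N ih =>
    obtain ⟨h', e⟩ := ih
    rw [Function.iterate_succ_apply', e]
    simp only [pow_succ, pow_mul]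
    exact curveFrobenius_some E h'

lemma curveFrobenius_iterate_some_eq_iff (N : ℕ) {x y : AlgebraicClosure k}
    (h : (E⁄(AlgebraicClosure k)).Nonsingular x y) :
    (curveFrobenius E)^[N] (.some x y h) = .some x y h ↔
      x ^ Fintype.card k ^ N = x ∧ y ^ Fintype.card k ^ N = y := by
  obtain ⟨h', e⟩ := curveFrobenius_iterate_some E N h
  rw [e, some.injEq]

lemma curveFrobenius_iterate_zero (N : ℕ) : (curveFrobenius E)^[N] 0 = 0 :=
  iterate_map_zero _ _

lemma curveFrobenius_injective : Function.Injective (curveFrobenius E) :=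
  map_injective (FiniteField.frobeniusAlgHom k (AlgebraicClosure k))

lemma finite_setOf_curveFrobenius_iterate_eq {N : ℕ} (hN : N ≠ 0) :
    {P : GeomPoint E | (curveFrobenius E)^[N] P = P}.Finite := by
  set s := {z : AlgebraicClosure k | z ^ Fintype.card k ^ N = z}
  have hs : s.Finite := finite_setOf_pow_eq (Nat.one_lt_pow hN Fintype.one_lt_card)
  let f : GeomPoint E → Option (AlgebraicClosure k × AlgebraicClosure k) := fun P =>
    match P with
    | 0 => none
    | .some x y _ => some (x, y)
  refine Set.Finite.of_finite_image (f := f)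
    (((hs.prod hs).image some).insert none |>.subset ?_) ?_
  · rintro _ ⟨_ | ⟨x, y, h⟩, hP, rfl⟩
    · exact Or.inl rfl
    · exact Or.inr ⟨(x, y), (curveFrobenius_iterate_some_eq_iff E N h).1 hP, rfl⟩
  · rintro (_ | ⟨x, y, h⟩) - (_ | ⟨x', y', h'⟩) - hPQ
    · rfl
    · cases hPQ
    · cases hPQ
    · cases hPQ
      rfl

/-- The degree of the field of definition of `E[m]` is the order of Frobenius on `E[m]`. -/
theorem torsionDegree_dvd_iff {m : ℕ} (hm : {P : GeomPoint E | m • P = 0}.Finite) (N : ℕ) :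
    torsionDegree E m ∣ N ↔ ∀ P : GeomPoint E, m • P = 0 → (curveFrobenius E)^[N] P = P := by
  have hfin : {z : AlgebraicClosure k | ∃ x y h,
      m • (some x y h : GeomPoint E) = 0 ∧ (z = x ∨ z = y)}.Finite := by
    let f : GeomPoint E → Set (AlgebraicClosure k) := fun P =>
      match P with
      | 0 => ∅
      | .some x y _ => {x, y}
    refine (hm.biUnion (t := f) ?_).subset ?_
    · rintro (_ | ⟨x, y, h⟩) -
      · exact Set.finite_empty
      · exact Set.toFinite {x, y}
    · rintro z ⟨x, y, h, hP, hz⟩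
      exact Set.mem_biUnion (x := some x y h) hP hz
  refine (finrank_adjoin_dvd_iff hfin (fun z _ => Algebra.IsIntegral.isIntegral z) N).trans ?_
  constructor
  · rintro H (_ | ⟨x, y, h⟩) hP
    · exact curveFrobenius_iterate_zero E N
    · exact (curveFrobenius_iterate_some_eq_iff E N h).2
        ⟨H x ⟨x, y, h, hP, Or.inl rfl⟩, H y ⟨x, y, h, hP, Or.inr rfl⟩⟩
  · rintro H z ⟨x, y, h, hP, hz⟩
    have := (curveFrobenius_iterate_some_eq_iff E N h).1 (H _ hP)
    rcases hz with rfl | rfl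
    exacts [this.1, this.2]

lemma isAlgebraicHom_curveFrobenius : IsAlgebraicHom E (curveFrobenius E) := by
  refine Or.inr ⟨C X ^ Fintype.card k, 1, X ^ Fintype.card k, 1, ∅, Set.finite_empty,
    fun x y h _ => ?_⟩
  obtain ⟨h', e⟩ := curveFrobenius_some E h
  simp only [evalEval_pow, evalEval_one, evalEval_C, evalEval_X, eval_X, div_one]
  exact ⟨one_ne_zero, one_ne_zero, h', e⟩

lemma curveFrobenius_mem_endRing : curveFrobenius E ∈ endRing E :=
  Subring.subset_closure (isAlgebraicHom_curveFrobenius E)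

variable (F : IntermediateField k (AlgebraicClosure k))

lemma range_map_val_eq (hF : Module.finrank k F ≠ 0) (P : GeomPoint E) :
    (∃ Q : (E⁄F).Point, Point.map (W' := E) F.val Q = P) ↔
      (curveFrobenius E)^[Module.finrank k F] P = P := by
  constructor
  · rintro ⟨_ | ⟨x, y, h⟩, rfl⟩
    · exact curveFrobenius_iterate_zero E _
    · exact (curveFrobenius_iterate_some_eq_iff E _ _).2
        ⟨(F.mem_iff_pow_card_pow_finrank_eq hF _).1 x.2,
          (F.mem_iff_pow_card_pow_finrank_eq hF _).1 y.2⟩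
  · rcases P with _ | ⟨x, y, h⟩
    · exact fun _ => ⟨0, rfl⟩
    · intro H
      obtain ⟨hx, hy⟩ := (curveFrobenius_iterate_some_eq_iff E _ h).1 H
      rw [← F.mem_iff_pow_card_pow_finrank_eq hF] at hx hy
      exact ⟨Point.some (⟨x, hx⟩ : F) (⟨y, hy⟩ : F)
        ((baseChange_nonsingular E F.val.injective _ _).1 h), rfl⟩

/-- Iterates of the relative Frobenius are Galois conjugate. -/
lemma galoisSetoid_of_iterate (hF : Module.finrank k F ≠ 0) {m : ℕ} (P Q : {P : GeomPoint E // m • P = 0}) (i : ℕ)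
    (h : (curveFrobenius E)^[Module.finrank k F * i] P.1 = Q.1) : (galoisSetoid E F m) P Q := by
  have : FiniteDimensional k F := FiniteDimensional.of_finrank_pos (Nat.pos_of_ne_zero hF)
  have : Finite F := Module.finite_of_finite k
  have := Fintype.ofFinite F
  refine ⟨FiniteField.frobeniusAlgEquivOfAlgebraic F (AlgebraicClosure k) ^ i, ?_⟩
  have hσ (z : AlgebraicClosure k) :
      (FiniteField.frobeniusAlgEquivOfAlgebraic F (AlgebraicClosure k) ^ i) z =
        z ^ Fintype.card k ^ (Module.finrank k F * i) := by
    rw [AlgEquiv.coe_pow, FiniteField.coe_frobeniusAlgEquivOfAlgebraic_iterate, pow_mul,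
      ← Module.card_eq_pow_finrank (K := k) (V := F)]
  rw [← h]
  obtain ⟨_ | ⟨x, y, hxy⟩, hP⟩ := P
  · exact (curveFrobenius_iterate_zero E _).symm
  · obtain ⟨h', e⟩ := curveFrobenius_iterate_some E (Module.finrank k F * i) hxy
    refine Eq.trans ?_ e.symm
    refine (map_some (W' := E) _ hxy).trans ?_
    rw [some.injEq]
    exact ⟨hσ x, hσ y⟩

end FixedPoints

/-! ### Powers of an `ℓ`-adic unit -/

section UnitLevel

variable {ℓ : ℕ} [Fact ℓ.Prime]

lemma PadicInt.pow_dvd_iff_le_valuation {x : ℤ_[ℓ]} (hx : x ≠ 0) (n : ℕ) :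
    (ℓ : ℤ_[ℓ]) ^ n ∣ x ↔ n ≤ x.valuation := by
  rw [← Ideal.mem_span_singleton, PadicInt.mem_span_pow_iff_le_valuation x hx]

lemma PadicInt.emultiplicity_eq_valuation {x : ℤ_[ℓ]} (hx : x ≠ 0) :
    emultiplicity (ℓ : ℤ_[ℓ]) x = x.valuation := by
  rw [emultiplicity_eq_coe, PadicInt.pow_dvd_iff_le_valuation hx,
    PadicInt.pow_dvd_iff_le_valuation hx]
  omega

lemma PadicInt.dvd_iff_toZMod_eq_zero (x : ℤ_[ℓ]) :
    (ℓ : ℤ_[ℓ]) ∣ x ↔ PadicInt.toZMod x = 0 := by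
  rw [← RingHom.mem_ker, PadicInt.ker_toZMod, PadicInt.maximalIdeal_eq_span_p,
    Ideal.mem_span_singleton]

lemma PadicInt.dvd_pow_sub_one {x : ℤ_[ℓ]} (hx : ¬ (ℓ : ℤ_[ℓ]) ∣ x) :
    (ℓ : ℤ_[ℓ]) ∣ x ^ (ℓ - 1) - 1 := by
  rw [PadicInt.dvd_iff_toZMod_eq_zero] at hx ⊢
  rw [map_sub, map_pow, ZMod.pow_card_sub_one_eq_one hx, map_one, sub_self]

/-- For y ≡ 1 modulo 4 the factor y + 1 of y² - 1 is divisible by 2 exactly once. -/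
lemma emultiplicity_sq_sub_one {y : ℤ_[ℓ]} (h2 : ℓ = 2) (hy : (ℓ : ℤ_[ℓ]) ^ 2 ∣ y - 1) :
    emultiplicity (ℓ : ℤ_[ℓ]) (y ^ 2 - 1) = emultiplicity (ℓ : ℤ_[ℓ]) (y - 1) + 1 := by
  have hp := PadicInt.prime_p (p := ℓ)
  have e : y ^ 2 - 1 = (y - 1) * (y + 1) := by ring
  obtain ⟨c, hc⟩ := hy
  have hy1 : y + 1 = ℓ * (1 + ℓ * c) := by
    rw [sub_eq_iff_eq_add.1 hc]
    subst h2
    push_cast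
    ring
  rw [e, emultiplicity_mul hp]
  congr 1
  refine (emultiplicity_eq_coe (n := 1)).2 ?_
  rw [hy1, pow_one, pow_succ, pow_one,
    mul_dvd_mul_iff_left hp.ne_zero]
  refine ⟨dvd_mul_right _ _, fun h => hp.not_isUnit (isUnit_of_dvd_one ?_)⟩
  exact (dvd_add_left (dvd_mul_right _ _)).1 h

/-- The lifting-the-exponent lemma in `ℤ_ℓ`. -/
lemma PadicInt.valuation_pow_sub_one {y : ℤ_[ℓ]} (hy : (ℓ : ℤ_[ℓ]) ∣ y - 1)
    (hy2 : ℓ = 2 → (ℓ : ℤ_[ℓ]) ^ 2 ∣ y - 1) (hne : ∀ n, n ≠ 0 → y ^ n ≠ 1) {n : ℕ} (hn : n ≠ 0) :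
    (y ^ n - 1).valuation = (y - 1).valuation + padicValNat ℓ n := by
  have hℓ : ℓ.Prime := Fact.out
  have hp := PadicInt.prime_p (p := ℓ)
  have hndvd {z : ℤ_[ℓ]} (hz : (ℓ : ℤ_[ℓ]) ∣ z - 1) : ¬ (ℓ : ℤ_[ℓ]) ∣ z := fun h =>
    hp.not_isUnit (isUnit_of_dvd_one (by simpa using dvd_sub h hz))
  -- Each factor ℓ of the exponent raises the valuation by one, and the part m prime to ℓ does not
  -- change it.
  obtain ⟨a, m, hm, rfl⟩ := Nat.exists_eq_pow_mul_and_not_dvd hn ℓ hℓ.ne_one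
  have hpow (a : ℕ) : emultiplicity (ℓ : ℤ_[ℓ]) (y ^ ℓ ^ a - 1) =
      emultiplicity (ℓ : ℤ_[ℓ]) (y - 1) + a := by
    by_cases h2 : ℓ = 2
    · induction a with
      | zero => simp
      | succ a ih =>
        have hd : (ℓ : ℤ_[ℓ]) ^ 2 ∣ y ^ ℓ ^ a - 1 :=
          (hy2 h2).trans (by simpa using sub_dvd_pow_sub_pow y 1 (ℓ ^ a))
        have e : y ^ ℓ ^ (a + 1) = (y ^ ℓ ^ a) ^ 2 := by
          rw [pow_succ, pow_mul]
          congr 1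
        rw [e, emultiplicity_sq_sub_one h2 hd, ih, Nat.cast_add, Nat.cast_one, add_assoc]
    · simpa using emultiplicity_pow_prime_pow_sub_pow_prime_pow hp (hℓ.odd_of_ne_two h2) hy
        (hndvd hy) a
  have hd : (ℓ : ℤ_[ℓ]) ∣ y ^ ℓ ^ a - 1 := hy.trans (by simpa using sub_dvd_pow_sub_pow y 1 (ℓ ^ a))
  have hm' : ¬ (ℓ : ℤ_[ℓ]) ∣ m := fun h => hm (by
    have h' : (ℓ : ℤ_[ℓ]) ^ 1 ∣ ((m : ℤ) : ℤ_[ℓ]) := by simpa using h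
    rw [PadicInt.pow_p_dvd_int_iff, pow_one] at h'
    exact_mod_cast h')
  have h := emultiplicity_pow_sub_pow_of_prime hp (x := y ^ ℓ ^ a) (y := 1) hd (hndvd hd) hm'
  rw [one_pow, ← pow_mul, hpow, PadicInt.emultiplicity_eq_valuation (sub_ne_zero.2 (hne _ hn)),
    PadicInt.emultiplicity_eq_valuation (sub_ne_zero.2 (by simpa using hne 1 one_ne_zero))] at h
  have h' : (y ^ (ℓ ^ a * m) - 1).valuation = (y - 1).valuation + a := by exact_mod_cast h
  rw [h', padicValNat.mul (pow_ne_zero a hℓ.ne_zero) (by rintro rfl; exact hm (dvd_zero ℓ)),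
    padicValNat.prime_pow, padicValNat.eq_zero_of_not_dvd hm, add_zero]

variable {x : ℤ_[ℓ]}

/-- For x = 2c + 1 one has x² - 1 = 4c(c + 1), and c(c + 1) is even. -/
lemma PadicInt.pow_three_dvd_sq_sub_one (hx : ¬ (ℓ : ℤ_[ℓ]) ∣ x) (h2 : ℓ = 2) :
    (ℓ : ℤ_[ℓ]) ^ 3 ∣ x ^ 2 - 1 := by
  have hodd {z : ℤ_[ℓ]} (hz : ¬ (ℓ : ℤ_[ℓ]) ∣ z) : (ℓ : ℤ_[ℓ]) ∣ z - 1 := by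
    have := PadicInt.dvd_pow_sub_one hz
    rwa [show ℓ - 1 = 1 by omega, pow_one] at this
  obtain ⟨c, hc⟩ := hodd hx
  have hcc : (ℓ : ℤ_[ℓ]) ∣ c * (c + 1) := by
    by_cases h : (ℓ : ℤ_[ℓ]) ∣ c
    · exact h.mul_right _
    · refine Dvd.dvd.mul_left ?_ _
      have := dvd_add (hodd h) (dvd_refl (ℓ : ℤ_[ℓ]))
      rw [show (c - 1 + ℓ : ℤ_[ℓ]) = c + 1 by subst h2; push_cast; ring] at this
      exact this
  obtain ⟨b, hb⟩ := hcc
  refine ⟨b, ?_⟩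
  have e : x = ℓ * c + 1 := by rw [← hc]; ring
  have h2' : (ℓ : ℤ_[ℓ]) = 2 := by subst h2; norm_num
  rw [h2'] at e hb ⊢
  rw [e]
  linear_combination 4 * hb

lemma unitLevel_of_ne_two (h2 : ℓ ≠ 2) : unitLevel x = (x ^ (ℓ - 1) - 1).valuation := if_neg h2

lemma one_le_unitLevel (hx : ¬ (ℓ : ℤ_[ℓ]) ∣ x) (hne : ∀ n, n ≠ 0 → x ^ n ≠ 1) :
    1 ≤ unitLevel x := by
  have hℓ : ℓ.Prime := Fact.out
  by_cases h2 : ℓ = 2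
  · rw [unitLevel, if_pos h2]
    have := (PadicInt.pow_dvd_iff_le_valuation (sub_ne_zero.2 (hne 2 two_ne_zero)) 3).1
      (PadicInt.pow_three_dvd_sq_sub_one hx h2)
    omega
  · rw [unitLevel_of_ne_two h2, ← PadicInt.pow_dvd_iff_le_valuation
      (sub_ne_zero.2 (hne _ (by have := hℓ.two_le; omega))), pow_one]
    exact PadicInt.dvd_pow_sub_one hx

/-- The 1 subtracted in `unitLevel` at ℓ = 2 is restored by the factor 2 of the exponent 2n. -/
lemma valuation_pow_two_mul_sub_one (hx : ¬ (ℓ : ℤ_[ℓ]) ∣ x) (hne : ∀ n, n ≠ 0 → x ^ n ≠ 1)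
    (h2 : ℓ = 2) {n : ℕ} (hn : n ≠ 0) :
    (x ^ (2 * n) - 1).valuation = unitLevel x + padicValNat ℓ (2 * n) := by
  have h3 := PadicInt.pow_three_dvd_sq_sub_one hx h2
  rw [pow_mul, PadicInt.valuation_pow_sub_one ((dvd_pow_self _ three_ne_zero).trans h3)
    (fun _ => (pow_dvd_pow _ (by norm_num)).trans h3)
    (fun m hm => by rw [← pow_mul]; exact hne _ (mul_ne_zero two_ne_zero hm)) hn, unitLevel,
    if_pos h2, padicValNat.mul two_ne_zero hn]
  have := (PadicInt.pow_dvd_iff_le_valuation (sub_ne_zero.2 (hne 2 two_ne_zero)) 3).1 h3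
  have h1 : padicValNat ℓ 2 = 1 := by subst h2; exact padicValNat_self
  omega

/-- For odd ℓ the exponent ℓ - 1 may be replaced by d because the cofactor (ℓ - 1) / d is prime to
ℓ. For ℓ = 2 one has d = 1, and the exponent 1 behaves regularly once x ≡ 1 modulo 4. -/
lemma valuation_pow_sub_one_of_dvd (hx : ¬ (ℓ : ℤ_[ℓ]) ∣ x) (hne : ∀ n, n ≠ 0 → x ^ n ≠ 1)
    {d : ℕ} (hd : d ∣ ℓ - 1) (hxd : (ℓ : ℤ_[ℓ]) ∣ x ^ d - 1)
    (h2 : ℓ = 2 → (ℓ : ℤ_[ℓ]) ^ 2 ∣ x - 1) {n : ℕ} (hn : n ≠ 0) :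
    (x ^ (d * n) - 1).valuation = unitLevel x + padicValNat ℓ n := by
  have hℓ : ℓ.Prime := Fact.out
  have hℓ1 : ℓ - 1 ≠ 0 := by have := hℓ.two_le; omega
  have hd0 : d ≠ 0 := fun h => hℓ1 (by rw [h] at hd; exact zero_dvd_iff.1 hd)
  have hne' (m : ℕ) (hm : m ≠ 0) : (x ^ d) ^ m ≠ 1 := by
    rw [← pow_mul]
    exact hne _ (mul_ne_zero hd0 hm)
  have h2' (h : ℓ = 2) : (ℓ : ℤ_[ℓ]) ^ 2 ∣ x ^ d - 1 :=
    (h2 h).trans (by simpa using sub_dvd_pow_sub_pow x 1 d)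
  rw [pow_mul, PadicInt.valuation_pow_sub_one hxd h2' hne' hn]
  congr 1
  by_cases h : ℓ = 2
  · obtain rfl : d = 1 := Nat.dvd_one.1 (by rwa [h] at hd)
    have h1 := valuation_pow_two_mul_sub_one hx hne h one_ne_zero
    have h3 := PadicInt.valuation_pow_sub_one hxd h2' hne' (two_ne_zero)
    rw [pow_one] at h3 ⊢
    rw [mul_one, h3] at h1
    omega
  · obtain ⟨e, he⟩ := hd
    have he0 : e ≠ 0 := by rintro rfl; exact hℓ1 he
    have hed : e ∣ ℓ - 1 := ⟨d, by rw [he, mul_comm]⟩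
    rw [unitLevel_of_ne_two h, he, pow_mul, PadicInt.valuation_pow_sub_one hxd h2' hne' he0,
      padicValNat.eq_zero_of_not_dvd, add_zero]
    intro hle
    have := Nat.le_of_dvd (Nat.pos_of_ne_zero hℓ1) (hle.trans hed)
    have := hℓ.two_le
    omega

/-- x^n - 1 divides x^((ℓ-1)n) - 1, whose valuation is known. For ℓ = 2 it is compared with x^(2n) -
1, whose other factor x^n + 1 is even. -/
lemma valuation_pow_sub_one_le (hx : ¬ (ℓ : ℤ_[ℓ]) ∣ x) (hne : ∀ n, n ≠ 0 → x ^ n ≠ 1)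
    {n : ℕ} (hn : n ≠ 0) : (x ^ n - 1).valuation ≤ unitLevel x + padicValNat ℓ n := by
  have hℓ : ℓ.Prime := Fact.out
  by_cases h2 : ℓ = 2
  · have h := valuation_pow_two_mul_sub_one hx hne h2 hn
    have hp : x ^ n + 1 ≠ 0 := fun h0 => hne (2 * n) (mul_ne_zero two_ne_zero hn) (by
      rw [mul_comm, pow_mul, eq_neg_of_add_eq_zero_left h0]
      ring)
    have e : x ^ (2 * n) - 1 = (x ^ n - 1) * (x ^ n + 1) := by ring
    rw [e, PadicInt.valuation_mul (sub_ne_zero.2 (hne n hn)) hp, padicValNat.mul two_ne_zero hn,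
      show padicValNat ℓ 2 = 1 by subst h2; exact padicValNat_self] at h
    have h1 : 1 ≤ (x ^ n + 1).valuation := by
      rw [← PadicInt.pow_dvd_iff_le_valuation hp, pow_one]
      have h3 := PadicInt.dvd_pow_sub_one hx
      rw [show ℓ - 1 = 1 by omega, pow_one] at h3
      have h4 := (h3.trans (by simpa using sub_dvd_pow_sub_pow x 1 n)).add (dvd_refl (ℓ : ℤ_[ℓ]))
      rwa [show (x ^ n - 1 + ℓ : ℤ_[ℓ]) = x ^ n + 1 by subst h2; push_cast; ring] at h4
    omega
  · have h := valuation_pow_sub_one_of_dvd hx hne dvd_rfl (PadicInt.dvd_pow_sub_one hx)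
      (fun h => absurd h h2) hn
    rw [← h, ← PadicInt.pow_dvd_iff_le_valuation (sub_ne_zero.2 (hne _
      (mul_ne_zero (by have := hℓ.two_le; omega) hn)))]
    refine ((PadicInt.pow_dvd_iff_le_valuation (sub_ne_zero.2 (hne n hn)) _).2 le_rfl).trans ?_
    rw [mul_comm, pow_mul]
    simpa using sub_dvd_pow_sub_pow (x ^ n) 1 (ℓ - 1)

end UnitLevel

/-! ### Diagonalizable endomorphisms on torsion points -/

section Diagonal

variable {ℓ : ℕ} [Fact ℓ.Prime] {A : Type*} [AddCommGroup A] {v w : tateModule ℓ A}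
  {φ : A →+ A} {lam mu : ℤ_[ℓ]}

lemma tateModule_smul_apply_add (x : tateModule ℓ A) (a : ℤ_[ℓ]) (n m : ℕ) :
    (((ℓ : ℤ_[ℓ]) ^ m * a) • x).1 (n + m) = (a • x).1 n := by
  rw [mul_smul, ← Nat.cast_pow, tateModule_natCast_smul_apply, tateModule_pow_smul_apply]

lemma map_iterate_eigenvectors (hv : tateMap ℓ φ v = lam • v) (hw : tateMap ℓ φ w = mu • w)
    (a b : ℤ_[ℓ]) (n N : ℕ) :
    φ^[N] ((a • v + b • w).1 n) = ((a * lam ^ N) • v + (b * mu ^ N) • w).1 n := by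
  induction N with
  | zero => simp
  | succ N ih =>
    rw [Function.iterate_succ_apply', ih]
    change (tateMap ℓ φ ((a * lam ^ N) • v + (b * mu ^ N) • w)).1 n = _
    rw [map_add, map_smul, map_smul, hv, hw, smul_smul, smul_smul, mul_assoc, mul_assoc,
      ← pow_succ, ← pow_succ]

namespace IsTateBasis

lemma apply_eq_iff (h : IsTateBasis v w) {a b a' b' : ℤ_[ℓ]} {n : ℕ} :
    (a • v + b • w).1 n = (a' • v + b' • w).1 n ↔
      (ℓ : ℤ_[ℓ]) ^ n ∣ a - a' ∧ (ℓ : ℤ_[ℓ]) ^ n ∣ b - b' := by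
  constructor
  · intro hab
    refine (h n).1 _ _ ?_
    have e : (a - a') • v + (b - b') • w = (a • v + b • w) - (a' • v + b' • w) := by module
    rw [e, tateModule_sub_apply, hab, sub_self]
  · rintro ⟨h₁, h₂⟩
    rw [tateModule_add_apply, tateModule_add_apply, tateModule_smul_apply_congr h₁,
      tateModule_smul_apply_congr h₂]

lemma iterate_eq_iff (h : IsTateBasis v w) (hv : tateMap ℓ φ v = lam • v)
    (hw : tateMap ℓ φ w = mu • w) {a b : ℤ_[ℓ]} {n N : ℕ} :
    φ^[N] ((a • v + b • w).1 n) = (a • v + b • w).1 n ↔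
      (ℓ : ℤ_[ℓ]) ^ n ∣ a * (lam ^ N - 1) ∧ (ℓ : ℤ_[ℓ]) ^ n ∣ b * (mu ^ N - 1) := by
  rw [map_iterate_eigenvectors hv hw, h.apply_eq_iff, mul_sub, mul_sub, mul_one, mul_one]

/-- The single point with both coordinates 1 detects both divisibilities. -/
lemma forall_iterate_eq_iff (h : IsTateBasis v w) (hv : tateMap ℓ φ v = lam • v)
    (hw : tateMap ℓ φ w = mu • w) (n N : ℕ) :
    (∀ P : A, ℓ ^ n • P = 0 → φ^[N] P = P) ↔
      (ℓ : ℤ_[ℓ]) ^ n ∣ lam ^ N - 1 ∧ (ℓ : ℤ_[ℓ]) ^ n ∣ mu ^ N - 1 := by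
  constructor
  · intro H
    have h1 := (h.iterate_eq_iff hv hw).1 (H _ (tateModule_pow_smul ((1 : ℤ_[ℓ]) • v +
      (1 : ℤ_[ℓ]) • w) n))
    simpa only [one_mul] using h1
  · rintro ⟨h₁, h₂⟩ P hP
    obtain ⟨a, b, rfl⟩ := (h n).2 P hP
    exact (h.iterate_eq_iff hv hw).2 ⟨h₁.mul_left a, h₂.mul_left b⟩

end IsTateBasis

/-- The homomorphism `(a, b) ↦ a v_r + b w_s`. -/
def tatePair (v w : tateModule ℓ A) (r s : ℕ) : ZMod (ℓ ^ r) × ZMod (ℓ ^ s) →+ A :=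
  (ZMod.lift (ℓ ^ r) ⟨zmultiplesHom A (v.1 r), by
    rw [zmultiplesHom_apply, natCast_zsmul, tateModule_pow_smul]⟩).coprod
  (ZMod.lift (ℓ ^ s) ⟨zmultiplesHom A (w.1 s), by
    rw [zmultiplesHom_apply, natCast_zsmul, tateModule_pow_smul]⟩)

lemma tatePair_natCast (r s a b : ℕ) : tatePair v w r s (a, b) = a • v.1 r + b • w.1 s := by
  rw [tatePair, AddMonoidHom.coprod_apply, ← Int.cast_natCast a, ← Int.cast_natCast b,
    ZMod.lift_coe, ZMod.lift_coe]
  simp only [zmultiplesHom_apply, natCast_zsmul]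

lemma exists_tatePair_eq (r s : ℕ) (a b : ℤ_[ℓ]) :
    ∃ x, tatePair v w r s x = (a • v).1 r + (b • w).1 s := by
  obtain ⟨m, -, hm⟩ := tateModule_smul_apply_eq_nsmul (A := A) a r
  obtain ⟨n, -, hn⟩ := tateModule_smul_apply_eq_nsmul (A := A) b s
  exact ⟨(m, n), by rw [tatePair_natCast, hm, hn]⟩

lemma tatePair_eq (r s : ℕ) (x : ZMod (ℓ ^ r) × ZMod (ℓ ^ s)) : ∃ a b : ℕ, x = ((a : ZMod (ℓ ^ r)), (b : ZMod (ℓ ^ s))) ∧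
    tatePair v w r s x =
      (((ℓ : ℤ_[ℓ]) ^ s * a) • v + ((ℓ : ℤ_[ℓ]) ^ r * b) • w).1 (r + s) := by
  have : NeZero (ℓ ^ r) := ⟨pow_ne_zero _ (Fact.out : ℓ.Prime).ne_zero⟩
  have : NeZero (ℓ ^ s) := ⟨pow_ne_zero _ (Fact.out : ℓ.Prime).ne_zero⟩
  obtain ⟨a, b⟩ := x
  obtain ⟨a, rfl⟩ := ZMod.natCast_zmod_surjective a
  obtain ⟨b, rfl⟩ := ZMod.natCast_zmod_surjective b
  refine ⟨a, b, rfl, ?_⟩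
  rw [tatePair_natCast, tateModule_add_apply, tateModule_smul_apply_add, add_comm r s,
    tateModule_smul_apply_add, tateModule_natCast_smul_apply, tateModule_natCast_smul_apply]

namespace IsTateBasis

lemma tatePair_injective (h : IsTateBasis v w) (r s : ℕ) :
    Function.Injective (tatePair v w r s) := by
  refine (injective_iff_map_eq_zero _).2 fun x hx => ?_
  have hℓ : (ℓ : ℤ_[ℓ]) ≠ 0 := PadicInt.prime_p.ne_zero
  obtain ⟨a, b, rfl, e⟩ := tatePair_eq (v := v) (w := w) r s x
  rw [e] at hx
  obtain ⟨h₁, h₂⟩ := (h _).1 _ _ hx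
  rw [add_comm r s, pow_add, mul_dvd_mul_iff_left (pow_ne_zero s hℓ)] at h₁
  rw [pow_add, mul_dvd_mul_iff_left (pow_ne_zero r hℓ)] at h₂
  have key {a n : ℕ} (h : (ℓ : ℤ_[ℓ]) ^ n ∣ a) : (a : ZMod (ℓ ^ n)) = 0 := by
    have h' : (ℓ : ℤ_[ℓ]) ^ n ∣ ((a : ℤ) : ℤ_[ℓ]) := by exact_mod_cast h
    rw [PadicInt.pow_p_dvd_int_iff] at h'
    rw [ZMod.natCast_eq_zero_iff]
    exact_mod_cast h'
  rw [key h₁, key h₂]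
  rfl

/-- The `ℓ`-power torsion points fixed by an iterate of a diagonalizable endomorphism. -/
theorem nonempty_addEquiv_of_fixed (h : IsTateBasis v w) (hv : tateMap ℓ φ v = lam • v)
    (hw : tateMap ℓ φ w = mu • w) {N : ℕ} (hl : lam ^ N ≠ 1) (hm : mu ^ N ≠ 1)
    (H : AddSubgroup A) (hH : ∀ P, P ∈ H ↔ (∃ n, ℓ ^ n • P = 0) ∧ φ^[N] P = P) :
    Nonempty (H ≃+ ZMod (ℓ ^ (lam ^ N - 1).valuation) × ZMod (ℓ ^ (mu ^ N - 1).valuation)) := by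
  have hℓ : (ℓ : ℤ_[ℓ]) ≠ 0 := PadicInt.prime_p.ne_zero
  set r := (lam ^ N - 1).valuation with hr
  set s := (mu ^ N - 1).valuation with hs
  have hr' (n : ℕ) (a : ℤ_[ℓ]) :
      (ℓ : ℤ_[ℓ]) ^ (n + r) ∣ a * (lam ^ N - 1) ↔ (ℓ : ℤ_[ℓ]) ^ n ∣ a := by
    rw [PadicInt.unitCoeff_spec (sub_ne_zero.2 hl), ← hr, ← mul_assoc, pow_add,
      mul_dvd_mul_iff_right (pow_ne_zero r hℓ), Units.dvd_mul_right]
  have hs' (n : ℕ) (a : ℤ_[ℓ]) :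
      (ℓ : ℤ_[ℓ]) ^ (n + s) ∣ a * (mu ^ N - 1) ↔ (ℓ : ℤ_[ℓ]) ^ n ∣ a := by
    rw [PadicInt.unitCoeff_spec (sub_ne_zero.2 hm), ← hs, ← mul_assoc, pow_add,
      mul_dvd_mul_iff_right (pow_ne_zero s hℓ), Units.dvd_mul_right]
  have hrange : (tatePair v w r s).range = H := by
    ext P
    rw [hH]
    constructor
    · rintro ⟨x, rfl⟩
      obtain ⟨a, b, -, e⟩ := tatePair_eq (v := v) (w := w) r s x
      rw [e]
      refine ⟨⟨r + s, tateModule_pow_smul _ _⟩, (h.iterate_eq_iff hv hw).2 ⟨?_, ?_⟩⟩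
      · rw [add_comm r s, hr']
        exact dvd_mul_right _ _
      · rw [hs']
        exact dvd_mul_right _ _
    · rintro ⟨⟨n, hn⟩, hP⟩
      -- Level n + r + s is high enough that being fixed forces ℓ^(n+s) to divide a and ℓ^(n+r) to
      -- divide b, so P descends to levels r and s.
      obtain ⟨a, b, rfl⟩ := (h (n + r + s)).2 P (by
        rw [add_assoc, add_comm, pow_add, mul_smul, hn, smul_zero])
      obtain ⟨ha, hb⟩ := (h.iterate_eq_iff hv hw).1 hP
      rw [add_right_comm, hr'] at ha
      rw [hs'] at hb
      obtain ⟨a, rfl⟩ := ha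
      obtain ⟨b, rfl⟩ := hb
      obtain ⟨x, hx⟩ := exists_tatePair_eq (v := v) (w := w) r s a b
      refine ⟨x, ?_⟩
      rw [hx, tateModule_add_apply, show n + r + s = r + (n + s) by ring,
        tateModule_smul_apply_add, show r + (n + s) = s + (n + r) by ring,
        tateModule_smul_apply_add]
  exact ⟨(AddEquiv.addSubgroupCongr hrange).symm.trans
    (AddMonoidHom.ofInjective (h.tatePair_injective r s)).symm⟩

lemma exists_tatePair_eq_of_smul_eq_zero (h : IsTateBasis v w) {j : ℕ} {P : A}
    (hP : ℓ ^ j • P = 0) : ∃ x, tatePair v w j j x = P := by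
  obtain ⟨a, b, rfl⟩ := (h j).2 P hP
  exact exists_tatePair_eq j j a b

lemma finite_torsion (h : IsTateBasis v w) (j : ℕ) : {P : A | ℓ ^ j • P = 0}.Finite := by
  have : NeZero (ℓ ^ j) := ⟨pow_ne_zero _ (Fact.out : ℓ.Prime).ne_zero⟩
  exact (Set.finite_range (tatePair v w j j)).subset fun P hP =>
    h.exists_tatePair_eq_of_smul_eq_zero hP

/-- A bound for the number of classes of `A[ℓ^j]` modulo a relation which contains the orbits of
`φ^d`. -/
theorem card_quotient_le (h : IsTateBasis v w) (hv : tateMap ℓ φ v = lam • v)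
    (hw : tateMap ℓ φ w = mu • w) (hmu : ¬ (ℓ : ℤ_[ℓ]) ∣ mu) {d β : ℕ} (hβ : 1 ≤ β)
    (hd : ∀ i n, i ≠ 0 → (ℓ : ℤ_[ℓ]) ^ n ∣ mu ^ (d * i) - 1 → n ≤ β + padicValNat ℓ i)
    {j : ℕ} (hj : 1 ≤ j) (S : Setoid {P : A // ℓ ^ j • P = 0})
    (hS : ∀ P Q i, φ^[d * i] P.1 = Q.1 → S P Q) :
    Finite (Quotient S) ∧ Nat.card (Quotient S) ≤ j * ℓ ^ (j + β) := by
  have hℓ : ℓ.Prime := Fact.out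
  have hnz (n : ℕ) : NeZero (ℓ ^ n) := ⟨pow_ne_zero _ hℓ.ne_zero⟩
  have hp := PadicInt.prime_p (p := ℓ)
  have hfin : Finite {P : A // ℓ ^ j • P = 0} := (h.finite_torsion j).to_subtype
  have hfinQ : Finite (Quotient S) := inferInstance
  refine ⟨hfinQ, ?_⟩
  have := Fintype.ofFinite (Quotient S)
  -- B(t) holds the points of A[ℓ^j] whose w-coordinate is killed by ℓ^t.
  let B (t : ℕ) : Finset A := Finset.univ.image (tatePair v w j t)
  have hB (t : ℕ) : (B t).card ≤ ℓ ^ (j + t) := by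
    refine Finset.card_image_le.trans ?_
    rw [Finset.card_univ, Fintype.card_prod, ZMod.card, ZMod.card, pow_add]
  have hmemB {t : ℕ} (ht : t ≤ j) {a b : ℤ_[ℓ]} (hb : (ℓ : ℤ_[ℓ]) ^ (j - t) ∣ b) :
      (a • v + b • w).1 j ∈ B t := by
    obtain ⟨b, rfl⟩ := hb
    obtain ⟨x, hx⟩ := exists_tatePair_eq (v := v) (w := w) j t a b
    refine Finset.mem_image.2 ⟨x, Finset.mem_univ _, ?_⟩
    rw [hx, tateModule_add_apply]
    congr 1
    conv_rhs => rw [show j = t + (j - t) by omega]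
    rw [show t + (j - t) - t = j - t by omega, tateModule_smul_apply_add]
  rw [Nat.card_eq_fintype_card]
  choose a b hab using fun c : Quotient S => (h j).2 c.out.1 c.out.2
  have horbit (c : Quotient S) (i : ℕ) (hi : ℓ ^ j • φ^[d * i] c.out.1 = 0) :
      c = Quotient.mk S ⟨φ^[d * i] c.out.1, hi⟩ := by
    refine (Quotient.out_eq c).symm.trans (Quotient.sound ?_)
    exact hS _ _ i rfl
  have hzero (P : {P : A // ℓ ^ j • P = 0}) (i : ℕ) : ℓ ^ j • φ^[i] P.1 = 0 := by
    rw [← iterate_map_nsmul, P.2, iterate_map_zero]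
  rcases lt_or_ge j β with hjβ | hjβ
  · rw [← Finset.card_univ]
    have hle : (Finset.univ : Finset (Quotient S)).card ≤ (B j).card :=
      Finset.card_le_card_of_injOn (fun c => c.out.1)
        (fun c _ => by
          change c.out.1 ∈ B j
          rw [← hab c]
          exact hmemB le_rfl (by simp))
        (fun c _ c' _ hcc => Quotient.out_injective (Subtype.ext hcc))
    refine (hle.trans (hB j)).trans ?_
    calc ℓ ^ (j + j) ≤ ℓ ^ (j + β) := Nat.pow_le_pow_right hℓ.pos (by omega)
      _ ≤ j * ℓ ^ (j + β) := Nat.le_mul_of_pos_left _ hj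
  have hex (c : Quotient S) : ∃ t, β ≤ t ∧ (ℓ : ℤ_[ℓ]) ^ (j - t) ∣ b c := ⟨j, hjβ, by simp⟩
  -- Classes are sorted by the least t ≥ β for which their representative lies in B(t).
  let τ (c : Quotient S) : ℕ := Nat.find (hex c)
  have hτ (c : Quotient S) : β ≤ τ c ∧ (ℓ : ℤ_[ℓ]) ^ (j - τ c) ∣ b c := Nat.find_spec (hex c)
  have hτj (c : Quotient S) : τ c ≤ j := Nat.find_min' (hex c) ⟨hjβ, by simp⟩
  have hbucket (t : ℕ) (ht : t ∈ Finset.Icc β j) :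
      (Finset.univ.filter fun c : Quotient S => τ c = t).card ≤ ℓ ^ (j + β) := by
    rw [Finset.mem_Icc] at ht
    -- A class of level t contributes ℓ^(t-β) distinct points of B(t), and different classes share
    -- none. Dividing |B(t)| ≤ ℓ^(j+t) by this leaves at most ℓ^(j+β) classes.
    have hinj : ((Finset.univ.filter fun c : Quotient S => τ c = t) ×ˢ
        Finset.range (ℓ ^ (t - β))).card ≤ (B t).card := by
      refine Finset.card_le_card_of_injOn (fun x => φ^[d * x.2] x.1.out.1) ?_ ?_
      · rintro ⟨c, i⟩ hc
        rw [Finset.mem_coe, Finset.mem_product, Finset.mem_filter] at hc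
        change φ^[d * i] c.out.1 ∈ B t
        rw [← hab c, map_iterate_eigenvectors hv hw]
        refine hmemB ht.2 (Dvd.dvd.mul_right ?_ _)
        rw [← hc.1.2]
        exact (hτ c).2
      · have hlt (c : Quotient S) (hc : τ c = t) (i i' : ℕ) (hii : i < i')
            (hi' : i' < ℓ ^ (t - β)) : φ^[d * i] c.out.1 ≠ φ^[d * i'] c.out.1 := by
          intro heq
          rw [← hab c, map_iterate_eigenvectors hv hw, map_iterate_eigenvectors hv hw] at heq
          have hdvd := (h.apply_eq_iff.1 heq.symm).2
          obtain ⟨b', hb'⟩ := (hτ c).2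
          rw [hc] at hb'
          have e : b c * mu ^ (d * i') - b c * mu ^ (d * i) =
              (ℓ : ℤ_[ℓ]) ^ (j - t) * ((b' * mu ^ (d * i)) * (mu ^ (d * (i' - i)) - 1)) := by
            have hpw : mu ^ (d * i') = mu ^ (d * i) * mu ^ (d * (i' - i)) := by
              rw [← pow_add, ← mul_add, Nat.add_sub_cancel' hii.le]
            rw [hb', hpw]
            ring
          have ej : (ℓ : ℤ_[ℓ]) ^ j = (ℓ : ℤ_[ℓ]) ^ (j - t) * (ℓ : ℤ_[ℓ]) ^ t := by
            rw [← pow_add, Nat.sub_add_cancel ht.2]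
          rw [e, ej, mul_dvd_mul_iff_left (pow_ne_zero _ hp.ne_zero)] at hdvd
          have htβ : β < t := by
            rcases ht.1.lt_or_eq with h | h
            · exact h
            · rw [← h, Nat.sub_self, pow_zero] at hi'
              omega
          have hb'' : ¬ (ℓ : ℤ_[ℓ]) ∣ b' * mu ^ (d * i) := by
            rw [hp.dvd_mul, not_or]
            refine ⟨fun ⟨b'', hb''⟩ => ?_, fun h => hmu (hp.dvd_of_dvd_pow h)⟩
            -- Were b' divisible by ℓ, the level t - 1 ≥ β would already do.
            refine Nat.find_min (hex c) (m := t - 1)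
              (by change t - 1 < τ c; omega) ⟨by omega, b'', ?_⟩
            rw [hb', hb'', show j - (t - 1) = j - t + 1 by omega, pow_succ]
            ring
          have h1 := hp.pow_dvd_of_dvd_mul_left t hb'' hdvd
          have h2 := hd _ _ (by omega) h1
          have h3 : ℓ ^ (t - β) ∣ i' - i :=
            (pow_dvd_pow ℓ (by omega : t - β ≤ padicValNat ℓ (i' - i))).trans pow_padicValNat_dvd
          have h4 := Nat.le_of_dvd (by omega) h3
          omega
        rintro ⟨c, i⟩ hc ⟨c', i'⟩ hc' heq
        rw [Finset.mem_coe, Finset.mem_product, Finset.mem_filter, Finset.mem_range] at hc hc'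
        change φ^[d * i] c.out.1 = φ^[d * i'] c'.out.1 at heq
        obtain rfl : c = c' := by
          rw [horbit c i (hzero _ _), horbit c' i' (hzero _ _)]
          congr 1
          exact Subtype.ext heq
        rcases lt_trichotomy i i' with hii | rfl | hii
        · exact absurd heq (hlt c hc.1.2 i i' hii hc'.2)
        · rfl
        · exact absurd heq.symm (hlt c hc.1.2 i' i hii hc.2)
    rw [Finset.card_product, Finset.card_range] at hinj
    have h5 := hinj.trans (hB t)
    rw [show j + t = j + β + (t - β) by omega, pow_add] at h5
    exact Nat.le_of_mul_le_mul_right h5 (pow_pos hℓ.pos _)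
  -- There are j + 1 - β levels, at most j because β ≥ 1.
  have hcard := Finset.card_le_mul_card_image_of_maps_to (s := Finset.univ) (f := τ)
    (t := Finset.Icc β j) (fun c _ => Finset.mem_Icc.2 ⟨(hτ c).1, hτj c⟩) _ hbucket
  rw [Finset.card_univ, Nat.card_Icc] at hcard
  refine hcard.trans ?_
  rw [mul_comm]
  exact Nat.mul_le_mul_right _ (by omega)

end IsTateBasis

end Diagonal

/-! ### Eigenvalues of the Frobenius endomorphism -/

section Eigenvalues

variable {ℓ : ℕ} [Fact ℓ.Prime]

lemma not_dvd_of_kroneckerAtPrime_eq_one {d : ℤ} (h : kroneckerAtPrime d ℓ = 1) :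
    ¬ (ℓ : ℤ) ∣ d := by
  intro hd
  rw [kroneckerAtPrime] at h
  split_ifs at h with h2
  · subst h2
    rw [ZMod.χ₈_int_eq_if_mod_eight, if_pos (Int.emod_eq_zero_of_dvd (by exact_mod_cast hd))] at h
    exact zero_ne_one h
  · rw [(legendreSym.eq_zero_iff ℓ d).2 ((ZMod.intCast_zmod_eq_zero_iff_dvd d ℓ).2 hd)] at h
    exact zero_ne_one h

section Abstract

variable {A : Type*} [AddCommGroup A] {φ : A →+ A} {lam mu : ℤ_[ℓ]} {v w : tateModule ℓ A}

/-- An eigenvector divided by the largest possible power of ℓ stays an eigenvector, since the module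
is torsion-free. -/
lemma exists_primitive_eigenvector (h : (tateMap ℓ φ).HasEigenvalue lam) :
    ∃ u : tateModule ℓ A, tateMap ℓ φ u = lam • u ∧ u.1 1 ≠ 0 := by
  obtain ⟨v, hv⟩ := h.exists_hasEigenvector
  obtain ⟨n, u, rfl, hu⟩ := exists_apply_one_ne_zero hv.2
  refine ⟨u, ?_, hu⟩
  have := hv.apply_eq_smul
  rw [map_smul, smul_comm] at this
  rw [← sub_eq_zero]
  refine tateModule_smul_eq_zero (a := (ℓ : ℤ_[ℓ]) ^ n) ?_
    (pow_ne_zero n PadicInt.prime_p.ne_zero)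
  rw [smul_sub, this, sub_self]

lemma not_dvd_eigenvalue (hφ : Function.Injective φ) (hv : tateMap ℓ φ v = lam • v)
    (hv1 : v.1 1 ≠ 0) : ¬ (ℓ : ℤ_[ℓ]) ∣ lam := by
  intro h
  refine hv1 (hφ ?_)
  rw [map_zero]
  change (tateMap ℓ φ v).1 1 = 0
  rw [hv]
  exact tateModule_smul_apply_eq_zero (by rwa [pow_one]) v

lemma apply_ne_apply_of_lt (hv1 : v.1 1 ≠ 0) {m n : ℕ} (h : m < n) : v.1 m ≠ v.1 n := by
  intro heq
  refine hv1 ?_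
  have h1 := tateModule_pow_smul_apply v 1 (n - 1)
  rw [Nat.add_sub_cancel' (by omega : 1 ≤ n), ← heq, show n - 1 = (n - 1 - m) + m by omega, pow_add,
    mul_smul, tateModule_pow_smul, smul_zero] at h1
  exact h1.symm

/-- Otherwise φ^N would fix the infinitely many points v_n. This keeps λ^N - 1 nonzero, where its
valuation is meaningful. -/
lemma eigenvalue_pow_ne_one (hfin : ∀ N, N ≠ 0 → {P : A | φ^[N] P = P}.Finite)
    (hv : tateMap ℓ φ v = lam • v) (hv1 : v.1 1 ≠ 0) (N : ℕ) (hN : N ≠ 0) : lam ^ N ≠ 1 := by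
  intro h
  refine Set.infinite_range_of_injective (f := v.1) ?_ ((hfin N hN).subset ?_)
  · intro m n hmn
    by_contra hne
    rcases lt_or_gt_of_ne hne with h | h
    · exact apply_ne_apply_of_lt hv1 h hmn
    · exact apply_ne_apply_of_lt hv1 h hmn.symm
  · rintro _ ⟨n, rfl⟩
    have := map_iterate_eigenvectors hv hv 1 0 n N
    rw [h, mul_one, zero_mul, zero_smul, add_zero, one_smul] at this
    exact this

lemma dvd_card_ker_of_eigenvector (hv : tateMap ℓ φ v = lam • v) (hv1 : v.1 1 ≠ 0) {m : ℕ}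
    (hm : (m : ZMod ℓ) = PadicInt.toZMod lam) :
    ℓ ∣ Nat.card (nsmulAddMonoidHom (α := A) m - φ).ker := by
  have hmem : v.1 1 ∈ (nsmulAddMonoidHom (α := A) m - φ).ker := by
    rw [AddMonoidHom.mem_ker, AddMonoidHom.sub_apply, nsmulAddMonoidHom_apply, sub_eq_zero,
      ← tateModule_natCast_smul_apply]
    change _ = (tateMap ℓ φ v).1 1
    rw [hv]
    refine tateModule_smul_apply_congr ?_ v
    rw [pow_one, PadicInt.dvd_iff_toZMod_eq_zero, map_sub, map_natCast, hm, sub_self]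
  have hord : addOrderOf (⟨v.1 1, hmem⟩ : (nsmulAddMonoidHom (α := A) m - φ).ker) = ℓ := by
    refine addOrderOf_eq_prime (Subtype.ext ?_) fun h => hv1 (congrArg Subtype.val h)
    have := tateModule_pow_smul v 1
    rwa [pow_one] at this
  rw [← hord]
  exact addOrderOf_dvd_natCard _

/-- Cauchy's theorem gives a point of order ℓ on which φ is m; one of its coordinates is nonzero
modulo ℓ. -/
lemma IsTateBasis.eq_or_eq_of_dvd_card_ker (h : IsTateBasis v w) (hv : tateMap ℓ φ v = lam • v)
    (hw : tateMap ℓ φ w = mu • w) {m : ℕ} (hm0 : Nat.card (nsmulAddMonoidHom (α := A) m - φ).ker ≠ 0)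
    (hm : ℓ ∣ Nat.card (nsmulAddMonoidHom (α := A) m - φ).ker) :
    (m : ZMod ℓ) = PadicInt.toZMod lam ∨ (m : ZMod ℓ) = PadicInt.toZMod mu := by
  have hfin := Nat.finite_of_card_ne_zero hm0
  obtain ⟨⟨P, hP⟩, hord⟩ := exists_prime_addOrderOf_dvd_card' ℓ hm
  rw [AddSubgroup.addOrderOf_mk] at hord
  have hP0 : P ≠ 0 := by
    rintro rfl
    rw [addOrderOf_zero] at hord
    exact (Fact.out : ℓ.Prime).one_lt.ne hord
  obtain ⟨a, b, rfl⟩ := (h 1).2 P (by rw [pow_one, ← hord, addOrderOf_nsmul_eq_zero])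
  rw [AddMonoidHom.mem_ker, AddMonoidHom.sub_apply, nsmulAddMonoidHom_apply, sub_eq_zero,
    ← tateModule_natCast_smul_apply] at hP
  have h1 := map_iterate_eigenvectors hv hw a b 1 1
  rw [Function.iterate_one, ← hP, smul_add, smul_smul, smul_smul, h.apply_eq_iff, pow_one, pow_one,
    pow_one] at h1
  have key {c z : ℤ_[ℓ]} (hc : (ℓ : ℤ_[ℓ]) ∣ m * c - c * z) (hne : (m : ZMod ℓ) ≠ PadicInt.toZMod z) :
      (ℓ : ℤ_[ℓ]) ∣ c := by
    rw [show (m : ℤ_[ℓ]) * c - c * z = c * (m - z) by ring, PadicInt.prime_p.dvd_mul] at hc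
    refine hc.resolve_right fun hc => hne ?_
    rw [PadicInt.dvd_iff_toZMod_eq_zero, map_sub, map_natCast, sub_eq_zero] at hc
    exact hc
  by_contra! hne
  refine hP0 ?_
  rw [tateModule_add_apply, tateModule_smul_apply_eq_zero (by rw [pow_one]; exact key h1.1 hne.1),
    tateModule_smul_apply_eq_zero (by rw [pow_one]; exact key h1.2 hne.2), add_zero]

lemma exists_natCast_zmod_eq {p : ℕ} (hp : p.Prime) (hℓ : ℓ ≠ p) (c : ZMod ℓ) (M : ℕ) :
    ∃ m : ℕ, M ≤ m ∧ ¬ p ∣ m ∧ (m : ZMod ℓ) = c := by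
  have hℓp : ℓ.Prime := Fact.out
  obtain ⟨x, hx₁, hx₂⟩ := Nat.chineseRemainder ((Nat.coprime_primes hℓp hp).2 hℓ) c.val 1
  refine ⟨x + ℓ * p * M, ?_, ?_, ?_⟩
  · have : M ≤ ℓ * p * M := Nat.le_mul_of_pos_left M (mul_pos hℓp.pos hp.pos)
    omega
  · intro h
    rw [Nat.dvd_add_left ((dvd_mul_left p ℓ).mul_right M)] at h
    have h1 : 1 ≡ 0 [MOD p] := hx₂.symm.trans (Nat.modEq_zero_iff_dvd.2 h)
    exact hp.one_lt.ne' (Nat.dvd_one.1 (Nat.modEq_zero_iff_dvd.1 h1))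
  · rw [(ZMod.natCast_eq_natCast_iff _ _ _).2 (show x + ℓ * p * M ≡ x [MOD ℓ] from ?_),
      (ZMod.natCast_eq_natCast_iff _ _ _).2 hx₁, ZMod.natCast_zmod_val]
    rw [mul_assoc]
    exact (Nat.modEq_zero_iff_dvd.2 (dvd_mul_right ℓ _)).add_left x

/-- If the kernels of `m - φ` have order `m² - t m + q`, then `q` is the determinant of `φ`
modulo `ℓ`. -/
theorem IsTateBasis.natCast_eq_mul_of_card_ker (h : IsTateBasis v w)
    (hv : tateMap ℓ φ v = lam • v) (hw : tateMap ℓ φ w = mu • w) (hv1 : v.1 1 ≠ 0)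
    (hw1 : w.1 1 ≠ 0) {p : ℕ} (hp : p.Prime) (hℓ : ℓ ≠ p) {q : ℕ} (hq : q ≠ 0) {t : ℤ}
    (ht : ∀ m : ℕ, ¬ p ∣ m →
      (Nat.card (nsmulAddMonoidHom (α := A) m - φ).ker : ℤ) = m ^ 2 - t * m + q) :
    (q : ZMod ℓ) = PadicInt.toZMod lam * PadicInt.toZMod mu := by
  have hdvd {m : ℕ} (hm : ¬ p ∣ m) :
      ℓ ∣ Nat.card (nsmulAddMonoidHom (α := A) m - φ).ker ↔ (m : ZMod ℓ) ^ 2 - t * m + q = 0 := by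
    rw [← ZMod.natCast_eq_zero_iff, ← Int.cast_natCast, ht m hm]
    push_cast
    rfl
  have hroot {c : ZMod ℓ} (hc : c ^ 2 - t * c + q = 0) :
      c = PadicInt.toZMod lam ∨ c = PadicInt.toZMod mu := by
    -- Taking m ≥ |t| makes m(m - t) + q positive, so the kernel is finite and nonempty as a count.
    obtain ⟨m, hM, hm, rfl⟩ := exists_natCast_zmod_eq hp hℓ c (t.natAbs)
    refine h.eq_or_eq_of_dvd_card_ker hv hw (fun h0 => ?_) ((hdvd hm).2 hc)
    have h1 := ht m hm
    rw [h0] at h1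
    have h2 : t ≤ m := by omega
    have h3 : (0 : ℤ) ≤ m * (m - t) := mul_nonneg (by positivity) (by omega)
    have h4 : (0 : ℤ) < q := by exact_mod_cast Nat.pos_of_ne_zero hq
    push_cast at h1
    nlinarith
  have hlam : (PadicInt.toZMod lam) ^ 2 - t * PadicInt.toZMod lam + q = (0 : ZMod ℓ) := by
    obtain ⟨m, -, hm, e⟩ := exists_natCast_zmod_eq hp hℓ (PadicInt.toZMod lam) 0
    have := (hdvd hm).1 (dvd_card_ker_of_eigenvector hv hv1 e)
    rwa [e] at this
  have hmu : (PadicInt.toZMod mu) ^ 2 - t * PadicInt.toZMod mu + q = (0 : ZMod ℓ) := by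
    obtain ⟨m, -, hm, e⟩ := exists_natCast_zmod_eq hp hℓ (PadicInt.toZMod mu) 0
    have := (hdvd hm).1 (dvd_card_ker_of_eigenvector hw hw1 e)
    rwa [e] at this
  -- The roots of X² - tX + q modulo ℓ are exactly λ and μ. If they coincide, the conjugate root t -
  -- λ must equal λ as well; otherwise their sum is t.
  by_cases heq : PadicInt.toZMod lam = PadicInt.toZMod mu
  · have h1 : (t : ZMod ℓ) - PadicInt.toZMod lam = PadicInt.toZMod lam := by
      have h2 := hroot (c := t - PadicInt.toZMod lam) (by linear_combination hlam)
      rwa [← heq, or_self] at h2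
    rw [← heq]
    linear_combination hlam + PadicInt.toZMod lam * h1
  · have h1 : (t : ZMod ℓ) = PadicInt.toZMod lam + PadicInt.toZMod mu := by
      refine sub_eq_zero.1 ((mul_eq_zero.1 (?_ : (PadicInt.toZMod lam - PadicInt.toZMod mu) *
        (t - (PadicInt.toZMod lam + PadicInt.toZMod mu)) = 0)).resolve_left (sub_ne_zero.2 heq))
      linear_combination hmu - hlam
    rw [h1] at hlam
    linear_combination hlam

end Abstract

section Curve

variable {k : Type*} [Field k] (E : WeierstrassCurve k) [E.IsElliptic] {p : ℕ} [Fact p.Prime]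
  [CharP k p]

lemma exists_nsmul_eq_geomPoint {m : ℕ} (hm : m ≠ 0) (P : GeomPoint E) : ∃ Q, m • Q = P := by
  have : (E⁄(AlgebraicClosure k)).IsElliptic :=
    inferInstanceAs (E.map (algebraMap k (AlgebraicClosure k))).IsElliptic
  exact WeierstrassCurve.mulHom_surjective (W := E.baseChange (AlgebraicClosure k)) hm P

lemma card_torsion_geomPoint (hp : p ≠ 2) (hℓ : ℓ ≠ p) :
    Nat.card {P : GeomPoint E // ℓ • P = 0} = ℓ ^ 2 := by
  have : (E⁄(AlgebraicClosure k)).IsElliptic :=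
    inferInstanceAs (E.map (algebraMap k (AlgebraicClosure k))).IsElliptic
  have : CharP (AlgebraicClosure k) p := charP_of_injective_algebraMap' k p
  have key {r : ℕ} (hr : r.Prime) (h : r ≠ p) : (r : AlgebraicClosure k) ≠ 0 := fun h0 =>
    h ((Nat.prime_dvd_prime_iff_eq Fact.out hr).1 ((CharP.cast_eq_zero_iff _ p r).1 h0)).symm
  exact WeierstrassCurve.card_ker_mulHom (W := E.baseChange (AlgebraicClosure k))
    (by exact_mod_cast key Nat.prime_two hp.symm) (key Fact.out hℓ)

end Curve

end Eigenvalues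

/-! ### Degrees of torsion fields -/

section Degrees

variable {ℓ : ℕ} [Fact ℓ.Prime] {lam mu : ℤ_[ℓ]} {α β : ℕ} {d : ℕ → ℕ}

lemma Nat.eq_of_forall_dvd_iff {a b : ℕ} (h : ∀ n, a ∣ n ↔ b ∣ n) : a = b :=
  Nat.dvd_antisymm ((h b).2 dvd_rfl) ((h a).1 dvd_rfl)

lemma pow_sub_dvd_iff {j β n : ℕ} (hn : n ≠ 0) : ℓ ^ (j - β) ∣ n ↔ j ≤ β + padicValNat ℓ n := by
  rw [padicValNat_dvd_iff_le hn]
  omega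

/-- If the valuations of `λ ^ (D n) - 1` and `μ ^ (D n) - 1` are given by lifting the exponent, then
this determines the orders of the diagonal matrix `(λ, μ)` modulo powers of `ℓ`. -/
lemma dvd_iff_of_valuation (hβα : β ≤ α)
    (hd : ∀ j N, d j ∣ N ↔ (ℓ : ℤ_[ℓ]) ^ j ∣ lam ^ N - 1 ∧ (ℓ : ℤ_[ℓ]) ^ j ∣ mu ^ N - 1)
    (hl : ∀ N, N ≠ 0 → lam ^ N ≠ 1) (hm : ∀ N, N ≠ 0 → mu ^ N ≠ 1) {D i : ℕ}
    (hDi : d i = D)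
    (hvl : ∀ n, n ≠ 0 → (lam ^ (D * n) - 1).valuation = α + padicValNat ℓ (D * n))
    (hvm : ∀ n, n ≠ 0 → (mu ^ (D * n) - 1).valuation = β + padicValNat ℓ (D * n)) {j : ℕ}
    (hij : i ≤ j) (N : ℕ) : d j ∣ N ↔ D ∣ N ∧ ℓ ^ (j - β) ∣ N := by
  have hsub (hN : d j ∣ N) : D ∣ N := by
    rw [← hDi, hd]
    exact ((hd j N).1 hN).imp (pow_dvd_pow _ hij).trans (pow_dvd_pow _ hij).trans
  by_cases hN : N = 0
  · simp [hN]
  refine (and_iff_right_of_imp hsub).symm.trans (and_congr_right ?_)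
  rintro ⟨n, rfl⟩
  have hn : n ≠ 0 := right_ne_zero_of_mul hN
  rw [hd, PadicInt.pow_dvd_iff_le_valuation (sub_ne_zero.2 (hl _ hN)),
    PadicInt.pow_dvd_iff_le_valuation (sub_ne_zero.2 (hm _ hN)), hvl n hn, hvm n hn,
    pow_sub_dvd_iff hN]
  omega

end Degrees

/-! ### Torsion fields, rational torsion and conjugacy classes -/

theorem mainTheorem7 {p ℓ : ℕ} [Fact p.Prime] [Fact ℓ.Prime] (hp : p ≠ 2) (hℓ : ℓ ≠ p)
    {k : Type*} [Field k] [Fintype k] [CharP k p]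
    (E : WeierstrassCurve k) [E.IsElliptic] (hord : IsOrdinary E p)
    {K : Type*} [Field K] [NumberField K] (e : (ℚ ⊗[ℤ] endRing E) ≃+* K)
    (hmax : IsEllMaximal E ℓ e) (hsplit : kroneckerAtPrime (NumberField.discr K) ℓ = 1)
    (lam mu : ℤ_[ℓ]) (hne : lam ≠ mu)
    (hlam : (tateMap ℓ (curveFrobenius E)).HasEigenvalue lam)
    (hmu : (tateMap ℓ (curveFrobenius E)).HasEigenvalue mu)
    (α β : ℕ) (hα : α = unitLevel lam) (hβ : β = unitLevel mu) (hαβ : β ≤ α)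
    (d : ℕ → ℕ) (hd : ∀ j, d j = torsionDegree E (ℓ ^ j)) :
    (orderOf (Fintype.card k : ZMod ℓ) ∣ d 1 ∧ d 1 ∣ ℓ - 1) ∧
    -- in the exponents the truncated difference is `max 0 (j - β)`, which changes no maximum
    (ℓ ≠ 2 → ∀ j, 1 ≤ j → d j = d 1 * ℓ ^ max (padicValNat ℓ (d 1)) (j - β)) ∧
    (ℓ = 2 → (d 2 = 1 ∨ d 2 = 2) ∧
      ∀ j, 2 ≤ j → d j = ℓ ^ max (padicValNat ℓ (d 2)) (j - β)) ∧
    (∀ n : ℕ, (ℓ = 2 → 1 ≤ n ∨ d 2 = 1) →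
      ∀ F : IntermediateField k (AlgebraicClosure k), Module.finrank k F = d 1 * ℓ ^ n →
        Nonempty (ellPowerTorsion E ℓ F ≃+ ZMod (ℓ ^ (n + α)) × ZMod (ℓ ^ (n + β)))) ∧
    (∀ j, 1 ≤ j →
      ∀ F₁ : IntermediateField k (AlgebraicClosure k), Module.finrank k F₁ = d 1 →
        Finite (GaloisClass E F₁ (ℓ ^ j)) ∧
        Nat.card (GaloisClass E F₁ (ℓ ^ j)) ≤ j * ℓ ^ (j + β)) := by
  have hℓp : ℓ.Prime := Fact.out
  have hpp : p.Prime := Fact.out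
  have hℓ1 : ℓ - 1 ≠ 0 := by have := hℓp.two_le; omega
  set φ := curveFrobenius E with hφ
  have hA := card_torsion_geomPoint (ℓ := ℓ) E hp hℓ
  have hs := exists_nsmul_eq_geomPoint E hℓp.ne_zero
  obtain ⟨v, hv, hv1⟩ := exists_primitive_eigenvector hlam
  obtain ⟨w, hw, hw1⟩ := exists_primitive_eigenvector hmu
  have hvw : IsTateBasis v w :=
    isTateBasis_of_eigenvectors hs hA (endRing E) e hmax
      (not_dvd_of_kroneckerAtPrime_eq_one hsplit) (curveFrobenius_mem_endRing E) hne hv hv1 hw hw1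
  have hfin (N : ℕ) (hN : N ≠ 0) := finite_setOf_curveFrobenius_iterate_eq E hN
  have hlu := not_dvd_eigenvalue (curveFrobenius_injective E) hv hv1
  have hmu' := not_dvd_eigenvalue (curveFrobenius_injective E) hw hw1
  have hl := eigenvalue_pow_ne_one hfin hv hv1
  have hm := eigenvalue_pow_ne_one hfin hw hw1
  have hβ1 : 1 ≤ β := hβ ▸ one_le_unitLevel hmu' hm
  -- From here on the curve enters the degrees only through this divisibility criterion.
  have hd' (j N : ℕ) : d j ∣ N ↔ (ℓ : ℤ_[ℓ]) ^ j ∣ lam ^ N - 1 ∧ (ℓ : ℤ_[ℓ]) ^ j ∣ mu ^ N - 1 := by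
    rw [hd, torsionDegree_dvd_iff E (hvw.finite_torsion j), hvw.forall_iterate_eq_iff hv hw]
  have hd1 : d 1 ∣ ℓ - 1 := by
    rw [hd', pow_one]
    exact ⟨PadicInt.dvd_pow_sub_one hlu, PadicInt.dvd_pow_sub_one hmu'⟩
  have hd10 : d 1 ≠ 0 := fun h => hℓ1 (zero_dvd_iff.1 (h ▸ hd1))
  have hd1v : padicValNat ℓ (d 1) = 0 := padicValNat.eq_zero_of_not_dvd fun h => by
    have := Nat.le_of_dvd (Nat.pos_of_ne_zero hℓ1) (h.trans hd1)
    have := hℓp.two_le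
    omega
  have hdvd1 : (ℓ : ℤ_[ℓ]) ∣ lam ^ d 1 - 1 ∧ (ℓ : ℤ_[ℓ]) ∣ mu ^ d 1 - 1 := by
    have := (hd' 1 (d 1)).1 dvd_rfl
    rwa [pow_one] at this
  have hsq : ℓ = 2 → d 2 = 1 →
      (ℓ : ℤ_[ℓ]) ^ 2 ∣ lam - 1 ∧ (ℓ : ℤ_[ℓ]) ^ 2 ∣ mu - 1 := fun _ h => by
    have := (hd' 2 1).1 (by rw [h])
    rwa [pow_one, pow_one] at this
  -- The exact valuations are measured from the exponent d_1 when ℓ is odd or d_2 = 1; if ℓ = 2 and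
  -- d_2 = 2, they are measured from the exponent 2.
  have hvl (h2 : ℓ = 2 → d 2 = 1) (n : ℕ) (hn : n ≠ 0) :
      (lam ^ (d 1 * n) - 1).valuation = α + padicValNat ℓ (d 1 * n) := by
    rw [valuation_pow_sub_one_of_dvd hlu hl hd1 hdvd1.1 (fun h => (hsq h (h2 h)).1) hn, ← hα,
      padicValNat.mul hd10 hn, hd1v, zero_add]
  have hvm (h2 : ℓ = 2 → d 2 = 1) (n : ℕ) (hn : n ≠ 0) :
      (mu ^ (d 1 * n) - 1).valuation = β + padicValNat ℓ (d 1 * n) := by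
    rw [valuation_pow_sub_one_of_dvd hmu' hm hd1 hdvd1.2 (fun h => (hsq h (h2 h)).2) hn, ← hβ,
      padicValNat.mul hd10 hn, hd1v, zero_add]
  have hvl2 (h2 : ℓ = 2) (n : ℕ) (hn : n ≠ 0) :
      (lam ^ (2 * n) - 1).valuation = α + padicValNat ℓ (2 * n) :=
    hα ▸ valuation_pow_two_mul_sub_one hlu hl h2 hn
  have hvm2 (h2 : ℓ = 2) (n : ℕ) (hn : n ≠ 0) :
      (mu ^ (2 * n) - 1).valuation = β + padicValNat ℓ (2 * n) :=
    hβ ▸ valuation_pow_two_mul_sub_one hmu' hm h2 hn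
  have hd12 (h2 : ℓ = 2) : d 1 = 1 := Nat.dvd_one.1 (by simpa [h2] using hd1)
  have hd2 (h2 : ℓ = 2) : d 2 = 1 ∨ d 2 = 2 := by
    refine (Nat.dvd_prime Nat.prime_two).1 ?_
    rw [hd']
    exact ⟨(pow_dvd_pow _ (by norm_num)).trans (PadicInt.pow_three_dvd_sq_sub_one hlu h2),
      (pow_dvd_pow _ (by norm_num)).trans (PadicInt.pow_three_dvd_sq_sub_one hmu' h2)⟩
  refine ⟨⟨?_, hd1⟩, fun h2 j hj => ?_, fun h2 => ⟨hd2 h2, fun j hj => ?_⟩, fun n hn F hF => ?_,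
    fun j hj F₁ hF₁ => ?_⟩
  -- Since q ≡ λμ modulo ℓ, and both eigenvalues have d_1-th power 1 modulo ℓ, so has q.
  · obtain ⟨t, ht⟩ := exists_card_ker_mulHom_sub_curveFrobenius E hp
    have hq := hvw.natCast_eq_mul_of_card_ker hv hw hv1 hw1 hpp hℓ Fintype.card_ne_zero ht
    rw [orderOf_dvd_iff_pow_eq_one, hq, mul_pow]
    obtain ⟨h₁, h₂⟩ := hdvd1
    rw [PadicInt.dvd_iff_toZMod_eq_zero, map_sub, map_pow, map_one, sub_eq_zero] at h₁ h₂
    rw [h₁, h₂, one_mul]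
  · rw [hd1v, Nat.zero_max]
    refine Nat.eq_of_forall_dvd_iff fun N => ?_
    rw [dvd_iff_of_valuation hαβ hd' hl hm rfl (hvl fun h => absurd h h2)
      (hvm fun h => absurd h h2) hj]
    refine ⟨fun h => Nat.Coprime.mul_dvd_of_dvd_of_dvd ?_ h.1 h.2, fun h =>
      ⟨(dvd_mul_right _ _).trans h, (dvd_mul_left _ _).trans h⟩⟩
    refine Nat.Coprime.pow_right _ (Nat.Coprime.symm ((Nat.Prime.coprime_iff_not_dvd hℓp).2 ?_))
    intro h
    have := Nat.le_of_dvd (Nat.pos_of_ne_zero hℓ1) (h.trans hd1)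
    omega
  · refine Nat.eq_of_forall_dvd_iff fun N => ?_
    rcases hd2 h2 with h | h
    · rw [dvd_iff_of_valuation hαβ hd' hl hm rfl (hvl fun _ => h) (hvm fun _ => h)
        (by omega : 1 ≤ j), hd12 h2, h, padicValNat_one_right, Nat.zero_max]
      simp
    · rw [dvd_iff_of_valuation hαβ hd' hl hm h (hvl2 h2) (hvm2 h2) hj, h,
        show padicValNat ℓ 2 = 1 by subst h2; exact padicValNat_self]
      rcases le_total 1 (j - β) with hle | hle
      · rw [max_eq_right hle]
        exact and_iff_right_of_imp ((show 2 ∣ ℓ ^ (j - β) by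
          rw [h2]; exact dvd_pow_self 2 (by omega)).trans)
      · rw [max_eq_left hle, pow_one]
        refine (and_iff_left_of_imp ?_).trans (by rw [h2])
        rw [← h2]
        exact ((pow_dvd_pow ℓ hle).trans (by rw [pow_one])).trans
  · have hN0 : d 1 * ℓ ^ n ≠ 0 := mul_ne_zero hd10 (pow_ne_zero n hℓp.ne_zero)
    have hvN : padicValNat ℓ (d 1 * ℓ ^ n) = n := by
      rw [padicValNat.mul hd10 (pow_ne_zero n hℓp.ne_zero), hd1v, zero_add, padicValNat.prime_pow]
    have hval : (lam ^ (d 1 * ℓ ^ n) - 1).valuation = n + α ∧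
        (mu ^ (d 1 * ℓ ^ n) - 1).valuation = n + β := by
      by_cases h2 : ℓ = 2 → d 2 = 1
      · rw [hvl h2 _ (pow_ne_zero n hℓp.ne_zero), hvm h2 _ (pow_ne_zero n hℓp.ne_zero), hvN]
        exact ⟨add_comm _ _, add_comm _ _⟩
      -- Here ℓ = 2 and d_2 = 2, so n ≥ 1 and the exponent is even.
      · obtain ⟨h2, h⟩ := Classical.not_imp.1 h2
        obtain ⟨n, rfl⟩ := Nat.exists_eq_add_of_le ((hn h2).resolve_right h)
        have e : d 1 * ℓ ^ (1 + n) = 2 * ℓ ^ n := by rw [hd12 h2, pow_add, pow_one, one_mul, h2]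
        rw [e] at hvN ⊢
        rw [hvl2 h2 _ (pow_ne_zero n hℓp.ne_zero), hvm2 h2 _ (pow_ne_zero n hℓp.ne_zero), hvN]
        exact ⟨add_comm _ _, add_comm _ _⟩
    have hinj := WeierstrassCurve.Affine.Point.map_injective (W' := E) F.val
    let H := (ellPowerTorsion E ℓ F).map (WeierstrassCurve.Affine.Point.map (W' := E) F.val)
    have hH (P : GeomPoint E) : P ∈ H ↔ (∃ m, ℓ ^ m • P = 0) ∧ φ^[d 1 * ℓ ^ n] P = P := by
      rw [← hF, ← range_map_val_eq E F (hF ▸ hN0)]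
      constructor
      · rintro ⟨Q, ⟨m, hm⟩, rfl⟩
        exact ⟨⟨m, by rw [← map_nsmul, hm, map_zero]⟩, Q, rfl⟩
      · rintro ⟨⟨m, hm⟩, Q, rfl⟩
        exact ⟨Q, ⟨m, hinj (by rw [map_nsmul, hm, map_zero])⟩, rfl⟩
    obtain ⟨g⟩ := hvw.nonempty_addEquiv_of_fixed hv hw (hl _ hN0) (hm _ hN0) H hH
    rw [hval.1, hval.2] at g
    exact ⟨((ellPowerTorsion E ℓ F).equivMapOfInjective _ hinj).trans g⟩
  -- An upper bound for the valuation of μ^(d_1 i) - 1 suffices, so ℓ = 2 with d_2 = 2 needs no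
  -- separate treatment.
  · refine hvw.card_quotient_le hv hw hmu' hβ1 (d := d 1) (fun i r hi h => ?_) hj _ fun P Q i h => ?_
    · have hN : d 1 * i ≠ 0 := mul_ne_zero hd10 hi
      rw [PadicInt.pow_dvd_iff_le_valuation (sub_ne_zero.2 (hm _ hN))] at h
      have := h.trans (valuation_pow_sub_one_le hmu' hm hN)
      rwa [padicValNat.mul hd10 hi, hd1v, zero_add, ← hβ] at this
    · exact galoisSetoid_of_iterate E F₁ (hF₁ ▸ hd10) P Q i (hF₁.symm ▸ h)
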